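/- Throughout, \(n\ge 8\), \(p\in[1,2]\), \(q\in[2,\infty]\), \(\frac1p+\frac1q=1\), and \(\rho_n=\min\{q-1,\,16\ln n-8\}\,n^{\frac2q-1}\) (for \(q=\infty\) the minimum is \(16\ln n-8\) and \(2/q=0\)). **Problem.** Let \(\xi\) have distribution \(P\), and let \(f(x)=\mathbb E_\xi F(x,\xi)\) on \(\mathbb R^n\), with \(F(x,\cdot)\) integrable. For \(P\)-almost every \(\xi\), \(F(\cdot,\xi)\) is convex with gradient \(g(\cdot,\xi)\) that is \(L(\xi)\)-Lipschitz in the Euclidean norm; \(L_2=\sqrt{\mathbb E L(\xi)^2}\in(0,\infty)\); \(\mathbb E_\xi\|g(x,\xi)-\nabla f(x)\|_2^2\le\sigma^2\) for all \(x\); and \(f\) has a minimizer \(x_*\). For \(x\in\mathbb R^n\) and \(\|e\|_2=1\) an oracle returns \(\widetilde f'(x,\xi,e)=\langle g(x,\xi),e\rangle+\zeta(x,\xi,e)+\eta(x,\xi,e)\), where \(\mathbb E_\xi\,\zeta(x,\xi,e)^2\le\Delta_\zeta\) and \(|\eta(x,\xi,e)|\le\Delta_\eta\) almost surely in \(\xi\),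 for all such \(x\), \(e\) (\(\zeta\), \(\eta\), \(g\) are jointly measurable). **Method.** A prox-function (with respect to \(\|\cdot\|_p\)) is a differentiable \(d:\mathbb R^n\to\mathbb R\) with \(\min d=0\) and \(d(y)-d(x)-\langle\nabla d(x),y-x\rangle\ge\frac12\|y-x\|_p^2\) for all \(x,y\); put \(V[z](x)=d(x)-d(z)-\langle\nabla d(z),x-z\rangle\). The Randomized Directional Derivative (RDD) method with starting point \(x_0\), \(N\ge1\) iterations and batch size \(m\ge1\) sets, for \(k=0,\dots,N-1\), \[\widetilde\nabla^m f(x_k)=\frac1m\sum_{i=1}^m\widetilde f'(x_k,\xi_{k+1,i},e_{k+1})\,e_{k+1},\qquad x_{k+1}=\arg\min_{x}\bigl\{\alpha n\langle\widetilde\nabla^m f(x_k),x-x_k\rangle+V[x_k](x)\bigr\},\quad \alpha=\frac1{48n\rho_nL_2},\] where the \(e_{k}\) are uniform on the Euclidean unit sphere, the \(\xi_{k,i}\) have distribution \(P\), and all of them are independent. It returns \(\bar x_N=\frac1N\sum_{k=0}^{N-1}x_k\) and makes \(Nm\) oracle calls. Put \(\Theta_p=V[x_0](x_*)\). **Theorem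 2.** (0) The functions \(d_1(x)=\frac{e\,n^{(\kappa-1)(2-\kappa)/\kappa}\ln n}{2}\|x\|_\kappa^2\), \(\kappa=1+\frac1{\ln n}\), and \(d_2(x)=\frac12\|x\|_2^2\) are prox-functions with respect to \(\|\cdot\|_1\) and \(\|\cdot\|_2\), respectively. (1) For every prox-function, \(f(\bar x_N)\) is integrable and \[\mathbb E[f(\bar x_N)]-f(x_*)\le\frac{384n\rho_nL_2\Theta_p}{N}+\frac{2}{L_2}\frac{\sigma^2}{m}+\frac{n}{12L_2}\Delta_\zeta+\frac{4n}{3L_2}\Delta_\eta^2+\frac{8\sqrt{2n\Theta_p}}{N}\Bigl(\frac{\sqrt{\Delta_\zeta}}2+2\Delta_\eta\Bigr)+\frac{N}{3L_2\rho_n}\Bigl(\frac{\sqrt{\Delta_\zeta}}2+2\Delta_\eta\Bigr)^2.\] (2) There is an absolute constant \(C>0\) such that for all \(n,p,q\) as above and all \(L_2,\Theta,\varepsilon>0\), \(\sigma\ge0\) there are \(N,m\ge1\) with \[N\le C\max\Bigl\{1,\frac{n\rho_nL_2\Theta}{\varepsilon}\Bigr\},\quad m\le C\max\Bigl\{1,\frac{\sigma^2}{\varepsilon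 L_2}\Bigr\},\quad Nm\le C\max\Bigl\{1,\frac{n\rho_nL_2\Theta}{\varepsilon},\frac{n\rho_n\sigma^2\Theta}{\varepsilon^2}\Bigr\}\] such that \(\mathbb E[f(\bar x_N)]-f(x_*)\le\varepsilon\) for every prox-function, every problem with these \(L_2\), \(\sigma\) and with \(\Theta_p\le\Theta\), and every noise with \(\Delta_\zeta\) and \(\Delta_\eta^2\) at most \(\frac1C\min\{\frac{\varepsilon^2}{n\Theta},\frac{\varepsilon L_2}{n}\}\). (3) In particular the complexity is \(\widetilde O\bigl(\max\bigl\{\frac{n^{2/q}L_2R_p^2}{\varepsilon},\frac{n^{2/q}\sigma^2R_p^2}{\varepsilon^2}\bigr\}\bigr)\), where \(\widetilde O\) hides powers of \(\ln n\) and at least one call is always made: there are absolute constants \(C>0\), \(c\in\mathbb N\) such that for \(p\in\{1,2\}\), all \(n\ge 8\) and all \(L_2,R_p,\varepsilon>0\), \(\sigma\ge0\) there are \(N,m\ge1\) with \[Nm\le C(\ln n)^c\max\Bigl\{1,\frac{n^{2/q}L_2R_p^2}{\varepsilon},\frac{n^{2/q}\sigma^2R_p^2}{\varepsilon^2}\Bigr\}\]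 such that the RDD method with prox-function \(x\mapsto d_p(x-x_0)\) satisfies \(\mathbb E[f(\bar x_N)]-f(x_*)\le\varepsilon\) for every problem with these \(L_2\), \(\sigma\) and with \(\|x_0-x_*\|_p\le R_p\), and every noise with \(\Delta_\zeta\) and \(\Delta_\eta^2\) at most \(\frac{1}{C(\ln n)^c}\min\{\frac{\varepsilon^2}{nR_p^2},\frac{\varepsilon L_2}{n}\}\). -/

import Mathlib

open MeasureTheory ProbabilityTheory
open scoped ENNReal RealInnerProductSpace

universe u v

/-- `ℝⁿ` with its Euclidean structure. -/
abbrev Vec (n : ℕ) : Type := EuclideanSpace ℝ (Fin n)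

/-- The `p`-norm `‖x‖_p` on `ℝⁿ`, `p ∈ [1, ∞]`. -/
noncomputable def pNorm {n : ℕ} (p : ℝ≥0∞) (x : Vec n) : ℝ :=
  ‖(WithLp.toLp p (fun i => x i) : PiLp p (fun _ : Fin n => ℝ))‖

/-- The Bregman divergence `V[z](x) = d(x) - d(z) - ⟨∇d(z), x - z⟩`. -/
noncomputable def bregman {n : ℕ} (d : Vec n → ℝ) (z x : Vec n) : ℝ :=
  d x - d z - ⟪gradient d z, x - z⟫

/-- `d` is a prox-function with respect to `‖·‖_p`: it is differentiable on `ℝⁿ`,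
`1`-strongly convex with respect to `‖·‖_p`, and its minimum is `0`.
(Continuity and convexity follow.) -/
structure IsProxFunction {n : ℕ} (p : ℝ≥0∞) (d : Vec n → ℝ) : Prop where
  differentiable : Differentiable ℝ d
  strongly_convex : ∀ x y : Vec n,
    1 / 2 * pNorm p (y - x) ^ 2 ≤ d y - d x - ⟪gradient d x, y - x⟫
  min_eq_zero : IsLeast (Set.range d) 0

/-- `κ = 1 + 1 / ln n`. -/
noncomputable def kappa (n : ℕ) : ℝ := 1 + 1 / Real.log n

/-- The prox-function for `p = 1`:
`d(x) = (e n^{(κ-1)(2-κ)/κ} ln n / 2) ‖x‖_κ²`. -/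
noncomputable def proxOne (n : ℕ) (x : Vec n) : ℝ :=
  Real.exp 1 * (n : ℝ) ^ ((kappa n - 1) * (2 - kappa n) / kappa n) * Real.log n / 2
    * pNorm (ENNReal.ofReal (kappa n)) x ^ 2

/-- The prox-function for `p = 2`: `d(x) = ‖x‖₂² / 2`. -/
noncomputable def proxTwo (n : ℕ) (x : Vec n) : ℝ := 1 / 2 * ‖x‖ ^ 2

/-- The prox-function chosen for `p ∈ {1, 2}`. -/
noncomputable def stdProx (n : ℕ) (p : ℝ≥0∞) : Vec n → ℝ :=
  if p = 1 then proxOne n else proxTwo n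

/-- `ρ_n = min{q - 1, 16 ln n - 8} n^{2/q - 1}`, `q ∈ [2, ∞]`; for `q = ∞` the minimum is
`16 ln n - 8` and `2/q = 0`. -/
noncomputable def rho (n : ℕ) (q : ℝ≥0∞) : ℝ :=
  (min (q - 1) (ENNReal.ofReal (16 * Real.log n - 8))).toReal
    * (n : ℝ) ^ (2 * (q⁻¹).toReal - 1)

/-- The uniform distribution on the Euclidean unit sphere `S₂(1)` of `ℝⁿ`, as a measure on `ℝⁿ`:
the normalized surface measure. -/
noncomputable def sphereUniform (n : ℕ) : Measure (Vec n) :=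
  (((volume : Measure (Vec n)).toSphere Set.univ)⁻¹ •
    (volume : Measure (Vec n)).toSphere).map Subtype.val

/-- The objective `f(x) = E_ξ F(x, ξ)`, where `ξ` has distribution `P`. -/
noncomputable def objective {n : ℕ} {X : Type*} [MeasurableSpace X] (P : Measure X)
    (F : Vec n → X → ℝ) (x : Vec n) : ℝ :=
  ∫ ξ, F x ξ ∂P

/-- The assumptions on the stochastic convex problem `min_x f(x) = E_ξ F(x, ξ)`:
for almost every `ξ` the function `F(·, ξ)` is convex with gradient `g(·, ξ)` that is
`L(ξ)`-Lipschitz in the Euclidean norm, `L₂ = √(E L(ξ)²) < ∞`, and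
`E ‖g(x, ξ) - ∇f(x)‖₂² ≤ σ²` for all `x`. -/
structure IsStochasticProblem {n : ℕ} {X : Type*} [MeasurableSpace X] (P : Measure X)
    (F : Vec n → X → ℝ) (g : Vec n → X → Vec n) (L : X → ℝ) (L₂ σ : ℝ) : Prop where
  integrable : ∀ x, Integrable (F x) P
  measurable_grad : Measurable (fun t : Vec n × X => g t.1 t.2)
  convex : ∀ᵐ ξ ∂P, ConvexOn ℝ Set.univ (fun x => F x ξ)
  hasGradient : ∀ᵐ ξ ∂P, ∀ x, HasGradientAt (fun y => F y ξ) (g x ξ) x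
  lipschitz : ∀ᵐ ξ ∂P, ∀ x y, ‖g x ξ - g y ξ‖ ≤ L ξ * ‖x - y‖
  memLp : MemLp L 2 P
  L₂_eq : L₂ = Real.sqrt (∫ ξ, L ξ ^ 2 ∂P)
  variance : ∀ x, Integrable (fun ξ => ‖g x ξ - gradient (objective P F) x‖ ^ 2) P ∧
    ∫ ξ, ‖g x ξ - gradient (objective P F) x‖ ^ 2 ∂P ≤ σ ^ 2

/-- The assumptions on the two parts `ζ(x, ξ, e)`, `η(x, ξ, e)` of the noise in the directional
derivative: `E_ξ ζ(x, ξ, e)² ≤ Δζ` and `|η(x, ξ, e)| ≤ Δη` almost surely in `ξ`,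
for all `x` and all unit vectors `e`. -/
structure IsNoise {n : ℕ} {X : Type*} [MeasurableSpace X] (P : Measure X)
    (ζ η : Vec n → X → Vec n → ℝ) (Δζ Δη : ℝ) : Prop where
  measurable_zeta : Measurable (fun t : Vec n × X × Vec n => ζ t.1 t.2.1 t.2.2)
  measurable_eta : Measurable (fun t : Vec n × X × Vec n => η t.1 t.2.1 t.2.2)
  zeta_bound : ∀ x e : Vec n, ‖e‖ = 1 →
    Integrable (fun ξ => ζ x ξ e ^ 2) P ∧ ∫ ξ, ζ x ξ e ^ 2 ∂P ≤ Δζ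
  eta_bound : ∀ x e : Vec n, ‖e‖ = 1 → ∀ᵐ ξ ∂P, |η x ξ e| ≤ Δη

/-- The noisy directional derivative `f̃'(x, ξ, e) = ⟨g(x, ξ), e⟩ + ζ(x, ξ, e) + η(x, ξ, e)`. -/
noncomputable def noisyDeriv {n : ℕ} {X : Type*} (g : Vec n → X → Vec n)
    (ζ η : Vec n → X → Vec n → ℝ) (x : Vec n) (ξ : X) (e : Vec n) : ℝ :=
  ⟪g x ξ, e⟫ + ζ x ξ e + η x ξ e

/-- The mini-batch gradient approximation `(1/m) ∑ᵢ f̃'(x, ξᵢ, e) e`; it makes `m` calls of the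
oracle `f̃'`. -/
noncomputable def batchGrad {n m : ℕ} {X : Type*} (fd : Vec n → X → Vec n → ℝ)
    (x : Vec n) (ξ : Fin m → X) (e : Vec n) : Vec n :=
  (1 / (m : ℝ)) • ∑ i, fd x (ξ i) e • e

/-- The randomness of `N` iterations with batch size `m`: the directions `e k` are uniform on the
unit sphere, the `ξ k i` have distribution `P`, and all of these random variables are mutually
independent. (`e k`, `ξ k` are used in iteration `k = 0, …, N - 1`.) -/
structure IsSampling {n N m : ℕ} {X Ω : Type*} [MeasurableSpace X] [MeasurableSpace Ω]
    (μ : Measure Ω) (P : Measure X) (e : Fin N → Ω → Vec n) (ξ : Fin N → Fin m → Ω → X) :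
    Prop where
  measurable_dir : ∀ k, Measurable (e k)
  measurable_sample : ∀ k i, Measurable (ξ k i)
  law_dir : ∀ k, μ.map (e k) = sphereUniform n
  law_sample : ∀ k i, μ.map (ξ k i) = P
  indep : iIndep (Sum.elim
    (fun k : Fin N => MeasurableSpace.comap (e k) inferInstance)
    (fun j : Fin N × Fin m => MeasurableSpace.comap (ξ j.1 j.2) inferInstance)) μ

/-- The step size `α = 1 / (48 n ρ_n L₂)`. -/
noncomputable def rddStep (n : ℕ) (q : ℝ≥0∞) (L₂ : ℝ) : ℝ :=
  1 / (48 * n * rho n q * L₂)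

/-- `x 0, …, x N` are the iterates of the Randomized Directional Derivative method with
prox-function `d`, starting point `x₀`, oracle `fd`, directions `e` and samples `ξ`:
`x_{k+1} = argmin_z { α n ⟨∇̃ᵐf(x_k), z - x_k⟩ + V[x_k](z) }`. -/
structure IsRDDRun {n N m : ℕ} {X Ω : Type*} (q : ℝ≥0∞) (L₂ : ℝ) (d : Vec n → ℝ)
    (fd : Vec n → X → Vec n → ℝ) (x₀ : Vec n) (e : Fin N → Ω → Vec n)
    (ξ : Fin N → Fin m → Ω → X) (x : ℕ → Ω → Vec n) : Prop where
  start : ∀ ω, x 0 ω = x₀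
  step : ∀ (k : Fin N) (ω : Ω), IsMinOn
    (fun z => rddStep n q L₂ * n *
        ⟪batchGrad fd (x k ω) (fun i => ξ k i ω) (e k ω), z - x k ω⟫
      + bregman d (x k ω) z)
    Set.univ (x (k + 1) ω)

/-- The output `x̄_N = (1/N) ∑_{k < N} x_k`. -/
noncomputable def averageIterate {n : ℕ} {Ω : Type*} (N : ℕ) (x : ℕ → Ω → Vec n) (ω : Ω) :
    Vec n :=
  (1 / (N : ℝ)) • ∑ k ∈ Finset.range N, x k ω

/-- `E f(x̄_N) - f(x_*) ≤ B` (with `f(x̄_N)` integrable) for the output of every run of `N`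
iterations with batch size `m` of the Randomized Directional Derivative method with prox-function
`d` and starting point `x₀`, on every problem that has the parameters `L₂`, `σ` and the solution
`x_*`, with every noise of levels `Δζ`, `Δη`. -/
def RDDErrorAtMost (n N m : ℕ) (q : ℝ≥0∞) (d : Vec n → ℝ) (x₀ xs : Vec n)
    (L₂ σ Δζ Δη B : ℝ) : Prop :=
  ∀ (X : Type u) [MeasurableSpace X] (P : Measure X) [IsProbabilityMeasure P]
    (F : Vec n → X → ℝ) (g : Vec n → X → Vec n) (L : X → ℝ) (ζ η : Vec n → X → Vec n → ℝ)
    (Ω : Type v) [MeasurableSpace Ω] (μ : Measure Ω) [IsProbabilityMeasure μ]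
    (e : Fin N → Ω → Vec n) (ξ : Fin N → Fin m → Ω → X) (x : ℕ → Ω → Vec n),
    IsStochasticProblem P F g L L₂ σ →
    (∀ y, objective P F xs ≤ objective P F y) →
    IsNoise P ζ η Δζ Δη →
    IsSampling μ P e ξ →
    IsRDDRun q L₂ d (noisyDeriv g ζ η) x₀ e ξ x →
    Integrable (fun ω => objective P F (averageIterate N x ω)) μ ∧
      (∫ ω, objective P F (averageIterate N x ω) ∂μ) - objective P F xs ≤ B

/-! The argument is mirror descent with the potential `V[x_k](x_*)`. Write `s = α n` and let `G` be
the gradient estimate. Optimality of the step and strong convexity of `d` in an `r'`-norm give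
`V[x_{k+1}](x_*) ≤ V[x_k](x_*) - s ⟨G, x_k - x_*⟩ + s² ‖G‖_r² / 2`, where `r` and `r'` are conjugate
(`bregman_step_le`). The exponent `r ≥ 2` is `q`, or `2 ln n` when `q` is large; in both cases `p ≤
r' ≤ 2` and `(r - 1) n^(2/r - 1) ≤ ρ_n` (`exists_exponent`).

Two facts about a uniform direction `e` drive the estimate: `E ⟨s, e⟩⟨v, e⟩ = ⟨s, v⟩ / n`, and `E
⟨s, e⟩² ‖e‖_r² ≤ (r - 1) n^(2/r - 1) ‖s‖² / n`. Both come from Gaussian moments by homogeneity: the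
integrand is integrated against a Gaussian vector and the radial part is divided out.

Convexity and smoothness give `‖∇f(x)‖² ≤ 4 L₂ (f(x) - f(x_*))`. With the chosen step the gradient
part of the quadratic term then eats only `1/12` of the expected decrease `α (f(x_k) - f(x_*))`. The
noise leaves a constant and a term proportional to `E ‖x_k - x_*‖ ≤ √(2 E V[x_k](x_*))`;
`sum_le_of_recursion` sums such a recursion. Conditioning on the past requires measurable iterates;
these come from the explicit recursion for `∇d(x_k)` and a continuous left inverse of `∇d`. Jensen's
inequality passes to the average.

For the complexity, `N` is a multiple of `n ρ_n L₂ Θ / ε` and `m` of `σ² / (ε L₂)`, rounded up; if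
the former ratio is at most `1/2`, the starting point is already accurate.

That `d₁` is a prox-function rests on the inequality `2 (‖m‖² + (κ - 1) ‖h‖²) ≤ ‖m + h‖² + ‖m - h‖²`
for the `κ`-norm. Since `‖z‖_κ²` is the least of the weighted sums `∑ z_i² r_i^(-(2 - κ)/κ)` over
positive weights of sum one (all `z_i ≠ 0`), this reduces to a scalar inequality in each coordinate.
-/

/-! ### Gaussian moments. -/

/-- The standard Gaussian measure on the real line. -/
noncomputable abbrev gauss1 : Measure ℝ := gaussianReal 0 1

/-- The standard Gaussian product measure. -/
noncomputable abbrev gaussPi (n : ℕ) : Measure (Fin n → ℝ) := Measure.pi fun _ => gauss1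

/-- The absolute moment `E |X|^r` of a standard Gaussian variable. -/
noncomputable def absMoment (r : ℝ) : ℝ := ∫ t, |t| ^ r ∂gauss1

theorem integral_gauss1 (f : ℝ → ℝ) :
    ∫ t, f t ∂gauss1 = (√(2 * Real.pi))⁻¹ * ∫ t, Real.exp (-(1 / 2) * t ^ 2) * f t := by
  rw [integral_gaussianReal_eq_integral_smul one_ne_zero, ← integral_const_mul]
  congr 1
  ext t
  simp only [gaussianPDFReal, smul_eq_mul, NNReal.coe_one, mul_one, sub_zero]
  rw [show -t ^ 2 / 2 = -(1 / 2) * t ^ 2 by ring]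
  ring

theorem integrable_abs_rpow_gauss1 {r : ℝ} (hr : 0 ≤ r) :
    Integrable (fun t : ℝ => |t| ^ r) gauss1 := by
  have h := (memLp_id_gaussianReal (μ := 0) (v := 1) ⟨r, hr⟩).integrable_norm_rpow'
  simp only [id, Real.norm_eq_abs] at h
  exact h

theorem absMoment_eq {r : ℝ} (hr : 0 ≤ r) :
    absMoment r = (√(2 * Real.pi))⁻¹ *
      (2 * ((1 / 2 : ℝ) ^ (-(r + 1) / 2) * (1 / 2) * Real.Gamma ((r + 1) / 2))) := by
  rw [absMoment, integral_gauss1]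
  congr 1
  have h := integral_comp_abs (f := fun t : ℝ => t ^ r * Real.exp (-(1 / 2) * t ^ (2 : ℝ)))
  rw [integral_rpow_mul_exp_neg_mul_rpow two_pos (by linarith) (by norm_num)] at h
  rw [← h]
  congr 1
  ext t
  rw [Real.rpow_two, sq_abs, mul_comm]

/-- The functional equation of the Gamma function plays the part of Gaussian integration by parts.
-/
theorem absMoment_add_two {r : ℝ} (hr : 0 ≤ r) : absMoment (r + 2) = (r + 1) * absMoment r := by
  rw [absMoment_eq hr, absMoment_eq (by linarith),
    show (r + 2 + 1) / 2 = (r + 1) / 2 + 1 by ring, Real.Gamma_add_one (by positivity),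
    show -(r + 2 + 1) / 2 = -(r + 1) / 2 - 1 by ring, Real.rpow_sub_one (by norm_num)]
  ring

theorem absMoment_zero : absMoment 0 = 1 := by
  simp [absMoment]

theorem absMoment_two : absMoment 2 = 1 := by
  have := absMoment_add_two (le_refl (0 : ℝ))
  simpa [absMoment_zero] using this

theorem absMoment_pos {r : ℝ} (hr : 0 ≤ r) : 0 < absMoment r := by
  rw [absMoment_eq hr]
  have := Real.Gamma_pos_of_pos (show 0 < (r + 1) / 2 by positivity)
  positivity

/-- The tangent line of the concave function `t ↦ t ^ a` at `c`. -/
theorem rpow_le_tangent {a t c : ℝ} (ha0 : 0 ≤ a) (ha1 : a ≤ 1) (ht : 0 ≤ t) (hc : 0 < c) :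
    t ^ a ≤ c ^ a * (1 - a + a / c * t) := by
  have h := rpow_one_add_le_one_add_mul_self (s := t / c - 1)
    (by have := div_nonneg ht hc.le; linarith) ha0 ha1
  rw [show 1 + (t / c - 1) = t / c by ring, Real.div_rpow ht hc.le,
    div_le_iff₀ (Real.rpow_pos_of_pos hc a)] at h
  refine h.trans (le_of_eq ?_)
  field_simp
  ring

/-- `‖X‖_r² ≤ r - 1` for a standard Gaussian variable `X` and `r ≥ 2`. -/
theorem absMoment_rpow_le {r : ℝ} (hr : 2 ≤ r) : absMoment r ^ (2 / r) ≤ r - 1 := by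
  have hp := absMoment_pos (show 0 ≤ r by linarith)
  have hr0 : 0 < r := by linarith
  set a := (r - 2) / r with ha
  have ha0 : 0 ≤ a := div_nonneg (by linarith) hr0.le
  have ha1 : a ≤ 1 := (div_le_one hr0).2 (by linarith)
  -- Jensen for the concave power `a`: `|X| ^ (r - 2) = (|X| ^ r) ^ a`, with the tangent taken at
  -- the mean of `|X| ^ r`.
  have h1 : absMoment (r - 2) ≤ absMoment r ^ a := by
    have hle : ∀ t : ℝ, |t| ^ (r - 2)
        ≤ absMoment r ^ a * (1 - a + a / absMoment r * |t| ^ r) := fun t => by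
      have := rpow_le_tangent ha0 ha1 (Real.rpow_nonneg (abs_nonneg t) r) hp
      rwa [← Real.rpow_mul (abs_nonneg t), ha, mul_div_cancel₀ _ hr0.ne'] at this
    have hi := integrable_abs_rpow_gauss1 hr0.le
    have h2 := integral_mono (integrable_abs_rpow_gauss1 (r := r - 2) (by linarith))
      ((((integrable_const _).add (hi.const_mul _)).const_mul _)) hle
    refine h2.trans (le_of_eq ?_)
    rw [integral_const_mul]
    simp only [Pi.add_apply]
    rw [integral_add (integrable_const _) (hi.const_mul _), integral_const_mul]
    change _ * (_ + a / absMoment r * absMoment r) = _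
    rw [div_mul_cancel₀ _ hp.ne']
    simp
  have h2 : absMoment r = (r - 1) * absMoment (r - 2) := by
    have := absMoment_add_two (show 0 ≤ r - 2 by linarith)
    rw [show r - 2 + 2 = r by ring, show r - 2 + 1 = r - 1 by ring] at this
    exact this
  have h3 : absMoment r ≤ (r - 1) * absMoment r ^ a :=
    h2.le.trans (mul_le_mul_of_nonneg_left h1 (by linarith))
  -- Dividing `h3` by `absMoment r ^ a` leaves the exponent `1 - a = 2 / r`.
  have h4 : absMoment r ^ (2 / r) * absMoment r ^ a = absMoment r := by
    rw [← Real.rpow_add hp, ha, show 2 / r + (r - 2) / r = 1 by field_simp; ring, Real.rpow_one]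
  have h5 := Real.rpow_pos_of_pos hp a
  by_contra! hlt
  nlinarith [mul_lt_mul_of_pos_right hlt h5]

/-- The one-dimensional factor of the monomial `x_j x_k |x_i|^r`. -/
noncomputable def coordFactor {n : ℕ} (r : ℝ) (j k i l : Fin n) (t : ℝ) : ℝ :=
  (if l = j then t else 1) * (if l = k then t else 1) * (if l = i then |t| ^ r else 1)

theorem prod_coordFactor {n : ℕ} (r : ℝ) (j k i : Fin n) (x : Fin n → ℝ) :
    ∏ l, coordFactor r j k i l (x l) = x j * x k * |x i| ^ r := by
  simp only [coordFactor, Finset.prod_mul_distrib]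
  simp

theorem mul_self_abs_rpow {r : ℝ} (hr : 0 ≤ r) (t : ℝ) : t * t * |t| ^ r = |t| ^ (r + 2) := by
  rw [Real.rpow_add_of_nonneg (abs_nonneg t) hr (by norm_num), Real.rpow_two, sq_abs]
  ring

theorem integrable_coordFactor {n : ℕ} {r : ℝ} (hr : 0 ≤ r) (j k i l : Fin n) :
    Integrable (coordFactor r j k i l) gauss1 := by
  have hm : AEStronglyMeasurable (coordFactor r j k i l) gauss1 := by
    unfold coordFactor
    refine Measurable.aestronglyMeasurable ?_
    split_ifs <;> fun_prop
  refine Integrable.mono' (((integrable_const (1 : ℝ)).add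
    (integrable_abs_rpow_gauss1 (show 0 ≤ r + 2 by linarith)))) hm
    (Filter.Eventually.of_forall fun t => ?_)
  -- In every case the factor is, up to sign, a power of `|t|` with exponent between `0` and `r +
  -- 2`.
  have key : ∀ a : ℝ, 0 ≤ a → a ≤ r + 2 → |t| ^ a ≤ 1 + |t| ^ (r + 2) := fun a ha hle => by
    rcases le_total |t| 1 with h | h
    · have := Real.rpow_le_one (abs_nonneg t) h ha
      have := Real.rpow_nonneg (abs_nonneg t) (r + 2)
      linarith
    · have := Real.rpow_le_rpow_of_exponent_le h hle
      linarith
  have e1 : |t| = |t| ^ (1 : ℝ) := (Real.rpow_one _).symm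
  simp only [coordFactor, Real.norm_eq_abs, Pi.add_apply, abs_mul]
  have hrr : |(|t| ^ r)| = |t| ^ r := abs_of_nonneg (Real.rpow_nonneg (abs_nonneg t) r)
  have k0 := key 0 le_rfl (by linarith)
  have k1 := key 1 (by norm_num) (by linarith)
  have k2 := key 2 (by norm_num) (by linarith)
  have kr := key r hr (by linarith)
  have kr1 := key (r + 1) (by linarith) (by linarith)
  have e2 : |t| * |t| = |t| ^ (2 : ℝ) := by rw [Real.rpow_two, sq]
  have er1 : |t| * |t| ^ r = |t| ^ (r + 1) := by
    rw [Real.rpow_add_of_nonneg (abs_nonneg t) hr zero_le_one, Real.rpow_one, mul_comm]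
  have er2 : |t| ^ (2 : ℝ) * |t| ^ r = |t| ^ (r + 2) := by
    rw [Real.rpow_add_of_nonneg (abs_nonneg t) hr (by norm_num), mul_comm]
  rw [Real.rpow_zero] at k0
  rw [Real.rpow_one] at k1
  split_ifs <;> simp only [hrr, abs_one, one_mul, mul_one] <;>
    first | assumption | (simp only [er2, e2, er1]; first | assumption | linarith)

theorem integrable_monomial {n : ℕ} {r : ℝ} (hr : 0 ≤ r) (j k i : Fin n) :
    Integrable (fun x : Fin n → ℝ => x j * x k * |x i| ^ r) (gaussPi n) := by
  have := Integrable.fintype_prod (μ := fun _ : Fin n => gauss1)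
    (f := fun l => coordFactor r j k i l) fun l => integrable_coordFactor hr j k i l
  simpa only [prod_coordFactor] using this

/-- The product measure splits the integral into one-dimensional ones. For `j ≠ k` at least one of
the two differs from `i`, and its factor is the mean of a centred variable. -/
theorem integral_monomial {n : ℕ} {r : ℝ} (hr : 0 ≤ r) (j k i : Fin n) :
    ∫ x : Fin n → ℝ, x j * x k * |x i| ^ r ∂gaussPi n
      = if j = k then (if j = i then absMoment (r + 2) else absMoment r) else 0 := by
  have h := integral_fintype_prod_eq_prod (μ := fun _ : Fin n => gauss1) (𝕜 := ℝ)
    (fun l => coordFactor r j k i l)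
  simp only [prod_coordFactor] at h
  rw [h]
  have hodd : ∀ j k : Fin n, j ≠ k → j ≠ i → ∫ t, coordFactor r j k i j t ∂gauss1 = 0 :=
    fun j k hjk hji => by simp [coordFactor, hjk, hji]
  split_ifs with hjk hji
  · subst hjk hji
    rw [Finset.prod_eq_single j (fun l _ hl => by simp [coordFactor, hl]) (by simp)]
    simp only [coordFactor, if_true, mul_self_abs_rpow hr]
    rfl
  · subst hjk
    rw [Finset.prod_eq_single i (fun l _ hl => ?_) (by simp)]
    · simp [coordFactor, Ne.symm hji, absMoment]
    · by_cases hlj : l = j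
      · subst hlj
        simp only [coordFactor, if_true, hl, if_false, mul_one]
        have := absMoment_two
        simpa [absMoment, ← sq] using this
      · simp [coordFactor, hl, hlj]
  · by_cases hji : j = i
    · have hki : k ≠ i := fun h => hjk (hji.trans h.symm)
      refine Finset.prod_eq_zero (Finset.mem_univ k) ?_
      simp [coordFactor, Ne.symm hjk, hki]
    · exact Finset.prod_eq_zero (Finset.mem_univ j) (hodd j k hjk hji)

theorem sq_mul_sum_abs_rpow {n : ℕ} (s x : Fin n → ℝ) (r : ℝ) :
    (∑ j, s j * x j) ^ 2 * ∑ i, |x i| ^ r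
      = ∑ j, ∑ k, ∑ i, s j * s k * (x j * x k * |x i| ^ r) := by
  rw [sq, Finset.sum_mul_sum, Finset.sum_mul]
  refine Finset.sum_congr rfl fun j _ => ?_
  rw [Finset.sum_mul]
  refine Finset.sum_congr rfl fun k _ => ?_
  rw [Finset.mul_sum]
  exact Finset.sum_congr rfl fun i _ => by ring

theorem integrable_sq_mul_sum_abs_rpow {n : ℕ} (s : Fin n → ℝ) {r : ℝ} (hr : 0 ≤ r) :
    Integrable (fun x : Fin n → ℝ => (∑ j, s j * x j) ^ 2 * ∑ i, |x i| ^ r) (gaussPi n) := by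
  simp only [sq_mul_sum_abs_rpow]
  exact integrable_finsetSum _ fun j _ => integrable_finsetSum _ fun k _ =>
    integrable_finsetSum _ fun i _ => (integrable_monomial hr j k i).const_mul _

/-- Only the diagonal `j = k` survives. There the `n - 1` indices `i ≠ j` contribute `absMoment r`
each, and `i = j` contributes `(r + 1) * absMoment r`. -/
theorem integral_sq_mul_sum_abs_rpow {n : ℕ} (s : Fin n → ℝ) {r : ℝ} (hr : 0 ≤ r) :
    ∫ x : Fin n → ℝ, (∑ j, s j * x j) ^ 2 * ∑ i, |x i| ^ r ∂gaussPi n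
      = (n + r) * absMoment r * ∑ j, s j ^ 2 := by
  simp only [sq_mul_sum_abs_rpow]
  have hI := fun j k i => (integrable_monomial (n := n) hr j k i).const_mul (s j * s k)
  rw [integral_finsetSum _ fun j _ => integrable_finsetSum _ fun k _ =>
    integrable_finsetSum _ fun i _ => hI j k i, Finset.mul_sum]
  refine Finset.sum_congr rfl fun j _ => ?_
  rw [integral_finsetSum _ fun k _ => integrable_finsetSum _ fun i _ => hI j k i,
    Finset.sum_eq_single j]
  · rw [integral_finsetSum _ fun i _ => hI j j i]
    simp only [integral_const_mul, integral_monomial hr, if_true, absMoment_add_two hr]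
    rw [← Finset.mul_sum]
    have : ∀ i : Fin n, (if j = i then (r + 1) * absMoment r else absMoment r)
        = absMoment r + if j = i then r * absMoment r else 0 := fun i => by split_ifs <;> ring
    simp only [this, Finset.sum_add_distrib, Finset.sum_ite_eq, Finset.sum_const,
      Finset.card_univ, Fintype.card_fin, Finset.mem_univ, if_true, nsmul_eq_mul]
    ring
  · intro k _ hk
    rw [integral_finsetSum _ fun i _ => hI j k i]
    refine Finset.sum_eq_zero fun i _ => ?_
    rw [integral_const_mul, integral_monomial hr, if_neg (Ne.symm hk), mul_zero]
  · simp

/-- The Gaussian form of the bound on `E ⟨s, e⟩² ‖e‖_r²`. -/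
theorem integral_sq_mul_rpow_le {n : ℕ} (hn : 1 ≤ n) (s : Fin n → ℝ) {r : ℝ} (hr : 2 ≤ r) :
    ∫ x : Fin n → ℝ, (∑ j, s j * x j) ^ 2 * (∑ i, |x i| ^ r) ^ (2 / r) ∂gaussPi n
      ≤ (r - 1) * (n : ℝ) ^ (2 / r) * (1 + 2 / n) * ∑ j, s j ^ 2 := by
  have hr0 : 0 < r := by linarith
  have hn0 : (0 : ℝ) < n := by exact_mod_cast hn
  have hp := absMoment_pos hr0.le
  have ha1 : 2 / r ≤ 1 := (div_le_one hr0).2 hr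
  -- `c` is the Gaussian mean of `∑ i, |x i| ^ r`, the point at which the power `2 / r` is
  -- linearized. The weight `⟨s, x⟩²` shifts this mean by the factor `(n + r) / n` only, so the loss
  -- is `1 - 2/r + (2/r)(n + r)/n = 1 + 2/n`.
  set c := absMoment r * n with hc
  have hc0 : 0 < c := mul_pos hp hn0
  have hi0 : Integrable (fun x : Fin n → ℝ => (∑ j, s j * x j) ^ 2) (gaussPi n) := by
    have := (integrable_sq_mul_sum_abs_rpow s (le_refl (0 : ℝ))).div_const (n : ℝ)
    simpa [hn0.ne'] using this
  have hI0 : ∫ x : Fin n → ℝ, (∑ j, s j * x j) ^ 2 ∂gaussPi n = ∑ j, s j ^ 2 := by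
    have := integral_sq_mul_sum_abs_rpow s (le_refl (0 : ℝ))
    simp only [Real.rpow_zero, Finset.sum_const, Finset.card_univ, Fintype.card_fin,
      nsmul_eq_mul, mul_one, add_zero, absMoment_zero, integral_mul_const] at this
    rw [mul_comm] at this
    exact mul_left_cancel₀ hn0.ne' this
  have hir := integrable_sq_mul_sum_abs_rpow s hr0.le
  have hle : ∀ x : Fin n → ℝ, (∑ j, s j * x j) ^ 2 * (∑ i, |x i| ^ r) ^ (2 / r)
      ≤ c ^ (2 / r) * ((1 - 2 / r) * (∑ j, s j * x j) ^ 2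
        + 2 / r / c * ((∑ j, s j * x j) ^ 2 * ∑ i, |x i| ^ r)) := fun x => by
    have := rpow_le_tangent (by positivity) ha1
      (Finset.sum_nonneg fun i _ => Real.rpow_nonneg (abs_nonneg (x i)) r : 0 ≤ ∑ i, |x i| ^ r) hc0
    refine (mul_le_mul_of_nonneg_left this (sq_nonneg _)).trans (le_of_eq ?_)
    ring
  have hint := ((hi0.const_mul (1 - 2 / r)).add (hir.const_mul (2 / r / c))).const_mul (c ^ (2 / r))
  have h1 := integral_mono_of_nonneg (Filter.Eventually.of_forall fun x => by positivity)
    hint (Filter.Eventually.of_forall hle)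
  refine h1.trans ?_
  rw [integral_const_mul]
  simp only [Pi.add_apply]
  rw [integral_add (hi0.const_mul _) (hir.const_mul _), integral_const_mul, integral_const_mul,
    hI0, integral_sq_mul_sum_abs_rpow s hr0.le]
  have hS : 0 ≤ ∑ j, s j ^ 2 := Finset.sum_nonneg fun _ _ => sq_nonneg _
  have e1 : c ^ (2 / r) * ((1 - 2 / r) * ∑ j, s j ^ 2
      + 2 / r / c * ((n + r) * absMoment r * ∑ j, s j ^ 2))
      = absMoment r ^ (2 / r) * ((n : ℝ) ^ (2 / r) * (1 + 2 / n) * ∑ j, s j ^ 2) := by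
    rw [hc, Real.mul_rpow hp.le hn0.le]
    field_simp
    ring
  rw [e1, mul_assoc, mul_assoc]
  refine mul_le_mul_of_nonneg_right (absMoment_rpow_le hr) (by positivity) |>.trans (le_of_eq ?_)
  ring

/-! ### From Gaussian to spherical means. -/

theorem gaussPi_eq_withDensity (n : ℕ) :
    gaussPi n = (volume : Measure (Fin n → ℝ)).withDensity
      fun x => ENNReal.ofReal (∏ i, gaussianPDFReal 0 1 (x i)) := by
  refine Measure.pi_eq fun s hs => ?_
  have hi : Integrable (fun x : Fin n → ℝ => ∏ i, gaussianPDFReal 0 1 (x i)) :=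
    Integrable.fintype_prod (μ := fun _ => volume) fun _ => integrable_gaussianPDFReal 0 1
  have hnn : ∀ x : Fin n → ℝ, 0 ≤ ∏ i, gaussianPDFReal 0 1 (x i) := fun x =>
    Finset.prod_nonneg fun i _ => gaussianPDFReal_nonneg _ _ _
  rw [withDensity_apply _ (MeasurableSet.univ_pi hs),
    ← ofReal_integral_eq_lintegral_ofReal hi.restrict (Filter.Eventually.of_forall hnn),
    volume_pi, Measure.restrict_pi_pi,
    integral_fintype_prod_eq_prod (fun _ => gaussianPDFReal 0 1),
    ENNReal.ofReal_prod_of_nonneg fun i _ => integral_nonneg fun _ => gaussianPDFReal_nonneg _ _ _]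
  exact Finset.prod_congr rfl fun i _ => (gaussianReal_apply_eq_integral _ one_ne_zero _).symm

/-- Gaussian integrals as Lebesgue integrals with the weight `exp (-‖x‖² / 2)`. -/
theorem integral_gaussPi {n : ℕ} (h : Vec n → ℝ) :
    ∫ x, h (WithLp.toLp 2 x) ∂gaussPi n
      = (√(2 * Real.pi))⁻¹ ^ n * ∫ x, Real.exp (-‖x‖ ^ 2 / 2) * h x := by
  have hm : Measurable fun x : Fin n → ℝ => ∏ i, gaussianPDFReal 0 1 (x i) :=
    Finset.measurable_fun_prod _ fun i _ =>
      (measurable_gaussianPDFReal 0 1).comp (measurable_pi_apply i)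
  rw [gaussPi_eq_withDensity, integral_withDensity_eq_integral_toReal_smul hm.ennreal_ofReal
    (Filter.Eventually.of_forall fun _ => ENNReal.ofReal_lt_top),
    ← (PiLp.volume_preserving_toLp (Fin n)).integral_comp
      (MeasurableEquiv.toLp 2 _).measurableEmbedding, ← integral_const_mul]
  congr 1
  ext x
  rw [ENNReal.toReal_ofReal (Finset.prod_nonneg fun i _ => gaussianPDFReal_nonneg _ _ _)]
  simp only [gaussianPDFReal, Finset.prod_mul_distrib, Finset.prod_const, Finset.card_univ,
    Fintype.card_fin, ← Real.exp_sum, EuclideanSpace.norm_sq_eq, smul_eq_mul, NNReal.coe_one,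
    mul_one, sub_zero, Real.norm_eq_abs, sq_abs, mul_assoc, ← Finset.sum_neg_distrib,
    Finset.sum_div]

theorem integral_sphereUniform {n : ℕ} (h : Vec n → ℝ) :
    ∫ e, h e ∂sphereUniform n = ((volume : Measure (Vec n)).toSphere.real Set.univ)⁻¹ *
      ∫ e : Metric.sphere (0 : Vec n) 1, h e ∂(volume : Measure (Vec n)).toSphere := by
  rw [sphereUniform, (MeasurableEmbedding.subtype_coe
    (Metric.isClosed_sphere.measurableSet)).integral_map, integral_smul_measure,
    ENNReal.toReal_inv]
  rfl

theorem toSphere_univ_ne_zero {n : ℕ} (hn : 1 ≤ n) :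
    (volume : Measure (Vec n)).toSphere Set.univ ≠ 0 := by
  have : Nonempty (Fin n) := ⟨⟨0, hn⟩⟩
  have : Nontrivial (Vec n) := inferInstance
  rw [Ne, Measure.measure_univ_eq_zero]
  exact Measure.toSphere_ne_zero _

theorem isProbabilityMeasure_sphereUniform {n : ℕ} (hn : 1 ≤ n) :
    IsProbabilityMeasure (sphereUniform n) := by
  refine ⟨?_⟩
  rw [sphereUniform, Measure.map_apply measurable_subtype_coe MeasurableSet.univ]
  simp only [Set.preimage_univ, Measure.smul_apply, smul_eq_mul]
  exact ENNReal.inv_mul_cancel (toSphere_univ_ne_zero hn) (measure_ne_top _ _)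

theorem norm_eq_one_ae_sphereUniform (n : ℕ) : ∀ᵐ e ∂sphereUniform n, ‖e‖ = 1 := by
  rw [sphereUniform, ae_map_iff measurable_subtype_coe.aemeasurable
    (measurableSet_eq_fun measurable_norm measurable_const)]
  exact Filter.Eventually.of_forall fun e => by simp

/-- Polar integration of a positively homogeneous function against the Gaussian weight. -/
theorem integral_homogeneous_eq {n : ℕ} (hn : 1 ≤ n) (k : ℕ) (h : Vec n → ℝ)
    (hh : ∀ t : ℝ, 0 < t → ∀ x, h (t • x) = t ^ k * h x) :
    ∫ x, Real.exp (-‖x‖ ^ 2 / 2) * h x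
      = (∫ e : Metric.sphere (0 : Vec n) 1, h e ∂(volume : Measure (Vec n)).toSphere) *
        ∫ r : Set.Ioi (0 : ℝ), Real.exp (-(r : ℝ) ^ 2 / 2) * (r : ℝ) ^ k
          ∂(Measure.volumeIoiPow (Module.finrank ℝ (Vec n) - 1)) := by
  have : Nonempty (Fin n) := ⟨⟨0, hn⟩⟩
  have : Nontrivial (Vec n) := inferInstance
  rw [← integral_prod_mul,
    ← (volume : Measure (Vec n)).measurePreserving_homeomorphUnitSphereProd.integral_comp
      (Homeomorph.measurableEmbedding _)]
  -- Polar coordinates live on the complement of the origin, which is a null set.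
  conv_lhs => rw [← restrict_compl_singleton (μ := volume) (0 : Vec n)]
  rw [← integral_subtype_comap (measurableSet_singleton _).compl]
  congr 1
  ext x
  have hx : 0 < ‖(x : Vec n)‖ := norm_pos_iff.2 x.2
  simp only [homeomorphUnitSphereProd_apply_fst_coe, homeomorphUnitSphereProd_apply_snd_coe]
  have := hh ‖(x : Vec n)‖⁻¹ (inv_pos.2 hx) x
  rw [this, inv_pow]
  field_simp

/-- Spherical means of homogeneous functions from Gaussian ones. -/
theorem integral_gaussPi_homogeneous {n : ℕ} (hn : 1 ≤ n) (k : ℕ) (h : Vec n → ℝ)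
    (hh : ∀ t : ℝ, 0 < t → ∀ x, h (t • x) = t ^ k * h x) :
    ∫ x, h (WithLp.toLp 2 x) ∂gaussPi n
      = (∫ e, h e ∂sphereUniform n) * ∫ x, ‖(WithLp.toLp 2 x : Vec n)‖ ^ k ∂gaussPi n := by
  -- `h` and `‖·‖ ^ k` have the same radial integral, so comparing the two leaves the spherical mean
  -- of `h`.
  rw [integral_gaussPi h, integral_gaussPi fun x => ‖x‖ ^ k, integral_sphereUniform,
    integral_homogeneous_eq hn k h hh, integral_homogeneous_eq hn k (fun x => ‖x‖ ^ k)
      fun t ht x => by rw [norm_smul, Real.norm_eq_abs, abs_of_pos ht, mul_pow]]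
  have h1 : ∫ e : Metric.sphere (0 : Vec n) 1, ‖(e : Vec n)‖ ^ k
      ∂(volume : Measure (Vec n)).toSphere = (volume : Measure (Vec n)).toSphere.real Set.univ := by
    simp
  have h2 : (volume : Measure (Vec n)).toSphere.real Set.univ ≠ 0 :=
    (measureReal_ne_zero_iff).2 (toSphere_univ_ne_zero hn)
  rw [h1]
  field_simp

theorem inner_eq_sum {n : ℕ} (s x : Vec n) : ⟪s, x⟫ = ∑ j, s j * x j := by
  simp [PiLp.inner_apply, mul_comm]

theorem integral_norm_sq_gaussPi {n : ℕ} :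
    ∫ x, ‖(WithLp.toLp 2 x : Vec n)‖ ^ 2 ∂gaussPi n = n := by
  have hi := fun i : Fin n => (integrable_monomial (le_refl (0 : ℝ)) i i i)
  have h := fun i : Fin n => (integral_monomial (le_refl (0 : ℝ)) i i i)
  simp only [Real.rpow_zero, mul_one, ← sq, if_true, zero_add, absMoment_two] at h hi
  simp only [EuclideanSpace.norm_sq_eq, Real.norm_eq_abs, sq_abs]
  rw [integral_finsetSum _ fun i _ => hi i]
  simp [h]

/-- `‖x‖ ^ 4 = ∑ i, x i ^ 2 * ∑ j, x j ^ 2`, which is the weighted moment with exponent `2` summed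
over the unit vectors. -/
theorem integral_norm_pow_four_gaussPi {n : ℕ} :
    ∫ x, ‖(WithLp.toLp 2 x : Vec n)‖ ^ 4 ∂gaussPi n = n * (n + 2) := by
  have hi := fun i : Fin n => integrable_sq_mul_sum_abs_rpow (Pi.single i 1) (zero_le_two (α := ℝ))
  have h := fun i : Fin n => integral_sq_mul_sum_abs_rpow (Pi.single i 1) (zero_le_two (α := ℝ))
  simp only [Pi.single_apply, ite_mul, one_mul, zero_mul, Finset.sum_ite_eq', Finset.mem_univ,
    if_true, absMoment_two, mul_one, ite_pow, one_pow, Real.rpow_two, sq_abs, ne_eq,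
    OfNat.ofNat_ne_zero, not_false_eq_true, zero_pow] at h hi
  have e : ∀ x : Fin n → ℝ, ‖(WithLp.toLp 2 x : Vec n)‖ ^ 4 = ∑ i, x i ^ 2 * ∑ j, x j ^ 2 :=
    fun x => by
      rw [show (4 : ℕ) = 2 * 2 by rfl, pow_mul, EuclideanSpace.norm_sq_eq, ← Finset.sum_mul, ← sq]
      simp
  simp only [e]
  rw [integral_finsetSum _ fun i _ => hi i]
  simp only [h, Finset.sum_const, Finset.card_univ, Fintype.card_fin, nsmul_eq_mul]

theorem integral_inner_sq_sphereUniform {n : ℕ} (hn : 1 ≤ n) (s : Vec n) :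
    ∫ e, ⟪s, e⟫ ^ 2 ∂sphereUniform n = ‖s‖ ^ 2 / n := by
  have hn0 : (n : ℝ) ≠ 0 := by positivity
  have h := integral_gaussPi_homogeneous hn 2 (fun x => ⟪s, x⟫ ^ 2) fun t _ x => by
    rw [inner_smul_right, mul_pow]
  rw [integral_norm_sq_gaussPi] at h
  rw [eq_div_iff hn0, ← h]
  have h0 := integral_sq_mul_sum_abs_rpow (n := n) s (le_refl (0 : ℝ))
  simp only [Real.rpow_zero, Finset.sum_const, Finset.card_univ, Fintype.card_fin,
    nsmul_eq_mul, mul_one, add_zero, absMoment_zero, integral_mul_const] at h0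
  rw [mul_comm] at h0
  simp only [inner_eq_sum, EuclideanSpace.norm_sq_eq, Real.norm_eq_abs, sq_abs]
  exact mul_left_cancel₀ hn0 h0

theorem integrable_inner_mul_inner_sphereUniform {n : ℕ} (hn : 1 ≤ n) (s v : Vec n) :
    Integrable (fun e => ⟪s, e⟫ * ⟪v, e⟫) (sphereUniform n) := by
  have := isProbabilityMeasure_sphereUniform hn
  refine Integrable.of_bound (C := ‖s‖ * ‖v‖) (by fun_prop) ?_
  filter_upwards [norm_eq_one_ae_sphereUniform n] with e he
  rw [norm_mul]
  have h1 := norm_inner_le_norm (𝕜 := ℝ) s e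
  have h2 := norm_inner_le_norm (𝕜 := ℝ) v e
  rw [he, mul_one] at h1 h2
  exact mul_le_mul h1 h2 (norm_nonneg _) (norm_nonneg _)

theorem integral_inner_mul_inner_sphereUniform {n : ℕ} (hn : 1 ≤ n) (s v : Vec n) :
    ∫ e, ⟪s, e⟫ * ⟪v, e⟫ ∂sphereUniform n = ⟪s, v⟫ / n := by
  have h1 := integral_inner_sq_sphereUniform hn (s + v)
  have h2 := integral_inner_sq_sphereUniform hn (s - v)
  have hi := fun s v : Vec n => integrable_inner_mul_inner_sphereUniform hn s v
  have e : ∀ e : Vec n, ⟪s, e⟫ * ⟪v, e⟫ = 1 / 4 * (⟪s + v, e⟫ ^ 2 - ⟪s - v, e⟫ ^ 2) := fun e => by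
    rw [inner_add_left, inner_sub_left]; ring
  have hsq : ∀ w : Vec n, Integrable (fun e => ⟪w, e⟫ ^ 2) (sphereUniform n) := fun w => by
    simpa only [sq] using hi w w
  simp only [e]
  rw [integral_const_mul, integral_sub (hsq _) (hsq _), h1, h2, norm_add_sq_real,
    norm_sub_sq_real]
  ring

/-- The integrand has degree `4`, so the Gaussian bound is divided by `E ‖x‖ ^ 4 = n (n + 2)`. This
cancels the factor `1 + 2/n` exactly. -/
theorem integral_inner_sq_mul_rpow_sphereUniform_le {n : ℕ} (hn : 1 ≤ n) (s : Vec n) {r : ℝ}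
    (hr : 2 ≤ r) :
    ∫ e : Vec n, ⟪s, e⟫ ^ 2 * (∑ i, |e i| ^ r) ^ (2 / r) ∂sphereUniform n
      ≤ (r - 1) * (n : ℝ) ^ (2 / r - 1) / n * ‖s‖ ^ 2 := by
  have hn0 : (0 : ℝ) < n := by exact_mod_cast hn
  have hr0 : 0 < r := by linarith
  have h := integral_gaussPi_homogeneous hn 4
    (fun x => ⟪s, x⟫ ^ 2 * (∑ i, |x i| ^ r) ^ (2 / r)) fun t ht x => by
      have e1 : ∀ i, |(t • x) i| ^ r = t ^ r * |x i| ^ r := fun i => by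
        rw [PiLp.smul_apply, smul_eq_mul, abs_mul, abs_of_pos ht,
          Real.mul_rpow ht.le (abs_nonneg _)]
      simp only [e1]
      rw [← Finset.mul_sum, Real.mul_rpow (by positivity)
        (Finset.sum_nonneg fun i _ => by positivity), ← Real.rpow_mul ht.le,
        mul_div_cancel₀ _ hr0.ne', Real.rpow_two, inner_smul_right]
      ring
  rw [integral_norm_pow_four_gaussPi] at h
  have hg := integral_sq_mul_rpow_le hn s hr
  simp only [inner_eq_sum] at h ⊢
  rw [h] at hg
  have hs : ∑ j, s j ^ 2 = ‖s‖ ^ 2 := by simp [EuclideanSpace.norm_sq_eq]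
  rw [hs, ← le_div_iff₀ (by positivity)] at hg
  refine hg.trans (le_of_eq ?_)
  rw [Real.rpow_sub_one hn0.ne']
  field_simp

/-! ### Norms with a real exponent. -/

/-- The `r`-norm on `ℝⁿ` for a real exponent. -/
noncomputable def sumNorm {n : ℕ} (r : ℝ) (x : Vec n) : ℝ := (∑ i, |x i| ^ r) ^ (1 / r)

theorem sum_abs_rpow_nonneg {n : ℕ} (r : ℝ) (x : Vec n) : 0 ≤ ∑ i, |x i| ^ r :=
  Finset.sum_nonneg fun i _ => Real.rpow_nonneg (abs_nonneg (x i)) r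

theorem sumNorm_nonneg {n : ℕ} (r : ℝ) (x : Vec n) : 0 ≤ sumNorm r x :=
  Real.rpow_nonneg (sum_abs_rpow_nonneg r x) _

theorem sumNorm_sq {n : ℕ} (r : ℝ) (x : Vec n) :
    sumNorm r x ^ 2 = (∑ i, |x i| ^ r) ^ (2 / r) := by
  rw [sumNorm, ← Real.rpow_mul_natCast (sum_abs_rpow_nonneg r x)]
  congr 1
  push_cast
  ring

theorem sumNorm_rpow {n : ℕ} {r : ℝ} (hr : r ≠ 0) (x : Vec n) :
    sumNorm r x ^ r = ∑ i, |x i| ^ r := by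
  rw [sumNorm, ← Real.rpow_mul (sum_abs_rpow_nonneg r x), one_div, inv_mul_cancel₀ hr,
    Real.rpow_one]

theorem pNorm_eq_sumNorm {n : ℕ} {p : ℝ≥0∞} (hp : 0 < p.toReal) (x : Vec n) :
    pNorm p x = sumNorm p.toReal x := by
  simp [pNorm, PiLp.norm_eq_sum hp, sumNorm]

theorem sumNorm_two {n : ℕ} (x : Vec n) : sumNorm 2 x = ‖x‖ := by
  have h := sumNorm_sq 2 x
  rw [div_self two_ne_zero, Real.rpow_one] at h
  have h2 : ‖x‖ ^ 2 = ∑ i, |x i| ^ (2 : ℝ) := by simp [EuclideanSpace.norm_sq_eq]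
  exact (pow_left_inj₀ (sumNorm_nonneg _ _) (norm_nonneg _) two_ne_zero).1 (h.trans h2.symm)

theorem abs_le_sumNorm {n : ℕ} {r : ℝ} (hr : 0 < r) (x : Vec n) (i : Fin n) :
    |x i| ≤ sumNorm r x := by
  rw [← Real.rpow_le_rpow_iff (abs_nonneg _) (sumNorm_nonneg _ _) hr, sumNorm_rpow hr.ne']
  exact Finset.single_le_sum (f := fun i => |x i| ^ r)
    (fun i _ => Real.rpow_nonneg (abs_nonneg _) _) (Finset.mem_univ i)

theorem sumNorm_le_sumNorm {n : ℕ} {a b : ℝ} (ha : 0 < a) (hab : a ≤ b) (x : Vec n) :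
    sumNorm b x ≤ sumNorm a x := by
  have hb : 0 < b := ha.trans_le hab
  rw [← Real.rpow_le_rpow_iff (sumNorm_nonneg _ _) (sumNorm_nonneg _ _) hb, sumNorm_rpow hb.ne']
  have h : ∀ i, |x i| ^ b ≤ |x i| ^ a * sumNorm a x ^ (b - a) := fun i => by
    calc |x i| ^ b = |x i| ^ a * |x i| ^ (b - a) := by
          rw [← Real.rpow_add_of_nonneg (abs_nonneg _) ha.le (by linarith)]; ring_nf
      _ ≤ _ := mul_le_mul_of_nonneg_left (Real.rpow_le_rpow (abs_nonneg _)
          (abs_le_sumNorm ha x i) (by linarith)) (Real.rpow_nonneg (abs_nonneg _) _)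
  refine (Finset.sum_le_sum fun i _ => h i).trans (le_of_eq ?_)
  rw [← Finset.sum_mul, ← sumNorm_rpow ha.ne',
    ← Real.rpow_add_of_nonneg (sumNorm_nonneg _ _) ha.le (by linarith)]
  ring_nf

theorem inner_le_sumNorm_mul_sumNorm {n : ℕ} {r r' : ℝ} (h : r.HolderConjugate r') (s x : Vec n) :
    ⟪s, x⟫ ≤ sumNorm r s * sumNorm r' x := by
  rw [inner_eq_sum]
  exact Real.inner_le_Lp_mul_Lq _ _ _ h

theorem sumNorm_le_rpow_mul_sumNorm {n : ℕ} {r : ℝ} (hr : 1 < r) (x : Vec n) :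
    sumNorm 1 x ≤ (n : ℝ) ^ (1 - 1 / r) * sumNorm r x := by
  have h := Real.inner_le_Lp_mul_Lq (Finset.univ : Finset (Fin n)) (fun _ => 1) (fun i => |x i|)
    (Real.HolderConjugate.conjExponent hr).symm
  have e : 1 / r.conjExponent = 1 - 1 / r := by
    rw [Real.conjExponent]; field_simp
  rw [e] at h
  simpa [sumNorm] using h

/-! ### The exponent `r` and bounds for `ρ_n`. -/

/-- This is what `n ≥ 8` is for: `e² < 8`. -/
theorem two_le_log {n : ℕ} (hn : 8 ≤ n) : 2 ≤ Real.log n := by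
  have hn' : (8 : ℝ) ≤ n := by exact_mod_cast hn
  rw [Real.le_log_iff_exp_le (by linarith)]
  have h := Real.exp_one_lt_d9
  have h2 : Real.exp 2 = Real.exp 1 * Real.exp 1 := by rw [← Real.exp_add]; norm_num
  have := Real.exp_pos 1
  nlinarith

theorem inv_toReal_le_half {p q : ℝ≥0∞} (hp2 : p ≤ 2) (hpq : p⁻¹ + q⁻¹ = 1) :
    (q⁻¹).toReal ≤ 1 / 2 ∧ 2 ≤ q := by
  have h1 : (2 : ℝ≥0∞)⁻¹ ≤ p⁻¹ := ENNReal.inv_le_inv.2 hp2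
  have h2 : q⁻¹ ≤ 2⁻¹ := by
    have h3 : (2 : ℝ≥0∞)⁻¹ + q⁻¹ ≤ 2⁻¹ + 2⁻¹ := by
      rw [ENNReal.inv_two_add_inv_two, ← hpq]; gcongr
    exact (ENNReal.add_le_add_iff_left (by simp)).1 h3
  refine ⟨?_, ENNReal.inv_le_inv.1 h2⟩
  have := ENNReal.toReal_mono (by simp) h2
  simpa using this

theorem toReal_inv_add {p q : ℝ≥0∞} (hp1 : 1 ≤ p) (hpq : p⁻¹ + q⁻¹ = 1) :
    (p.toReal)⁻¹ + (q⁻¹).toReal = 1 := by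
  have h := congrArg ENNReal.toReal hpq
  rw [ENNReal.toReal_add (by simp; rintro rfl; simp at hp1)
    (ne_top_of_le_ne_top ENNReal.one_ne_top (hpq ▸ le_add_self))] at h
  simpa using h

/-- The two cases of the minimum in `rho`. -/
theorem rho_eq {n : ℕ} (hn : 8 ≤ n) {q : ℝ≥0∞} (hq : 2 ≤ q) :
    (∃ Q : ℝ, 2 ≤ Q ∧ (q⁻¹).toReal = 1 / Q ∧ Q - 1 ≤ 16 * Real.log n - 8 ∧
        rho n q = (Q - 1) * (n : ℝ) ^ (2 / Q - 1)) ∨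
      ((q⁻¹).toReal ≤ 1 / (16 * Real.log n - 7) ∧
        rho n q = (16 * Real.log n - 8) * (n : ℝ) ^ (2 * (q⁻¹).toReal - 1)) := by
  have hl := two_le_log hn
  rcases eq_or_ne q ⊤ with rfl | hqt
  · right
    refine ⟨?_, ?_⟩
    · simp; linarith
    · simp [rho, ENNReal.toReal_ofReal (show 0 ≤ 16 * Real.log n - 8 by linarith)]
  · have hQ : 2 ≤ q.toReal := by simpa using ENNReal.toReal_mono hqt hq
    have hmin : (min (q - 1) (ENNReal.ofReal (16 * Real.log n - 8))).toReal
        = min (q.toReal - 1) (16 * Real.log n - 8) := by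
      rw [ENNReal.toReal_min (ENNReal.sub_ne_top hqt) ENNReal.ofReal_ne_top,
        ENNReal.toReal_sub_of_le (le_trans (by norm_num) hq) hqt,
        ENNReal.toReal_ofReal (by linarith)]
      simp
    rcases le_total (q.toReal - 1) (16 * Real.log n - 8) with h | h
    · left
      refine ⟨q.toReal, hQ, by simp, h, ?_⟩
      rw [rho, hmin, min_eq_left h, ENNReal.toReal_inv]
      rfl
    · right
      refine ⟨?_, by rw [rho, hmin, min_eq_right h]⟩
      rw [ENNReal.toReal_inv, ← one_div]
      exact one_div_le_one_div_of_le (by linarith) (by linarith)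

/-- If `q - 1` is the smaller term of the minimum, `r = q` works with equality. Otherwise `r = 2 ln
n ≤ q` replaces it: then `n ^ (2 / r) = e`, and `(2 ln n - 1) e ≤ 8 (2 ln n - 1) = 16 ln n - 8`.
Since `r ≤ q`, the conjugate exponent satisfies `p ≤ r'`, so strong convexity survives the change of
norm. -/
theorem exists_exponent {n : ℕ} (hn : 8 ≤ n) {p q : ℝ≥0∞} (hp1 : 1 ≤ p) (hp2 : p ≤ 2)
    (hpq : p⁻¹ + q⁻¹ = 1) :
    ∃ r r' : ℝ, 2 ≤ r ∧ r.HolderConjugate r' ∧ p.toReal ≤ r' ∧ r' ≤ 2 ∧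
      (r - 1) * (n : ℝ) ^ (2 / r - 1) ≤ rho n q := by
  have hl := two_le_log hn
  have hn1 : (1 : ℝ) ≤ n := by exact_mod_cast (by omega : 1 ≤ n)
  obtain ⟨hu, hq2⟩ := inv_toReal_le_half hp2 hpq
  have hpu := toReal_inv_add hp1 hpq
  have hp0 : 0 < p.toReal := ENNReal.toReal_pos (zero_lt_one.trans_le hp1).ne'
    (ne_top_of_le_ne_top (by simp) hp2)
  have key : ∃ r : ℝ, 2 ≤ r ∧ (q⁻¹).toReal ≤ 1 / r ∧
      (r - 1) * (n : ℝ) ^ (2 / r - 1) ≤ rho n q := by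
    rcases rho_eq hn hq2 with ⟨Q, hQ, hqQ, -, hr⟩ | ⟨hle, hr⟩
    · exact ⟨Q, hQ, hqQ.le, hr.ge⟩
    · refine ⟨2 * Real.log n, by linarith, hle.trans
        (one_div_le_one_div_of_le (by linarith) (by linarith)), ?_⟩
      rw [hr]
      have hn0 : (0 : ℝ) < n := by linarith
      have e1 : (n : ℝ) ^ (2 / (2 * Real.log n) - 1) = Real.exp 1 * (n : ℝ) ^ (-1 : ℝ) := by
        rw [sub_eq_add_neg, Real.rpow_add hn0, Real.rpow_def_of_pos hn0 (2 / _)]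
        congr 2
        field_simp
      have e2 : (n : ℝ) ^ (-1 : ℝ) ≤ (n : ℝ) ^ (2 * (q⁻¹).toReal - 1) :=
        Real.rpow_le_rpow_of_exponent_le hn1 (by have := @ENNReal.toReal_nonneg q⁻¹; linarith)
      rw [e1]
      have h3 := Real.exp_one_lt_d9
      have h4 : 0 < (n : ℝ) ^ (-1 : ℝ) := by positivity
      calc (2 * Real.log n - 1) * (Real.exp 1 * (n : ℝ) ^ (-1 : ℝ))
          = ((2 * Real.log n - 1) * Real.exp 1) * (n : ℝ) ^ (-1 : ℝ) := by ring
        _ ≤ (16 * Real.log n - 8) * (n : ℝ) ^ (-1 : ℝ) :=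
          mul_le_mul_of_nonneg_right (by nlinarith) h4.le
        _ ≤ _ := mul_le_mul_of_nonneg_left e2 (by linarith)
  obtain ⟨r, hr2, hur, hrho⟩ := key
  have hc := Real.HolderConjugate.conjExponent (show 1 < r by linarith)
  refine ⟨r, r.conjExponent, hr2, hc, ?_, ?_, hrho⟩
  · have h1 := hc.inv_add_inv_eq_one
    rw [one_div] at hur
    exact (inv_le_inv₀ hc.symm.pos hp0).1 (by linarith)
  · rw [Real.conjExponent, div_le_iff₀ (by linarith)]
    linarith

theorem rho_pos {n : ℕ} (hn : 8 ≤ n) {q : ℝ≥0∞} (hq : 2 ≤ q) : 0 < rho n q := by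
  have hl := two_le_log hn
  have hn0 : (0 : ℝ) < n := by exact_mod_cast (by omega : 0 < n)
  rcases rho_eq hn hq with ⟨Q, hQ, -, -, h⟩ | ⟨-, h⟩
  · rw [h]
    exact mul_pos (by linarith) (by positivity)
  · rw [h]
    exact mul_pos (by linarith) (by positivity)

/-- Serves the case in which the starting point is already accurate, where `L₂ Θ` is compared with
`n ρ_n L₂ Θ`. -/
theorem one_le_mul_rho {n : ℕ} (hn : 8 ≤ n) {q : ℝ≥0∞} (hq : 2 ≤ q) : 1 ≤ n * rho n q := by
  have hl := two_le_log hn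
  have hn1 : (1 : ℝ) ≤ n := by exact_mod_cast (by omega : 1 ≤ n)
  have e : ∀ c a : ℝ, (n : ℝ) * (c * (n : ℝ) ^ (a - 1)) = c * (n : ℝ) ^ a := fun c a => by
    rw [Real.rpow_sub_one (by positivity)]; field_simp
  rcases rho_eq hn hq with ⟨Q, hQ, -, -, h⟩ | ⟨-, h⟩
  · rw [h, e]
    exact one_le_mul_of_one_le_of_one_le (by linarith)
      (Real.one_le_rpow hn1 (div_nonneg zero_le_two (by linarith)))
  · rw [h, e]
    exact one_le_mul_of_one_le_of_one_le (by linarith) (Real.one_le_rpow hn1 (by positivity))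

theorem mul_rho_le {n : ℕ} (hn : 8 ≤ n) {q : ℝ≥0∞} (hq : 2 ≤ q) :
    n * rho n q ≤ 16 * Real.log n * (n : ℝ) ^ (2 * (q⁻¹).toReal) := by
  have hn1 : (1 : ℝ) ≤ n := by exact_mod_cast (by omega : 1 ≤ n)
  have e : ∀ c a : ℝ, (n : ℝ) * (c * (n : ℝ) ^ (a - 1)) = c * (n : ℝ) ^ a := fun c a => by
    rw [Real.rpow_sub_one (by positivity)]; field_simp
  rcases rho_eq hn hq with ⟨Q, hQ, h1, h2, h⟩ | ⟨-, h⟩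
  · rw [h, e, h1, mul_one_div]
    exact mul_le_mul_of_nonneg_right (by linarith) (by positivity)
  · rw [h, e]
    exact mul_le_mul_of_nonneg_right (by linarith) (by positivity)

/-! ### Bregman divergences and the mirror descent step. -/

section Prox

variable {n : ℕ} {d : Vec n → ℝ}

/-- The `r'`-norm is at most the `p`-norm for `p ≤ r'`, so strong convexity passes to it. -/
theorem bregman_ge_sumNorm {p : ℝ≥0∞} {r' : ℝ} (hd : IsProxFunction p d) (hp : 0 < p.toReal)
    (hpr : p.toReal ≤ r') (x y : Vec n) : 1 / 2 * sumNorm r' (y - x) ^ 2 ≤ bregman d x y := by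
  refine le_trans ?_ (hd.strongly_convex x y)
  rw [pNorm_eq_sumNorm hp]
  have := sumNorm_le_sumNorm hp hpr (y - x)
  have := sumNorm_nonneg r' (y - x)
  gcongr

theorem bregman_ge_norm {p : ℝ≥0∞} (hd : IsProxFunction p d) (hp : 0 < p.toReal)
    (hp2 : p.toReal ≤ 2) (x y : Vec n) : 1 / 2 * ‖y - x‖ ^ 2 ≤ bregman d x y := by
  have := bregman_ge_sumNorm hd hp hp2 x y
  rwa [sumNorm_two] at this

/-- First-order optimality condition of the mirror descent step. -/
theorem gradient_eq_of_isMinOn (hd : Differentiable ℝ d) {s : ℝ} {G x z : Vec n}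
    (h : IsMinOn (fun z => s * ⟪G, z - x⟫ + bregman d x z) Set.univ z) :
    gradient d z = gradient d x - s • G := by
  have h1 : HasFDerivAt d (innerSL ℝ (gradient d z)) z := (hd z).hasGradientAt.hasFDerivAt
  have hin : ∀ a : Vec n, HasFDerivAt (fun z => ⟪a, z - x⟫) (innerSL ℝ a) z := fun a => by
    have := (innerSL ℝ a).hasFDerivAt.comp z ((hasFDerivAt_id z).sub_const x)
    exact this
  have h2 : HasFDerivAt (fun z => s * ⟪G, z - x⟫ + bregman d x z)
      (s • innerSL ℝ G + (innerSL ℝ (gradient d z) - innerSL ℝ (gradient d x))) z :=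
    ((hin G).const_mul s).add ((h1.sub_const (d x)).sub (hin _))
  have h3 := (h.isLocalMin Filter.univ_mem).hasFDerivAt_eq_zero h2
  refine ext_inner_right ℝ fun v => ?_
  have h4 := congrArg (fun A : Vec n →L[ℝ] ℝ => A v) h3
  simp only [add_apply, sub_apply,
    smul_apply, innerSL_apply_apply, smul_eq_mul,
    zero_apply] at h4
  rw [inner_sub_left, real_inner_smul_left]
  linarith

/-- The gradient of a prox-function has a continuous left inverse. -/
theorem exists_continuous_leftInverse_gradient
    (hsc : ∀ x y : Vec n, 1 / 2 * ‖y - x‖ ^ 2 ≤ bregman d x y) :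
    ∃ T : Vec n → Vec n, Continuous T ∧ ∀ x, T (gradient d x) = x := by
  -- Adding strong convexity at both points gives `‖x - y‖² ≤ ⟨∇d(x) - ∇d(y), x - y⟩`; by
  -- Cauchy–Schwarz, `∇d` does not shrink distances.
  have ha : AntilipschitzWith 1 (gradient d) := by
    refine AntilipschitzWith.of_le_mul_dist fun x y => ?_
    rw [dist_eq_norm, dist_eq_norm, NNReal.coe_one, one_mul]
    have h1 := hsc x y
    have h2 := hsc y x
    rw [bregman] at h1 h2
    rw [norm_sub_rev y x] at h1
    have h3 : ⟪gradient d x - gradient d y, x - y⟫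
        = -⟪gradient d x, y - x⟫ - ⟪gradient d y, x - y⟫ := by
      rw [inner_sub_left, ← inner_neg_right, neg_sub]
    have h4 := real_inner_le_norm (gradient d x - gradient d y) (x - y)
    by_contra! hlt
    have h5 : 0 < ‖x - y‖ := (norm_nonneg _).trans_lt hlt
    nlinarith
  have hinv : Set.RightInvOn (gradient d).invFun (gradient d) (Set.range (gradient d)) := by
    rintro _ ⟨x, rfl⟩
    rw [Function.leftInverse_invFun ha.injective]
  -- The inverse is Lipschitz on the range of `∇d`; extending it to the whole space avoids having to
  -- identify that range.
  obtain ⟨T, hT, hTe⟩ := (lipschitzOnWith_iff_restrict.2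
    (ha.to_rightInvOn hinv)).extend_finite_dimension
  refine ⟨T, hT.continuous, fun x => ?_⟩
  rw [← hTe (Set.mem_range_self x), Function.leftInverse_invFun ha.injective]

/-- One step of mirror descent. -/
theorem bregman_step_le {r r' : ℝ} (hr : r.HolderConjugate r')
    (hsc : ∀ x y : Vec n, 1 / 2 * sumNorm r' (y - x) ^ 2 ≤ bregman d x y) {s : ℝ} (hs : 0 ≤ s)
    {G x z : Vec n} (hz : gradient d z = gradient d x - s • G) (u : Vec n) :
    bregman d z u ≤ bregman d x u - s * ⟪G, x - u⟫ + s ^ 2 / 2 * sumNorm r G ^ 2 := by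
  have h1 := hsc x z
  -- The three-point identity, with the optimality condition substituted for `∇d(z)`.
  have h2 : bregman d z u = bregman d x u - bregman d x z + s * ⟪G, u - z⟫ := by
    simp only [bregman, hz, inner_sub_left, real_inner_smul_left]
    have : u - x = (u - z) + (z - x) := by abel
    rw [this, inner_add_right]
    ring
  have h3 : ⟪G, u - z⟫ = -⟪G, x - u⟫ + ⟪-G, z - x⟫ := by
    rw [inner_neg_left, ← inner_neg_right, ← inner_neg_right, ← inner_add_right]
    congr 1; abel
  have h4 := inner_le_sumNorm_mul_sumNorm hr (-G) (z - x)
  have h5 : sumNorm r (-G) = sumNorm r G := by simp [sumNorm]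
  rw [h5] at h4
  have h6 := mul_le_mul_of_nonneg_left h4 hs
  rw [h2, h3]
  -- Young's inequality: `s ‖G‖ ‖z - x‖ ≤ s² ‖G‖² / 2 + ‖z - x‖² / 2`, and strong convexity pays for
  -- the last term.
  nlinarith [sq_nonneg (s * sumNorm r G - sumNorm r' (z - x))]

end Prox

/-! ### Convexity and smoothness of the objective. -/

theorem ConvexOn.add_inner_le_of_hasGradientAt {n : ℕ} {φ : Vec n → ℝ}
    (hφ : ConvexOn ℝ Set.univ φ) {x v : Vec n} (h : HasGradientAt φ v x) (y : Vec n) :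
    φ x + ⟪v, y - x⟫ ≤ φ y := by
  have hc : ConvexOn ℝ Set.univ (fun t : ℝ => φ (AffineMap.lineMap x y t)) :=
    hφ.comp_affineMap (AffineMap.lineMap x y)
  have hd : HasDerivAt (fun t : ℝ => φ (AffineMap.lineMap x y t)) ⟪v, y - x⟫ 0 := by
    have h1 : HasFDerivAt φ (innerSL ℝ v) (AffineMap.lineMap x y (0 : ℝ)) := by
      rw [AffineMap.lineMap_apply_zero]
      exact h.hasFDerivAt
    exact h1.comp_hasDerivAt (0 : ℝ) AffineMap.hasDerivAt_lineMap
  have := hc.le_slope_of_hasDerivAt (Set.mem_univ 0) (Set.mem_univ 1) zero_lt_one hd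
  simp only [slope_def_field, AffineMap.lineMap_apply_one, AffineMap.lineMap_apply_zero] at this
  linarith

section Problem

variable {n : ℕ} {X : Type*} [MeasurableSpace X] {P : Measure X}
  {F : Vec n → X → ℝ} {g : Vec n → X → Vec n} {L : X → ℝ} {L₂ σ : ℝ}

namespace IsStochasticProblem

/-- The upper bound uses the gradient inequality at `y` instead of integrating along the segment.
This costs a factor `2` against the usual `L / 2`, hence the `4 * L₂` in `norm_gradient_sq_le`. -/
theorem gap_ae (h : IsStochasticProblem P F g L L₂ σ) (x y : Vec n) :
    ∀ᵐ ξ ∂P, 0 ≤ F y ξ - F x ξ - ⟪g x ξ, y - x⟫ ∧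
      F y ξ - F x ξ - ⟪g x ξ, y - x⟫ ≤ L ξ * ‖y - x‖ ^ 2 := by
  filter_upwards [h.convex, h.hasGradient, h.lipschitz] with ξ h1 h2 h3
  have h4 := h1.add_inner_le_of_hasGradientAt (h2 x) y
  have h5 := h1.add_inner_le_of_hasGradientAt (h2 y) x
  have h6 := real_inner_le_norm (g y ξ - g x ξ) (y - x)
  have h7 := mul_le_mul_of_nonneg_right (h3 y x) (norm_nonneg (y - x))
  have h8 : ⟪g y ξ, x - y⟫ = -⟪g y ξ, y - x⟫ := by rw [← inner_neg_right, neg_sub]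
  rw [inner_sub_left] at h6
  exact ⟨by linarith, by nlinarith⟩

variable [IsProbabilityMeasure P]

/-- Independent of the differentiability of the objective: the variance bound controls `g x` minus
some fixed vector, whatever that vector is. -/
theorem memLp_grad (h : IsStochasticProblem P F g L L₂ σ) (x : Vec n) : MemLp (g x) 2 P := by
  have hm : Measurable (g x) := h.measurable_grad.comp measurable_prodMk_left
  have h1 : MemLp (fun ξ => g x ξ - gradient (objective P F) x) 2 P :=
    (memLp_two_iff_integrable_sq_norm (hm.sub_const _).aestronglyMeasurable).2 (h.variance x).1
  exact (h1.add (memLp_const (gradient (objective P F) x))).ae_eq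
    (Filter.Eventually.of_forall fun ξ => by simp)

theorem integrable_grad (h : IsStochasticProblem P F g L L₂ σ) (x : Vec n) :
    Integrable (g x) P := (h.memLp_grad x).integrable one_le_two

theorem integral_L_le (h : IsStochasticProblem P F g L L₂ σ) : ∫ ξ, L ξ ∂P ≤ L₂ := by
  have h1 := variance_nonneg L P
  rw [variance_eq_sub h.memLp] at h1
  rw [h.L₂_eq]
  refine Real.le_sqrt_of_sq_le ?_
  simpa using h1

theorem gap_mean (h : IsStochasticProblem P F g L L₂ σ) (x y : Vec n) :
    0 ≤ objective P F y - objective P F x - ⟪∫ ξ, g x ξ ∂P, y - x⟫ ∧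
      objective P F y - objective P F x - ⟪∫ ξ, g x ξ ∂P, y - x⟫ ≤ L₂ * ‖y - x‖ ^ 2 := by
  have hi : Integrable (fun ξ => ⟪g x ξ, y - x⟫) P := (h.integrable_grad x).inner_const _
  have hg : ⟪∫ ξ, g x ξ ∂P, y - x⟫ = ∫ ξ, ⟪g x ξ, y - x⟫ ∂P := by
    rw [real_inner_comm, ← integral_inner (h.integrable_grad x)]
    simp only [real_inner_comm]
  have e : objective P F y - objective P F x - ⟪∫ ξ, g x ξ ∂P, y - x⟫
      = ∫ ξ, (F y ξ - F x ξ - ⟪g x ξ, y - x⟫) ∂P := by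
    have hs : Integrable (fun ξ => F y ξ - F x ξ) P := (h.integrable y).sub (h.integrable x)
    rw [integral_sub hs hi, integral_sub (h.integrable y) (h.integrable x), hg]
    rfl
  rw [e]
  refine ⟨integral_nonneg_of_ae ((h.gap_ae x y).mono fun ξ hξ => hξ.1), ?_⟩
  refine (integral_mono_ae (((h.integrable y).sub (h.integrable x)).sub hi)
    ((h.memLp.integrable one_le_two).mul_const _)
    ((h.gap_ae x y).mono fun ξ hξ => hξ.2)).trans ?_
  rw [integral_mul_const]
  exact mul_le_mul_of_nonneg_right h.integral_L_le (sq_nonneg _)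

/-- No separate interchange of limits is needed: the averaged gap bound already says that the
remainder is `O(‖y - x‖²)`. -/
theorem hasGradientAt (h : IsStochasticProblem P F g L L₂ σ) (x : Vec n) :
    HasGradientAt (objective P F) (∫ ξ, g x ξ ∂P) x := by
  rw [hasGradientAt_iff_isLittleO]
  have h1 : (fun y => objective P F y - objective P F x - ⟪∫ ξ, g x ξ ∂P, y - x⟫)
      =O[nhds x] fun y => ‖y - x‖ ^ 2 := by
    refine Asymptotics.IsBigO.of_bound L₂ (Filter.Eventually.of_forall fun y => ?_)
    rw [Real.norm_eq_abs, abs_of_nonneg (h.gap_mean x y).1, Real.norm_eq_abs,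
      abs_of_nonneg (sq_nonneg _)]
    exact (h.gap_mean x y).2
  refine h1.trans_isLittleO ?_
  have h2 := (Asymptotics.isLittleO_norm_pow_id (E' := Vec n) one_lt_two).comp_tendsto
    (show Filter.Tendsto (fun y => y - x) (nhds x) (nhds 0) by
      simpa using (continuous_sub_right x).tendsto x)
  exact h2

theorem gradient_eq (h : IsStochasticProblem P F g L L₂ σ) (x : Vec n) :
    gradient (objective P F) x = ∫ ξ, g x ξ ∂P := (h.hasGradientAt x).gradient

theorem le_objective (h : IsStochasticProblem P F g L L₂ σ) (x y : Vec n) :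
    objective P F x + ⟪gradient (objective P F) x, y - x⟫ ≤ objective P F y := by
  rw [h.gradient_eq]
  linarith [(h.gap_mean x y).1]

theorem objective_le (h : IsStochasticProblem P F g L L₂ σ) (x y : Vec n) :
    objective P F y
      ≤ objective P F x + ⟪gradient (objective P F) x, y - x⟫ + L₂ * ‖y - x‖ ^ 2 := by
  rw [h.gradient_eq]
  linarith [(h.gap_mean x y).2]

theorem continuous_objective (h : IsStochasticProblem P F g L L₂ σ) :
    Continuous (objective P F) :=
  continuous_iff_continuousAt.2 fun x => (h.hasGradientAt x).differentiableAt.continuousAt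

/-- The minimum does not exceed the value after a gradient step of length `1 / (2 * L₂)`, the
minimizer of the quadratic upper model. -/
theorem norm_gradient_sq_le (h : IsStochasticProblem P F g L L₂ σ) (hL : 0 < L₂) {xs : Vec n}
    (hxs : ∀ y, objective P F xs ≤ objective P F y) (x : Vec n) :
    ‖gradient (objective P F) x‖ ^ 2 ≤ 4 * L₂ * (objective P F x - objective P F xs) := by
  set v := gradient (objective P F) x with hv
  have h1 := (hxs (x - (1 / (2 * L₂)) • v)).trans (h.objective_le x _)
  rw [← hv, sub_sub_cancel_left, inner_neg_right, real_inner_smul_right, norm_neg, norm_smul,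
    real_inner_self_eq_norm_sq, mul_pow, Real.norm_eq_abs, sq_abs] at h1
  field_simp at h1
  nlinarith

theorem objective_sub_le (h : IsStochasticProblem P F g L L₂ σ) (hL : 0 < L₂) {xs : Vec n}
    (hxs : ∀ y, objective P F xs ≤ objective P F y) (x : Vec n) :
    objective P F x - objective P F xs ≤ L₂ * ‖x - xs‖ ^ 2 := by
  have h0 := h.norm_gradient_sq_le hL hxs xs
  have h1 : gradient (objective P F) xs = 0 := by
    rw [sub_self, mul_zero] at h0
    exact norm_eq_zero.1 (pow_eq_zero_iff two_ne_zero |>.1 (le_antisymm h0 (sq_nonneg _)))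
  have h2 := h.objective_le xs x
  rw [h1, inner_zero_left] at h2
  linarith

end IsStochasticProblem

/-! ### Mini-batch gradients. -/

/-- The mini-batch average of the stochastic gradients. -/
noncomputable def batchMean {m : ℕ} (g : Vec n → X → Vec n) (x : Vec n) (ξ : Fin m → X) : Vec n :=
  (1 / (m : ℝ)) • ∑ i, g x (ξ i)

namespace IsStochasticProblem

variable [IsProbabilityMeasure P]

theorem memLp_batchMean (h : IsStochasticProblem P F g L L₂ σ) (m : ℕ) (x : Vec n) :
    MemLp (batchMean (m := m) g x) 2 (Measure.pi fun _ => P) := by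
  have h1 : MemLp (fun ξ : Fin m → X => ∑ i, g x (ξ i)) 2 (Measure.pi fun _ => P) :=
    memLp_finsetSum _ fun i _ => (h.memLp_grad x).comp_measurePreserving
      (measurePreserving_eval (fun _ : Fin m => P) i)
  exact h1.const_smul (1 / (m : ℝ))

theorem integral_batchMean (h : IsStochasticProblem P F g L L₂ σ) {m : ℕ} (hm : 1 ≤ m)
    (x : Vec n) :
    ∫ ξ, batchMean (m := m) g x ξ ∂(Measure.pi fun _ => P) = gradient (objective P F) x := by
  have hp := fun i : Fin m => measurePreserving_eval (fun _ : Fin m => P) i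
  have hi : ∀ i : Fin m, ∫ ξ : Fin m → X, g x (ξ i) ∂(Measure.pi fun _ => P) = ∫ ξ, g x ξ ∂P :=
    fun i => by
      have hmap := integral_map (f := g x) (hp i).measurable.aemeasurable
        (by rw [(hp i).map_eq]; exact (h.memLp_grad x).1)
      rw [(hp i).map_eq] at hmap
      exact hmap.symm
  unfold batchMean
  have hint : ∀ i : Fin m, Integrable (fun ξ : Fin m → X => g x (ξ i)) (Measure.pi fun _ => P) :=
    fun i => (hp i).integrable_comp_of_integrable (h.integrable_grad x)
  rw [integral_smul, integral_finsetSum _ fun i _ => hint i]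
  simp only [hi, h.gradient_eq, Finset.sum_const, Finset.card_univ, Fintype.card_fin,
    ← Nat.cast_smul_eq_nsmul ℝ, smul_smul]
  rw [one_div, inv_mul_cancel₀ (by positivity), one_smul]

/-- In each coordinate the second moment is squared mean plus variance, and independence divides the
variance by `m`. -/
theorem integral_norm_batchMean_sq_le (h : IsStochasticProblem P F g L L₂ σ) {m : ℕ} (hm : 1 ≤ m)
    (x : Vec n) :
    ∫ ξ, ‖batchMean (m := m) g x ξ‖ ^ 2 ∂(Measure.pi fun _ => P)
      ≤ ‖gradient (objective P F) x‖ ^ 2 + σ ^ 2 / m := by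
  have hm0 : (0 : ℝ) < m := by exact_mod_cast hm
  have hgl : ∀ l, MemLp (fun ξ => g x ξ l) 2 P := fun l =>
    (PiLp.proj 2 (fun _ : Fin n => ℝ) l : Vec n →L[ℝ] ℝ).comp_memLp' (h.memLp_grad x)
  have hbl : ∀ l, MemLp (fun ξ => batchMean (m := m) g x ξ l) 2 (Measure.pi fun _ => P) := fun l =>
    (PiLp.proj 2 (fun _ : Fin n => ℝ) l : Vec n →L[ℝ] ℝ).comp_memLp' (h.memLp_batchMean m x)
  have hbi : ∀ l, ∫ ξ, batchMean (m := m) g x ξ l ∂(Measure.pi fun _ => P)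
      = gradient (objective P F) x l := fun l => by
    rw [← h.integral_batchMean hm x]
    exact ((PiLp.proj 2 (fun _ : Fin n => ℝ) l : Vec n →L[ℝ] ℝ).integral_comp_comm
      ((h.memLp_batchMean m x).integrable one_le_two))
  have hgi : ∀ l, ∫ ξ, g x ξ l ∂P = gradient (objective P F) x l := fun l => by
    rw [h.gradient_eq]
    exact ((PiLp.proj 2 (fun _ : Fin n => ℝ) l : Vec n →L[ℝ] ℝ).integral_comp_comm
      (h.integrable_grad x))
  have hv : ∀ l, Var[fun ξ => batchMean (m := m) g x ξ l; Measure.pi fun _ => P]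
      = 1 / m * Var[fun ξ => g x ξ l; P] := fun l => by
    have e : (fun ξ => batchMean (m := m) g x ξ l)
        = fun ξ => 1 / (m : ℝ) * (∑ i, fun ω : Fin m → X => g x (ω i) l) ξ := by
      ext ξ; simp [batchMean]
    rw [e, variance_const_mul, variance_sum_pi (X := fun _ ξ => g x ξ l) fun _ => hgl l]
    simp only [Finset.sum_const, Finset.card_univ, Fintype.card_fin, nsmul_eq_mul]
    field_simp
  have hsq : ∀ l, ∫ ξ, batchMean (m := m) g x ξ l ^ 2 ∂(Measure.pi fun _ => P)
      = (gradient (objective P F) x l) ^ 2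
        + 1 / m * ∫ ξ, (g x ξ l - gradient (objective P F) x l) ^ 2 ∂P := fun l => by
    have h1 := variance_eq_sub (hbl l)
    rw [hv l, variance_eq_integral (hgl l).1.aemeasurable, hgi l, hbi l] at h1
    simp only [Pi.pow_apply] at h1
    linarith
  have hvar := (h.variance x).2
  simp only [EuclideanSpace.norm_sq_eq, Real.norm_eq_abs, sq_abs, PiLp.sub_apply] at hvar ⊢
  have hcl : ∀ l, Integrable (fun ξ => (g x ξ l - gradient (objective P F) x l) ^ 2) P := fun l =>
    ((hgl l).sub (memLp_const (gradient (objective P F) x l))).integrable_sq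
  rw [integral_finsetSum _ fun l _ => hcl l] at hvar
  rw [integral_finsetSum _ fun l _ => (hbl l).integrable_sq]
  simp only [hsq, Finset.sum_add_distrib, ← Finset.mul_sum]
  have := mul_le_mul_of_nonneg_left hvar (one_div_pos.2 hm0).le
  rw [one_div_mul_eq_div] at this
  rw [one_div_mul_eq_div] at *
  linarith

end IsStochasticProblem

end Problem

/-! ### Moments of a uniform direction. -/

theorem sumNorm_smul {n : ℕ} {r : ℝ} (hr : r ≠ 0) (a : ℝ) (x : Vec n) :
    sumNorm r (a • x) = |a| * sumNorm r x := by
  have e1 : ∀ i, |(a • x) i| ^ r = |a| ^ r * |x i| ^ r := fun i => by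
    rw [PiLp.smul_apply, smul_eq_mul, abs_mul, Real.mul_rpow (abs_nonneg _) (abs_nonneg _)]
  simp only [sumNorm, e1]
  rw [← Finset.mul_sum, Real.mul_rpow (by positivity) (sum_abs_rpow_nonneg r x),
    ← Real.rpow_mul (abs_nonneg a), mul_one_div_cancel hr, Real.rpow_one]

theorem sumNorm_le_norm {n : ℕ} {r : ℝ} (hr : 2 ≤ r) (x : Vec n) : sumNorm r x ≤ ‖x‖ := by
  rw [← sumNorm_two]
  exact sumNorm_le_sumNorm two_pos hr x

theorem measurable_sumNorm {n : ℕ} (r : ℝ) : Measurable (sumNorm (n := n) r) := by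
  unfold sumNorm
  fun_prop

theorem sumNorm_sq_le_one {n : ℕ} {r : ℝ} (hr : 2 ≤ r) {e : Vec n} (he : ‖e‖ = 1) :
    sumNorm r e ^ 2 ≤ 1 :=
  pow_le_one₀ (sumNorm_nonneg _ _) ((sumNorm_le_norm hr e).trans he.le)

theorem integrable_inner_sq_mul_sumNorm_sq {n : ℕ} (hn : 1 ≤ n) {r : ℝ} (hr : 2 ≤ r) (s : Vec n) :
    Integrable (fun e => ⟪s, e⟫ ^ 2 * sumNorm r e ^ 2) (sphereUniform n) := by
  have := isProbabilityMeasure_sphereUniform hn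
  have hm := measurable_sumNorm (n := n) r
  refine Integrable.of_bound (C := ‖s‖ ^ 2) (by fun_prop) ?_
  filter_upwards [norm_eq_one_ae_sphereUniform n] with e he
  have h1 := norm_inner_le_norm (𝕜 := ℝ) s e
  rw [he, mul_one] at h1
  rw [norm_mul, norm_pow, Real.norm_of_nonneg (sq_nonneg (sumNorm r e))]
  calc _ ≤ ‖s‖ ^ 2 * 1 := mul_le_mul (pow_le_pow_left₀ (norm_nonneg _) h1 2)
        (sumNorm_sq_le_one hr he) (sq_nonneg _) (sq_nonneg _)
    _ = _ := mul_one _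

theorem integral_inner_sq_mul_sumNorm_sq_le {n : ℕ} (hn : 1 ≤ n) {r R : ℝ} (hr : 2 ≤ r)
    (hR : (r - 1) * (n : ℝ) ^ (2 / r - 1) ≤ R) (s : Vec n) :
    ∫ e, ⟪s, e⟫ ^ 2 * sumNorm r e ^ 2 ∂sphereUniform n ≤ R / n * ‖s‖ ^ 2 := by
  simp only [sumNorm_sq]
  refine (integral_inner_sq_mul_rpow_sphereUniform_le hn s hr).trans ?_
  gcongr

/-- The weighted bound is summed over the unit vectors, since `∑ i, e i ^ 2 = 1` on the sphere. -/
theorem integral_sumNorm_sq_le {n : ℕ} (hn : 1 ≤ n) {r R : ℝ} (hr : 2 ≤ r)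
    (hR : (r - 1) * (n : ℝ) ^ (2 / r - 1) ≤ R) :
    ∫ e, sumNorm r e ^ 2 ∂sphereUniform n ≤ R := by
  have hn0 : (n : ℝ) ≠ 0 := by positivity
  have h1 : ∫ e, sumNorm r e ^ 2 ∂sphereUniform n
      = ∫ e, ∑ i, ⟪EuclideanSpace.single i (1 : ℝ), e⟫ ^ 2 * sumNorm r e ^ 2 ∂sphereUniform n := by
    refine integral_congr_ae ?_
    filter_upwards [norm_eq_one_ae_sphereUniform n] with e he
    have h2 : ∑ i, e i ^ 2 = 1 := by
      have := EuclideanSpace.norm_sq_eq e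
      rw [he] at this
      simpa using this.symm
    rw [← Finset.sum_mul]
    simp [EuclideanSpace.inner_single_left, h2]
  rw [h1, integral_finsetSum _ fun i _ => integrable_inner_sq_mul_sumNorm_sq hn hr _]
  calc _ ≤ ∑ i : Fin n, R / n * ‖(EuclideanSpace.single i (1 : ℝ) : Vec n)‖ ^ 2 :=
        Finset.sum_le_sum fun i _ => integral_inner_sq_mul_sumNorm_sq_le hn hr hR _
    _ = R := by simp [mul_div_cancel₀ R hn0]

/-- Jensen's inequality gains the factor `√n` over the pointwise bound by `‖v‖`. -/
theorem integral_abs_inner_sphereUniform_le {n : ℕ} (hn : 1 ≤ n) (v : Vec n) :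
    ∫ e, |⟪v, e⟫| ∂sphereUniform n ≤ ‖v‖ / √n := by
  have := isProbabilityMeasure_sphereUniform hn
  have hi : Integrable (fun e => ⟪v, e⟫ ^ 2) (sphereUniform n) := by
    simpa only [sq] using integrable_inner_mul_inner_sphereUniform hn v v
  have hm : MemLp (fun e => |⟪v, e⟫|) 2 (sphereUniform n) := by
    rw [memLp_two_iff_integrable_sq (by fun_prop)]
    simpa only [sq_abs] using hi
  have h1 := variance_nonneg (fun e => |⟪v, e⟫|) (sphereUniform n)
  rw [variance_eq_sub hm] at h1
  simp only [Pi.pow_apply, sq_abs, integral_inner_sq_sphereUniform hn] at h1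
  have h2 : (‖v‖ / √n) ^ 2 = ‖v‖ ^ 2 / n := by rw [div_pow, Real.sq_sqrt (Nat.cast_nonneg n)]
  exact (le_abs_self _).trans (abs_le_of_sq_le_sq (by rw [h2]; linarith) (by positivity))

/-! ### Expected change of the potential in one step. -/

section OneStep

variable {n : ℕ} {Ξ : Type*} {γ : Ξ → Vec n} {c : Vec n × Ξ → ℝ} {r R K D : ℝ}

/-- The increment of the potential caused by the gradient estimate `(⟨γ ξ, e⟩ + c (e, ξ)) e`. -/
noncomputable def stepIncrement (r s : ℝ) (v : Vec n) (γ : Ξ → Vec n) (c : Vec n × Ξ → ℝ)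
    (w : Vec n × Ξ) : ℝ :=
  -(s * ⟪(⟪γ w.2, w.1⟫ + c w) • w.1, v⟫)
    + s ^ 2 / 2 * sumNorm r ((⟪γ w.2, w.1⟫ + c w) • w.1) ^ 2

/-- A crude domination; it serves integrability only. -/
theorem abs_stepIncrement_le (hr : 2 ≤ r) {s : ℝ} (hs : 0 ≤ s) (v : Vec n) {w : Vec n × Ξ}
    (hw : ‖w.1‖ = 1) :
    |stepIncrement r s v γ c w|
      ≤ s * (‖γ w.2‖ ^ 2 + c w ^ 2 + ‖v‖ ^ 2) + s ^ 2 * (‖γ w.2‖ ^ 2 + c w ^ 2) := by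
  set a := ⟪γ w.2, w.1⟫ + c w with ha
  have h1 := abs_real_inner_le_norm (γ w.2) w.1
  rw [hw, mul_one] at h1
  have h2 : ⟪γ w.2, w.1⟫ ^ 2 ≤ ‖γ w.2‖ ^ 2 := by
    rw [← sq_abs]; exact pow_le_pow_left₀ (abs_nonneg _) h1 2
  have h3 : a ^ 2 ≤ 2 * (‖γ w.2‖ ^ 2 + c w ^ 2) := by
    nlinarith [sq_nonneg (⟪γ w.2, w.1⟫ - c w)]
  have h4 : |⟪a • w.1, v⟫| ≤ ‖γ w.2‖ ^ 2 + c w ^ 2 + ‖v‖ ^ 2 := by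
    have := abs_real_inner_le_norm (a • w.1) v
    rw [norm_smul, hw, mul_one, Real.norm_eq_abs] at this
    nlinarith [sq_nonneg (|a| - ‖v‖), sq_abs a, sq_nonneg ‖v‖]
  have h5 : sumNorm r (a • w.1) ^ 2 ≤ a ^ 2 := by
    rw [sumNorm_smul (by linarith), mul_pow, sq_abs]
    exact mul_le_of_le_one_right (sq_nonneg _) (sumNorm_sq_le_one hr hw)
  have h6 := sq_nonneg (sumNorm r (a • w.1))
  rw [stepIncrement, ← ha]
  refine (abs_add_le _ _).trans (add_le_add ?_ ?_)
  · rw [abs_neg, abs_mul, abs_of_nonneg hs]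
    exact mul_le_mul_of_nonneg_left h4 hs
  · rw [abs_of_nonneg (by positivity)]
    nlinarith [sq_nonneg s]

/-- Gradient and noise are separated by `(a + b)² ≤ 2a² + 2b²`, so that the noise may depend on the
sample and on the direction. -/
theorem stepIncrement_le (hr : 2 ≤ r) {s : ℝ} (hs : 0 ≤ s) (v : Vec n) (w : Vec n × Ξ) :
    stepIncrement r s v γ c w
      ≤ -(s * (⟪γ w.2, w.1⟫ * ⟪v, w.1⟫)) + s * (|c w| * |⟪v, w.1⟫|)
        + (s ^ 2 * (⟪γ w.2, w.1⟫ ^ 2 * sumNorm r w.1 ^ 2)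
          + s ^ 2 * (c w ^ 2 * sumNorm r w.1 ^ 2)) := by
  rw [stepIncrement, sumNorm_smul (by linarith), mul_pow, sq_abs, real_inner_smul_left,
    real_inner_comm v w.1]
  have h1 : -(c w * ⟪v, w.1⟫) ≤ |c w| * |⟪v, w.1⟫| := by
    rw [← abs_mul]; exact neg_le_abs _
  have h2 := mul_le_mul_of_nonneg_left h1 hs
  have h3 : s ^ 2 * sumNorm r w.1 ^ 2 * (⟪γ w.2, w.1⟫ + c w) ^ 2
      ≤ s ^ 2 * sumNorm r w.1 ^ 2 * (2 * ⟪γ w.2, w.1⟫ ^ 2 + 2 * c w ^ 2) :=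
    mul_le_mul_of_nonneg_left (by nlinarith [sq_nonneg (⟪γ w.2, w.1⟫ - c w)]) (by positivity)
  nlinarith

variable [MeasurableSpace Ξ] {π : Measure Ξ}

theorem norm_fst_eq_one_ae (n : ℕ) (π : Measure Ξ) [SFinite π] :
    ∀ᵐ w ∂(sphereUniform n).prod π, ‖w.1‖ = 1 :=
  Measure.quasiMeasurePreserving_fst.ae (norm_eq_one_ae_sphereUniform n)

theorem measurable_stepIncrement (hγ : Measurable γ) (hc : Measurable c) (s : ℝ) (v : Vec n) :
    Measurable (stepIncrement r s v γ c) := by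
  have := measurable_sumNorm (n := n) r
  unfold stepIncrement
  fun_prop

variable [IsProbabilityMeasure π]

theorem integrable_noise_sq (hn : 1 ≤ n) (hc : Measurable c)
    (hK : ∀ e : Vec n, ‖e‖ = 1 → Integrable (fun ξ => c (e, ξ) ^ 2) π ∧
      ∫ ξ, c (e, ξ) ^ 2 ∂π ≤ K) :
    Integrable (fun w => c w ^ 2) ((sphereUniform n).prod π) ∧
      ∫ w, c w ^ 2 ∂(sphereUniform n).prod π ≤ K := by
  have := isProbabilityMeasure_sphereUniform hn
  have hm : AEStronglyMeasurable (fun w => c w ^ 2) ((sphereUniform n).prod π) := by fun_prop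
  have hae := norm_eq_one_ae_sphereUniform n
  have hi2 : Integrable (fun e => ∫ ξ, c (e, ξ) ^ 2 ∂π) (sphereUniform n) := by
    refine Integrable.of_bound (C := K)
      ((hc.pow_const 2).stronglyMeasurable.integral_prod_right').aestronglyMeasurable ?_
    filter_upwards [hae] with e he
    rw [Real.norm_of_nonneg (integral_nonneg fun _ => sq_nonneg _)]
    exact (hK e he).2
  have hi : Integrable (fun w => c w ^ 2) ((sphereUniform n).prod π) := by
    rw [integrable_prod_iff hm]
    refine ⟨hae.mono fun e he => (hK e he).1, ?_⟩
    simpa only [Real.norm_of_nonneg (sq_nonneg (c _))] using hi2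
  refine ⟨hi, ?_⟩
  rw [integral_prod _ hi]
  refine (integral_mono_ae hi2 (integrable_const K) (hae.mono fun e he => (hK e he).2)).trans ?_
  simp

theorem integral_abs_stepIncrement_le (hn : 1 ≤ n) (hr : 2 ≤ r) (hγ : MemLp γ 2 π)
    (hc : Measurable c)
    (hK : ∀ e : Vec n, ‖e‖ = 1 → Integrable (fun ξ => c (e, ξ) ^ 2) π ∧
      ∫ ξ, c (e, ξ) ^ 2 ∂π ≤ K) {s : ℝ} (hs : 0 ≤ s) (v : Vec n) :
    ∫ w, |stepIncrement r s v γ c w| ∂(sphereUniform n).prod π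
      ≤ s * (∫ ξ, ‖γ ξ‖ ^ 2 ∂π + K + ‖v‖ ^ 2) + s ^ 2 * (∫ ξ, ‖γ ξ‖ ^ 2 ∂π + K) := by
  have := isProbabilityMeasure_sphereUniform hn
  have hγ2 : Integrable (fun ξ => ‖γ ξ‖ ^ 2) π := hγ.integrable_norm_pow two_ne_zero
  have hγ2Q : Integrable (fun w : Vec n × Ξ => ‖γ w.2‖ ^ 2) ((sphereUniform n).prod π) :=
    hγ2.comp_snd _
  have hγe : ∫ w : Vec n × Ξ, ‖γ w.2‖ ^ 2 ∂(sphereUniform n).prod π = ∫ ξ, ‖γ ξ‖ ^ 2 ∂π := by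
    rw [integral_fun_snd (fun ξ => ‖γ ξ‖ ^ 2)]
    simp
  obtain ⟨hc2, hcK⟩ := integrable_noise_sq hn hc hK
  have h1 : Integrable (fun w : Vec n × Ξ => ‖γ w.2‖ ^ 2 + c w ^ 2) ((sphereUniform n).prod π) :=
    hγ2Q.add hc2
  have h2 : Integrable (fun w : Vec n × Ξ => ‖γ w.2‖ ^ 2 + c w ^ 2 + ‖v‖ ^ 2)
      ((sphereUniform n).prod π) := h1.add (integrable_const _)
  refine (integral_mono_of_nonneg (Filter.Eventually.of_forall fun _ => abs_nonneg _)
    ((h2.const_mul s).add (h1.const_mul (s ^ 2)))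
    ((norm_fst_eq_one_ae n π).mono fun w hw => abs_stepIncrement_le hr hs v hw)).trans ?_
  rw [integral_add' (h2.const_mul s) (h1.const_mul (s ^ 2)), integral_const_mul,
    integral_const_mul, integral_add h1 (integrable_const _), integral_add hγ2Q hc2, hγe]
  simp only [integral_const, probReal_univ, one_smul]
  gcongr

/-- The expected increment of the potential in one step. -/
theorem integral_stepIncrement_le (hn : 1 ≤ n) (hr : 2 ≤ r)
    (hR : (r - 1) * (n : ℝ) ^ (2 / r - 1) ≤ R) (hγm : Measurable γ) (hγ : MemLp γ 2 π)
    (hc : Measurable c)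
    (hK : ∀ e : Vec n, ‖e‖ = 1 → Integrable (fun ξ => c (e, ξ) ^ 2) π ∧
      ∫ ξ, c (e, ξ) ^ 2 ∂π ≤ K)
    (hD : ∀ e : Vec n, ‖e‖ = 1 → ∫ ξ, |c (e, ξ)| ∂π ≤ D) (hD0 : 0 ≤ D) (hK0 : 0 ≤ K)
    {s : ℝ} (hs : 0 ≤ s) (v : Vec n) :
    Integrable (stepIncrement r s v γ c) ((sphereUniform n).prod π) ∧
    ∫ w, stepIncrement r s v γ c w ∂(sphereUniform n).prod π
      ≤ -(s * (⟪∫ ξ, γ ξ ∂π, v⟫ / n)) + s * (D * (‖v‖ / √n))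
        + (s ^ 2 * (R / n * ∫ ξ, ‖γ ξ‖ ^ 2 ∂π) + s ^ 2 * (K * R)) := by
  have := isProbabilityMeasure_sphereUniform hn
  set Q := (sphereUniform n).prod π with hQ
  have hmN := measurable_sumNorm (n := n) r
  have hae := norm_eq_one_ae_sphereUniform n
  have haeQ : ∀ᵐ w ∂Q, ‖w.1‖ = 1 := norm_fst_eq_one_ae n π
  have hγ2 : Integrable (fun ξ => ‖γ ξ‖ ^ 2) π := hγ.integrable_norm_pow two_ne_zero
  have hγ2Q : Integrable (fun w : Vec n × Ξ => ‖γ w.2‖ ^ 2) Q := hγ2.comp_snd _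
  obtain ⟨hc2, -⟩ := integrable_noise_sq hn hc hK
  have hinc : Integrable (stepIncrement r s v γ c) Q := by
    refine Integrable.mono' (g := fun w => s * (‖γ w.2‖ ^ 2 + c w ^ 2 + ‖v‖ ^ 2)
      + s ^ 2 * (‖γ w.2‖ ^ 2 + c w ^ 2)) ?_
      (measurable_stepIncrement hγm hc s v).aestronglyMeasurable
      (haeQ.mono fun w hw => abs_stepIncrement_le hr hs v hw)
    exact (((hγ2Q.add hc2).add (integrable_const _)).const_mul s).add
      ((hγ2Q.add hc2).const_mul _)
  refine ⟨hinc, ?_⟩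
  have i1 : Integrable (fun w : Vec n × Ξ => ⟪γ w.2, w.1⟫ * ⟪v, w.1⟫) Q := by
    refine Integrable.mono' (hγ2Q.add (integrable_const (‖v‖ ^ 2)))
      (by fun_prop) (haeQ.mono fun w hw => ?_)
    have h1 := abs_real_inner_le_norm (γ w.2) w.1
    have h2 := abs_real_inner_le_norm v w.1
    rw [hw, mul_one] at h1 h2
    rw [norm_mul, Real.norm_eq_abs, Real.norm_eq_abs]
    have := mul_le_mul h1 h2 (abs_nonneg _) (norm_nonneg _)
    simp only [Pi.add_apply]
    nlinarith [sq_nonneg (‖γ w.2‖ - ‖v‖)]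
  have i2 : Integrable (fun w : Vec n × Ξ => |c w| * |⟪v, w.1⟫|) Q := by
    refine Integrable.mono' (hc2.add (integrable_const (‖v‖ ^ 2)))
      (by fun_prop) (haeQ.mono fun w hw => ?_)
    have h2 := abs_real_inner_le_norm v w.1
    rw [hw, mul_one] at h2
    rw [norm_mul, Real.norm_eq_abs, Real.norm_eq_abs, abs_abs, abs_abs]
    have := mul_le_mul_of_nonneg_left h2 (abs_nonneg (c w))
    simp only [Pi.add_apply]
    nlinarith [sq_nonneg (|c w| - ‖v‖), sq_abs (c w)]
  have i3 : Integrable (fun w : Vec n × Ξ => ⟪γ w.2, w.1⟫ ^ 2 * sumNorm r w.1 ^ 2) Q := by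
    refine Integrable.mono' hγ2Q (by fun_prop) (haeQ.mono fun w hw => ?_)
    have h1 := abs_real_inner_le_norm (γ w.2) w.1
    rw [hw, mul_one] at h1
    rw [Real.norm_of_nonneg (by positivity), ← sq_abs ⟪γ w.2, w.1⟫]
    calc _ ≤ ‖γ w.2‖ ^ 2 * 1 := mul_le_mul (pow_le_pow_left₀ (abs_nonneg _) h1 2)
          (sumNorm_sq_le_one hr hw) (sq_nonneg _) (sq_nonneg _)
      _ = _ := mul_one _
  have i4 : Integrable (fun w : Vec n × Ξ => c w ^ 2 * sumNorm r w.1 ^ 2) Q := by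
    refine Integrable.mono' hc2 (by fun_prop) (haeQ.mono fun w hw => ?_)
    rw [Real.norm_of_nonneg (by positivity)]
    exact mul_le_of_le_one_right (sq_nonneg _) (sumNorm_sq_le_one hr hw)
  -- In the gradient terms the direction is integrated first, with the samples fixed. In the noise
  -- terms the samples come first, because the noise is controlled for each fixed direction only.
  have b1 : ∫ w : Vec n × Ξ, ⟪γ w.2, w.1⟫ * ⟪v, w.1⟫ ∂Q = ⟪∫ ξ, γ ξ ∂π, v⟫ / n := by
    rw [integral_prod_symm _ i1]
    simp only [integral_inner_mul_inner_sphereUniform hn]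
    rw [integral_div, real_inner_comm, ← integral_inner (hγ.integrable one_le_two)]
    simp only [real_inner_comm]
  have b2 : ∫ w : Vec n × Ξ, |c w| * |⟪v, w.1⟫| ∂Q ≤ D * (‖v‖ / √n) := by
    rw [integral_prod _ i2]
    simp only [integral_mul_const]
    have hvi : Integrable (fun e => |⟪v, e⟫|) (sphereUniform n) := by
      refine Integrable.of_bound (C := ‖v‖) (by fun_prop) (hae.mono fun e he => ?_)
      have h2 := abs_real_inner_le_norm v e
      rw [he, mul_one] at h2
      rwa [Real.norm_eq_abs, abs_abs]
    refine (integral_mono_of_nonneg (Filter.Eventually.of_forall fun e => ?_)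
      (hvi.const_mul D) (hae.mono fun e he => ?_)).trans ?_
    · exact mul_nonneg (integral_nonneg fun _ => abs_nonneg _) (abs_nonneg _)
    · exact mul_le_mul_of_nonneg_right (hD e he) (abs_nonneg _)
    · rw [integral_const_mul]
      exact mul_le_mul_of_nonneg_left (integral_abs_inner_sphereUniform_le hn v) hD0
  have b3 : ∫ w : Vec n × Ξ, ⟪γ w.2, w.1⟫ ^ 2 * sumNorm r w.1 ^ 2 ∂Q
      ≤ R / n * ∫ ξ, ‖γ ξ‖ ^ 2 ∂π := by
    rw [integral_prod_symm _ i3, ← integral_const_mul]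
    exact integral_mono_of_nonneg (Filter.Eventually.of_forall fun ξ =>
      integral_nonneg fun e => by positivity) (hγ2.const_mul _)
      (Filter.Eventually.of_forall fun ξ => integral_inner_sq_mul_sumNorm_sq_le hn hr hR (γ ξ))
  have b4 : ∫ w : Vec n × Ξ, c w ^ 2 * sumNorm r w.1 ^ 2 ∂Q ≤ K * R := by
    rw [integral_prod _ i4]
    simp only [integral_mul_const]
    have hvi : Integrable (fun e => sumNorm r e ^ 2) (sphereUniform n) := by
      refine Integrable.of_bound (C := 1) (by fun_prop) (hae.mono fun e he => ?_)
      rw [Real.norm_of_nonneg (sq_nonneg _)]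
      exact sumNorm_sq_le_one hr he
    refine (integral_mono_of_nonneg (Filter.Eventually.of_forall fun e => ?_)
      (hvi.const_mul K) (hae.mono fun e he => ?_)).trans ?_
    · exact mul_nonneg (integral_nonneg fun _ => sq_nonneg _) (sq_nonneg _)
    · exact mul_le_mul_of_nonneg_right (hK e he).2 (sq_nonneg _)
    · rw [integral_const_mul]
      exact mul_le_mul_of_nonneg_left (integral_sumNorm_sq_le hn hr hR) hK0
  have j1 := (i1.const_mul s).neg
  have j2 := i2.const_mul s
  have j3 := i3.const_mul (s ^ 2)
  have j4 := i4.const_mul (s ^ 2)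
  refine (integral_mono hinc ((j1.add j2).add (j3.add j4)) fun w =>
    stepIncrement_le hr hs v w).trans ?_
  have e1 := integral_add' (j1.add j2) (j3.add j4)
  rw [e1, integral_add' j1 j2, integral_add' j3 j4, integral_neg', integral_const_mul,
    integral_const_mul, integral_const_mul, integral_const_mul, b1]
  have := mul_le_mul_of_nonneg_left b2 hs
  have := mul_le_mul_of_nonneg_left b3 (sq_nonneg s)
  have := mul_le_mul_of_nonneg_left b4 (sq_nonneg s)
  linarith

end OneStep

/-! ### Noise of a mini-batch. -/

section Noise

variable {n m : ℕ} {X : Type*}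

/-- The mini-batch average of the noise. -/
noncomputable def batchNoise (ζ η : Vec n → X → Vec n → ℝ) (x : Vec n)
    (w : Vec n × (Fin m → X)) : ℝ :=
  1 / (m : ℝ) * ∑ i, (ζ x (w.2 i) w.1 + η x (w.2 i) w.1)

theorem batchGrad_noisyDeriv (g : Vec n → X → Vec n) (ζ η : Vec n → X → Vec n → ℝ) (x e : Vec n)
    (ξ : Fin m → X) :
    batchGrad (noisyDeriv g ζ η) x ξ e
      = (⟪batchMean g x ξ, e⟫ + batchNoise ζ η x (e, ξ)) • e := by
  simp only [batchGrad, noisyDeriv, batchMean, batchNoise, ← Finset.sum_smul, smul_smul,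
    real_inner_smul_left, sum_inner, add_assoc, Finset.sum_add_distrib]
  congr 1
  ring

variable [MeasurableSpace X] {P : Measure X}
  {ζ η : Vec n → X → Vec n → ℝ} {Δζ Δη : ℝ}

theorem IsNoise.measurable_section (h : IsNoise P ζ η Δζ Δη) (x e : Vec n) :
    Measurable (fun ξ => ζ x ξ e) ∧ Measurable (fun ξ => η x ξ e) := by
  have hp : Measurable (fun ξ : X => (x, ξ, e)) := by fun_prop
  exact ⟨h.measurable_zeta.comp hp, h.measurable_eta.comp hp⟩

theorem measurable_batchNoise (h : IsNoise P ζ η Δζ Δη) :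
    Measurable fun t : Vec n × Vec n × (Fin m → X) => batchNoise ζ η t.1 t.2 := by
  unfold batchNoise
  refine Measurable.const_mul (Finset.measurable_fun_sum _ fun i _ => Measurable.add ?_ ?_) _
  · exact h.measurable_zeta.comp
      (show Measurable fun t : Vec n × Vec n × (Fin m → X) => (t.1, t.2.2 i, t.2.1) by fun_prop)
  · exact h.measurable_eta.comp
      (show Measurable fun t : Vec n × Vec n × (Fin m → X) => (t.1, t.2.2 i, t.2.1) by fun_prop)

variable [IsProbabilityMeasure P]

theorem exists_norm_eq_one (hn : 1 ≤ n) : ∃ e : Vec n, ‖e‖ = 1 :=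
  ⟨EuclideanSpace.single ⟨0, hn⟩ 1, by simp⟩

theorem IsNoise.nonneg (h : IsNoise P ζ η Δζ Δη) (hn : 1 ≤ n) : 0 ≤ Δζ ∧ 0 ≤ Δη := by
  obtain ⟨e, he⟩ := exists_norm_eq_one hn
  refine ⟨(integral_nonneg fun _ => sq_nonneg _).trans (h.zeta_bound 0 e he).2, ?_⟩
  obtain ⟨ξ, hξ⟩ := (h.eta_bound 0 e he).exists
  exact (abs_nonneg _).trans hξ

theorem integral_abs_le_sqrt {Y : Type*} [MeasurableSpace Y] {ν : Measure Y}
    [IsProbabilityMeasure ν] {u : Y → ℝ} (hm : AEStronglyMeasurable u ν)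
    (hu : Integrable (fun y => u y ^ 2) ν) : ∫ y, |u y| ∂ν ≤ √(∫ y, u y ^ 2 ∂ν) := by
  have h1 := variance_nonneg (fun y => |u y|) ν
  have hm2 : MemLp (fun y => |u y|) 2 ν :=
    (memLp_two_iff_integrable_sq hm.norm).2 (by simpa using hu)
  rw [variance_eq_sub hm2] at h1
  simp only [Pi.pow_apply, sq_abs] at h1
  exact Real.le_sqrt_of_sq_le (by linarith)

theorem IsNoise.sum_bounds (h : IsNoise P ζ η Δζ Δη) (hn : 1 ≤ n) (x : Vec n) {e : Vec n}
    (he : ‖e‖ = 1) :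
    Integrable (fun ξ => (ζ x ξ e + η x ξ e) ^ 2) P ∧
      ∫ ξ, (ζ x ξ e + η x ξ e) ^ 2 ∂P ≤ 3 / 2 * Δζ + 3 * Δη ^ 2 ∧
      Integrable (fun ξ => |ζ x ξ e + η x ξ e|) P ∧
      ∫ ξ, |ζ x ξ e + η x ξ e| ∂P ≤ √Δζ + Δη := by
  obtain ⟨hζ0, hη0⟩ := h.nonneg hn
  obtain ⟨hζm, hηm⟩ := h.measurable_section x e
  obtain ⟨hζi, hζb⟩ := h.zeta_bound x e he
  have hηb := h.eta_bound x e he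
  -- The weights `3/2` and `3` come from `(a - 2b)² ≥ 0`. Equal weights `2` would end in the
  -- coefficient `1/11` of `n / L₂ * Δζ`, above the `1/12` of the theorem.
  have hsq : ∀ᵐ ξ ∂P, (ζ x ξ e + η x ξ e) ^ 2 ≤ 3 / 2 * ζ x ξ e ^ 2 + 3 * Δη ^ 2 := by
    filter_upwards [hηb] with ξ hξ
    have := pow_le_pow_left₀ (abs_nonneg _) hξ 2
    rw [sq_abs] at this
    nlinarith [sq_nonneg (ζ x ξ e - 2 * η x ξ e)]
  have hI : Integrable (fun ξ => 3 / 2 * ζ x ξ e ^ 2 + 3 * Δη ^ 2) P :=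
    (hζi.const_mul _).add (integrable_const _)
  have hsi : Integrable (fun ξ => (ζ x ξ e + η x ξ e) ^ 2) P := by
    refine hI.mono' (by fun_prop) (hsq.mono fun ξ hξ => ?_)
    rwa [Real.norm_of_nonneg (sq_nonneg _)]
  have hm2 : MemLp (fun ξ => ζ x ξ e + η x ξ e) 2 P :=
    (memLp_two_iff_integrable_sq (by fun_prop)).2 hsi
  have hζ2 : MemLp (fun ξ => ζ x ξ e) 2 P :=
    (memLp_two_iff_integrable_sq (by fun_prop)).2 hζi
  refine ⟨hsi, ?_, (hm2.integrable one_le_two).abs, ?_⟩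
  · refine (integral_mono_ae hsi hI hsq).trans ?_
    rw [integral_add (hζi.const_mul _) (integrable_const _), integral_const_mul]
    simp only [integral_const, probReal_univ, one_smul]
    linarith
  · have h1 : ∀ᵐ ξ ∂P, |ζ x ξ e + η x ξ e| ≤ |ζ x ξ e| + Δη := by
      filter_upwards [hηb] with ξ hξ
      exact (abs_add_le _ _).trans (by linarith)
    have hζa := (hζ2.integrable one_le_two).abs
    refine (integral_mono_ae (hm2.integrable one_le_two).abs
      (hζa.add (integrable_const Δη)) h1).trans ?_
    rw [integral_add' hζa (integrable_const _)]
    simp only [integral_const, probReal_univ, one_smul]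
    have := (integral_abs_le_sqrt hζm.aestronglyMeasurable hζi).trans (Real.sqrt_le_sqrt hζb)
    linarith

/-- The noise is not centred, so averaging gains nothing: convexity merely carries the bounds for
one sample over to the mean. -/
theorem batchNoise_bounds (h : IsNoise P ζ η Δζ Δη) (hn : 1 ≤ n) (hm : 1 ≤ m) (x : Vec n)
    {e : Vec n} (he : ‖e‖ = 1) :
    Integrable (fun ξ : Fin m → X => batchNoise ζ η x (e, ξ) ^ 2) (Measure.pi fun _ => P) ∧
      ∫ ξ : Fin m → X, batchNoise ζ η x (e, ξ) ^ 2 ∂(Measure.pi fun _ => P)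
        ≤ 3 / 2 * Δζ + 3 * Δη ^ 2 ∧
      ∫ ξ : Fin m → X, |batchNoise ζ η x (e, ξ)| ∂(Measure.pi fun _ => P) ≤ √Δζ + Δη := by
  have hm0 : (0 : ℝ) < m := by exact_mod_cast hm
  obtain ⟨hs, hsb, ha, hab⟩ := h.sum_bounds hn x he
  obtain ⟨hζm, hηm⟩ := h.measurable_section x e
  set u : X → ℝ := fun ξ => ζ x ξ e + η x ξ e with hu
  have hum : Measurable u := hζm.add hηm
  have hp := fun i : Fin m => measurePreserving_eval (fun _ : Fin m => P) i
  have havg : ∀ φ : X → ℝ, Integrable φ P →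
      Integrable (fun ξ : Fin m → X => 1 / (m : ℝ) * ∑ i, φ (ξ i)) (Measure.pi fun _ => P) ∧
      ∫ ξ : Fin m → X, 1 / (m : ℝ) * ∑ i, φ (ξ i) ∂(Measure.pi fun _ => P) = ∫ ξ, φ ξ ∂P := by
    intro φ hφ
    have hi : ∀ i : Fin m, Integrable (fun ξ : Fin m → X => φ (ξ i)) (Measure.pi fun _ => P) :=
      fun i => (hp i).integrable_comp_of_integrable hφ
    have he : ∀ i : Fin m, ∫ ξ : Fin m → X, φ (ξ i) ∂(Measure.pi fun _ => P) = ∫ ξ, φ ξ ∂P :=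
      fun i => by
        have hmap := integral_map (f := φ) (hp i).measurable.aemeasurable
          (by rw [(hp i).map_eq]; exact hφ.1)
        rw [(hp i).map_eq] at hmap
        exact hmap.symm
    refine ⟨(integrable_finsetSum _ fun i _ => hi i).const_mul _, ?_⟩
    rw [integral_const_mul, integral_finsetSum _ fun i _ => hi i]
    simp only [he, Finset.sum_const, Finset.card_univ, Fintype.card_fin, nsmul_eq_mul]
    field_simp
  obtain ⟨i1, b1⟩ := havg (fun ξ => u ξ ^ 2) hs
  obtain ⟨i2, b2⟩ := havg (fun ξ => |u ξ|) ha
  have hmn : Measurable fun ξ : Fin m → X => batchNoise ζ η x (e, ξ) :=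
    (measurable_batchNoise h).comp (show Measurable fun ξ : Fin m → X => (x, e, ξ) by fun_prop)
  have hle : ∀ ξ : Fin m → X, batchNoise ζ η x (e, ξ) ^ 2
      ≤ 1 / (m : ℝ) * ∑ i, u (ξ i) ^ 2 := fun ξ => by
    have := sq_sum_le_card_mul_sum_sq (s := Finset.univ) (f := fun i => u (ξ i))
    rw [Finset.card_univ, Fintype.card_fin] at this
    have h2 := mul_le_mul_of_nonneg_left this (sq_nonneg (1 / (m : ℝ)))
    rw [batchNoise, mul_pow]
    refine h2.trans (le_of_eq ?_)
    field_simp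
  have hi1 := i1.mono' (hmn.pow_const 2).aestronglyMeasurable
    (Filter.Eventually.of_forall fun ξ => by
      rw [Real.norm_of_nonneg (sq_nonneg _)]; exact hle ξ)
  refine ⟨hi1, (integral_mono hi1 i1 hle).trans (b1.le.trans hsb), ?_⟩
  refine (integral_mono_of_nonneg (Filter.Eventually.of_forall fun _ => abs_nonneg _) i2
    (Filter.Eventually.of_forall fun ξ => ?_)).trans (b2.le.trans hab)
  simp only [batchNoise, abs_mul]
  rw [abs_of_pos (one_div_pos.2 hm0)]
  exact mul_le_mul_of_nonneg_left (Finset.abs_sum_le_sum_abs _ _) (one_div_pos.2 hm0).le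

end Noise

/-! ### Independence of each iteration from the past. -/

section Sampling

variable {n N m : ℕ} {X Ω : Type*} [MeasurableSpace X] {e : Fin N → Ω → Vec n}
  {ξ : Fin N → Fin m → Ω → X}

/-- The σ-algebras generated by the individual directions and samples. -/
abbrev sourceAlgebra (e : Fin N → Ω → Vec n) (ξ : Fin N → Fin m → Ω → X) :
    Fin N ⊕ Fin N × Fin m → MeasurableSpace Ω :=
  Sum.elim (fun k : Fin N => MeasurableSpace.comap (e k) inferInstance)
    (fun j : Fin N × Fin m => MeasurableSpace.comap (ξ j.1 j.2) inferInstance)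

/-- The iteration in which a source of randomness is used. -/
def sourceRound : Fin N ⊕ Fin N × Fin m → ℕ := Sum.elim (fun k => k) (fun j => j.1)

/-- The σ-algebra of the randomness used before iteration `k`. -/
abbrev pastAlgebra (e : Fin N → Ω → Vec n) (ξ : Fin N → Fin m → Ω → X) (k : ℕ) :
    MeasurableSpace Ω :=
  ⨆ i ∈ {i : Fin N ⊕ Fin N × Fin m | sourceRound i < k}, sourceAlgebra e ξ i

/-- The randomness used in iteration `k`. -/
def roundSample (e : Fin N → Ω → Vec n) (ξ : Fin N → Fin m → Ω → X) (k : Fin N) (ω : Ω) :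
    Vec n × (Fin m → X) := (e k ω, fun i => ξ k i ω)

/-- Stated for a general set of sources, to serve both the past up to an iteration and that
iteration alone. -/
theorem measurable_of_source_mem {S : Set (Fin N ⊕ Fin N × Fin m)} {k : Fin N}
    (hS : ∀ i, sourceRound i = k → i ∈ S) :
    Measurable[⨆ i ∈ S, sourceAlgebra e ξ i] (roundSample e ξ k) := by
  have h1 : Measurable[⨆ i ∈ S, sourceAlgebra e ξ i] (e k) :=
    (comap_measurable (e k)).mono
      (le_iSup₂_of_le (f := fun i (_ : i ∈ S) => sourceAlgebra e ξ i) (Sum.inl k)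
        (hS _ rfl) le_rfl) le_rfl
  have h2 : ∀ i, Measurable[⨆ i ∈ S, sourceAlgebra e ξ i] (ξ k i) := fun i =>
    (comap_measurable (ξ k i)).mono
      (le_iSup₂_of_le (f := fun i (_ : i ∈ S) => sourceAlgebra e ξ i) (Sum.inr (k, i))
        (hS _ rfl) le_rfl) le_rfl
  exact Measurable.prodMk h1
    (@measurable_pi_lambda _ _ _ (⨆ i ∈ S, sourceAlgebra e ξ i) _ _ h2)

theorem measurable_roundSample_past (k : Fin N) :
    Measurable[pastAlgebra e ξ (k + 1)] (roundSample e ξ k) :=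
  measurable_of_source_mem fun i hi => by
    rw [Set.mem_ofPred_eq, hi]; exact Nat.lt_succ_self _

theorem pastAlgebra_mono {k l : ℕ} (h : k ≤ l) : pastAlgebra e ξ k ≤ pastAlgebra e ξ l :=
  biSup_mono fun _ hi => lt_of_lt_of_le hi h

variable [mΩ : MeasurableSpace Ω] {μ : Measure Ω} {P : Measure X}

namespace IsSampling

theorem sourceAlgebra_le (h : IsSampling μ P e ξ) (i : Fin N ⊕ Fin N × Fin m) :
    sourceAlgebra e ξ i ≤ mΩ := by
  rcases i with k | ⟨k, i⟩
  · exact (h.measurable_dir k).comap_le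
  · exact (h.measurable_sample k i).comap_le

theorem pastAlgebra_le (h : IsSampling μ P e ξ) (k : ℕ) : pastAlgebra e ξ k ≤ mΩ :=
  iSup₂_le fun i _ => h.sourceAlgebra_le i

theorem measurable_roundSample (h : IsSampling μ P e ξ) (k : Fin N) :
    Measurable (roundSample e ξ k) :=
  (h.measurable_dir k).prodMk (measurable_pi_lambda _ (h.measurable_sample k))

variable [IsProbabilityMeasure μ]

theorem map_roundSample (h : IsSampling μ P e ξ) (k : Fin N) :
    μ.map (roundSample e ξ k) = (sphereUniform n).prod (Measure.pi fun _ => P) := by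
  have hξm : Measurable fun ω i => ξ k i ω := measurable_pi_lambda _ (h.measurable_sample k)
  have h1 : IndepFun (e k) (fun ω i => ξ k i ω) μ := by
    rw [IndepFun_iff_Indep]
    have hd : Disjoint ({Sum.inl k} : Set (Fin N ⊕ Fin N × Fin m)) (Set.range Sum.inr) := by
      rw [Set.disjoint_singleton_left]; rintro ⟨a, ha⟩; cases ha
    have hI := indep_iSup_of_disjoint h.sourceAlgebra_le h.indep hd
    refine indep_of_indep_of_le hI ?_ ?_
    · exact le_iSup₂_of_le (f := fun i (_ : i ∈ ({Sum.inl k} : Set (Fin N ⊕ Fin N × Fin m))) =>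
        sourceAlgebra e ξ i) (Sum.inl k) rfl le_rfl
    · refine Measurable.comap_le (@measurable_pi_lambda _ _ _ (⨆ i ∈ Set.range Sum.inr,
        sourceAlgebra e ξ i) _ _ fun i => (comap_measurable (ξ k i)).mono ?_ le_rfl)
      exact le_iSup₂_of_le (f := fun i (_ : i ∈ Set.range Sum.inr) =>
        sourceAlgebra e ξ i) (Sum.inr (k, i)) ⟨_, rfl⟩ le_rfl
  have h2 : iIndepFun (fun i => ξ k i) μ := by
    rw [iIndepFun_iff_iIndep]
    exact h.indep.precomp (g := fun i : Fin m => (Sum.inr (k, i) : Fin N ⊕ Fin N × Fin m))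
      fun a b hab => by simpa using hab
  have h3 := h1.map_prod_eq_prod_map_map (h.measurable_dir k).aemeasurable hξm.aemeasurable
  rw [h.law_dir k, h2.map_fun_eq_pi_map fun i => (h.measurable_sample k i).aemeasurable] at h3
  simp only [h.law_sample] at h3
  exact h3

/-- The randomness of iteration `k` is independent of the past. -/
theorem map_prod_roundSample (h : IsSampling μ P e ξ) (k : Fin N) {Z : Ω → Vec n}
    (hZ : Measurable[pastAlgebra e ξ k] Z) :
    μ.map (fun ω => (Z ω, roundSample e ξ k ω))
      = (μ.map Z).prod ((sphereUniform n).prod (Measure.pi fun _ => P)) := by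
  have hd : Disjoint {i : Fin N ⊕ Fin N × Fin m | sourceRound i < k}
      {i : Fin N ⊕ Fin N × Fin m | sourceRound i = k} :=
    Set.disjoint_left.2 fun i hi hi' => (ne_of_lt hi) hi'
  have hI := indep_iSup_of_disjoint h.sourceAlgebra_le h.indep hd
  have h1 : IndepFun Z (roundSample e ξ k) μ := by
    rw [IndepFun_iff_Indep]
    exact indep_of_indep_of_le hI hZ.comap_le
      (Measurable.comap_le (measurable_of_source_mem fun i hi => hi))
  rw [← h.map_roundSample k]
  exact h1.map_prod_eq_prod_map_map (hZ.mono (h.pastAlgebra_le k) le_rfl).aemeasurable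
    (h.measurable_roundSample k).aemeasurable

end IsSampling

end Sampling

/-! ### Summing the recursion. -/

/-- Summation of a stochastic recursion with a square-root perturbation. -/
theorem sum_le_of_recursion {N : ℕ} {v δ : ℕ → ℝ} {a A B : ℝ} (hA : 0 ≤ A) (hB : 0 ≤ B)
    (ha : 0 ≤ a) (hv : ∀ k ≤ N, 0 ≤ v k) (hδ : ∀ k < N, 0 ≤ δ k)
    (h : ∀ k < N, v (k + 1) ≤ v k - a * δ k + A + B * √(2 * v k)) :
    a * ∑ k ∈ Finset.range N, δ k ≤ 2 * v 0 + 2 * (N * A) + 2 * (N * B) ^ 2 := by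
  have hv0 := hv 0 (Nat.zero_le _)
  set b := N * B with hb
  have hb0 : 0 ≤ b := by positivity
  -- `y = b + w` is the positive root of `y² = 2by + 2(v 0 + N A)`. Hence the bound `√(2 v_j) ≤ y`
  -- reproduces itself: it yields `v_k ≤ v 0 + N (A + B y) = y² / 2`.
  set w := √(b ^ 2 + 2 * (v 0 + N * A)) with hw
  have hw2 : w ^ 2 = b ^ 2 + 2 * (v 0 + N * A) := Real.sq_sqrt (by positivity)
  have hw0 : 0 ≤ w := Real.sqrt_nonneg _
  have hR : (b + w) ^ 2 = 2 * b * (b + w) + 2 * (v 0 + N * A) := by nlinarith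
  have key : ∀ k ≤ N, v k + a * ∑ j ∈ Finset.range k, δ j ≤ v 0 + k * (A + B * (b + w)) := by
    intro k
    induction k with
    | zero => simp
    | succ k ih =>
      intro hk
      have hih := ih (Nat.le_of_succ_le hk)
      have hkN : (k : ℝ) ≤ N := by exact_mod_cast Nat.le_of_succ_le hk
      have hS : 0 ≤ a * ∑ j ∈ Finset.range k, δ j := mul_nonneg ha
        (Finset.sum_nonneg fun j hj => hδ j ((Finset.mem_range.1 hj).trans hk))
      have h1 : √(2 * v k) ≤ b + w := by
        refine Real.sqrt_le_iff.2 ⟨by positivity, ?_⟩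
        have : (k : ℝ) * (A + B * (b + w)) ≤ N * (A + B * (b + w)) :=
          mul_le_mul_of_nonneg_right hkN (by positivity)
        rw [hR]
        nlinarith
      have h2 := h k hk
      have h3 := mul_le_mul_of_nonneg_left h1 hB
      rw [Finset.sum_range_succ]
      push_cast
      nlinarith
  have h1 := key N le_rfl
  have h2 := hv N le_rfl
  have h3 : (N : ℝ) * (A + B * (b + w)) = N * A + b * (b + w) := by rw [hb]; ring
  -- `b w ≤ (b² + w²) / 2 = b² + v 0 + N A`.
  nlinarith [sq_nonneg (b - w)]

/-! ### The expected increment at a fixed and at a random iterate. -/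

section RoundEstimate

variable {n m : ℕ} {X : Type*} [MeasurableSpace X] {P : Measure X}
  {F : Vec n → X → ℝ} {g : Vec n → X → Vec n} {L : X → ℝ} {L₂ σ Δζ Δη : ℝ}
  {ζ η : Vec n → X → Vec n → ℝ}

theorem IsStochasticProblem.measurable_batchMean
    (h : IsStochasticProblem P F g L L₂ σ) :
    Measurable fun t : Vec n × (Fin m → X) => batchMean g t.1 t.2 := by
  unfold batchMean
  have hsum : Measurable fun t : Vec n × (Fin m → X) => ∑ i, g t.1 (t.2 i) :=
    Finset.measurable_fun_sum _ fun i _ => h.measurable_grad.comp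
      (show Measurable fun t : Vec n × (Fin m → X) => (t.1, t.2 i) by fun_prop)
  exact hsum.const_smul (1 / (m : ℝ))

/-- The gradient estimate as a function of the point and of the randomness of the iteration. -/
noncomputable def gradEstimate (g : Vec n → X → Vec n) (ζ η : Vec n → X → Vec n → ℝ)
    (t : Vec n × Vec n × (Fin m → X)) : Vec n :=
  (⟪batchMean g t.1 t.2.2, t.2.1⟫ + batchNoise ζ η t.1 t.2) • t.2.1

theorem measurable_gradEstimate (h : IsStochasticProblem P F g L L₂ σ)
    (hN : IsNoise P ζ η Δζ Δη) : Measurable (gradEstimate (m := m) g ζ η) := by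
  have h1 : Measurable fun t : Vec n × Vec n × (Fin m → X) => batchMean g t.1 t.2.2 :=
    h.measurable_batchMean.comp
      (show Measurable fun t : Vec n × Vec n × (Fin m → X) => (t.1, t.2.2) by fun_prop)
  have h2 := measurable_batchNoise (m := m) hN
  unfold gradEstimate
  fun_prop

variable {r s : ℝ} {xs : Vec n}

theorem measurable_stepIncrement_joint (h : IsStochasticProblem P F g L L₂ σ)
    (hN : IsNoise P ζ η Δζ Δη) :
    Measurable fun t : Vec n × Vec n × (Fin m → X) =>
      stepIncrement r s (t.1 - xs) (batchMean g t.1) (batchNoise ζ η t.1) t.2 := by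
  have h1 := measurable_gradEstimate (m := m) h hN
  have h2 := (measurable_sumNorm (n := n) r).comp h1
  have e : (fun t : Vec n × Vec n × (Fin m → X) =>
      stepIncrement r s (t.1 - xs) (batchMean g t.1) (batchNoise ζ η t.1) t.2)
      = fun t => -(s * ⟪gradEstimate g ζ η t, t.1 - xs⟫)
        + s ^ 2 / 2 * (sumNorm r ∘ gradEstimate g ζ η) t ^ 2 := rfl
  rw [e]
  fun_prop

variable [IsProbabilityMeasure P]

/-- The step size gives `s R = 1 / (48 L₂)`. Together with `‖∇f‖² ≤ 4 L₂ (f - f(x_*))` the quadratic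
term then costs `1/12` of the decrease `s / n * (f - f(x_*))`, and `11/12` remains. -/
theorem integral_stepIncrement_point_le (hn : 1 ≤ n) (hm : 1 ≤ m) (hr : 2 ≤ r) {R : ℝ}
    (hR0 : 0 < R) (hR : (r - 1) * (n : ℝ) ^ (2 / r - 1) ≤ R) (hL : 0 < L₂)
    (h : IsStochasticProblem P F g L L₂ σ) (hxs : ∀ y, objective P F xs ≤ objective P F y)
    (hN : IsNoise P ζ η Δζ Δη) (hs : s = 1 / (48 * R * L₂)) (z : Vec n) :
    Integrable (stepIncrement (Ξ := Fin m → X) r s (z - xs) (batchMean g z) (batchNoise ζ η z))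
        ((sphereUniform n).prod (Measure.pi fun _ => P)) ∧
    ∫ w, stepIncrement (Ξ := Fin m → X) r s (z - xs) (batchMean g z) (batchNoise ζ η z) w
        ∂(sphereUniform n).prod (Measure.pi fun _ => P)
      ≤ -(11 / 12 * (s / n) * (objective P F z - objective P F xs))
        + (s / n / (48 * L₂) * (σ ^ 2 / m + n * (3 / 2 * Δζ + 3 * Δη ^ 2))
          + s * (√Δζ + Δη) / √n * ‖z - xs‖) := by
  have hn0 : (0 : ℝ) < n := by exact_mod_cast hn
  have hs0 : 0 < s := by rw [hs]; positivity
  obtain ⟨hζ0, hη0⟩ := hN.nonneg hn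
  have hb := fun (e : Vec n) (he : ‖e‖ = 1) => batchNoise_bounds (m := m) hN hn hm z he
  have hcm : Measurable (batchNoise (m := m) ζ η z) :=
    (measurable_batchNoise (m := m) hN).comp measurable_prodMk_left
  have hγm : Measurable (batchMean (m := m) g z) :=
    (h.measurable_batchMean (m := m)).comp measurable_prodMk_left
  obtain ⟨hi, hle⟩ := integral_stepIncrement_le hn hr hR hγm (h.memLp_batchMean m z) hcm
    (fun e he => ⟨(hb e he).1, (hb e he).2.1⟩) (fun e he => (hb e he).2.2) (by positivity)
    (by positivity) hs0.le (z - xs)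
  refine ⟨hi, hle.trans ?_⟩
  rw [h.integral_batchMean hm]
  have h1 := h.integral_norm_batchMean_sq_le hm z
  have h2 := h.norm_gradient_sq_le hL hxs z
  have h3 : objective P F z - objective P F xs ≤ ⟪gradient (objective P F) z, z - xs⟫ := by
    have := h.le_objective z xs
    rw [← neg_sub z xs, inner_neg_right] at this
    linarith
  have hsR : s * R = 1 / (48 * L₂) := by rw [hs]; field_simp
  have h4 : s ^ 2 * (R / n * ∫ ξ, ‖batchMean (m := m) g z ξ‖ ^ 2 ∂(Measure.pi fun _ => P))
      ≤ s / n / (48 * L₂) * (4 * L₂ * (objective P F z - objective P F xs) + σ ^ 2 / m) := by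
    have e1 : s ^ 2 * (R / n * ∫ ξ, ‖batchMean (m := m) g z ξ‖ ^ 2 ∂(Measure.pi fun _ => P))
        = s / n * (s * R) * ∫ ξ, ‖batchMean (m := m) g z ξ‖ ^ 2 ∂(Measure.pi fun _ => P) := by
      ring
    rw [e1, hsR, mul_one_div]
    exact mul_le_mul_of_nonneg_left (by linarith) (by positivity)
  have h5 : s ^ 2 * ((3 / 2 * Δζ + 3 * Δη ^ 2) * R)
      = s / n / (48 * L₂) * (n * (3 / 2 * Δζ + 3 * Δη ^ 2)) := by
    have e1 : s ^ 2 * ((3 / 2 * Δζ + 3 * Δη ^ 2) * R)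
        = s * (s * R) * (3 / 2 * Δζ + 3 * Δη ^ 2) := by ring
    rw [e1, hsR]
    field_simp
  have h6 : s / n / (48 * L₂) * (4 * L₂ * (objective P F z - objective P F xs) + σ ^ 2 / m)
      = 1 / 12 * (s / n) * (objective P F z - objective P F xs)
        + s / n / (48 * L₂) * (σ ^ 2 / m) := by
    field_simp
    ring
  have h7 : s * (⟪gradient (objective P F) z, z - xs⟫ / n)
      = s / n * ⟪gradient (objective P F) z, z - xs⟫ := by ring
  have h8 := mul_le_mul_of_nonneg_left h3 (show 0 ≤ s / n by positivity)
  have h9 : s * ((√Δζ + Δη) * (‖z - xs‖ / √n)) = s * (√Δζ + Δη) / √n * ‖z - xs‖ := by ring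
  rw [h5, h7, h9]
  nlinarith

theorem integrable_objective_sub (h : IsStochasticProblem P F g L L₂ σ) (hL : 0 < L₂)
    (hxs : ∀ y, objective P F xs ≤ objective P F y) {ν : Measure (Vec n)}
    (hν : Integrable (fun z => ‖z - xs‖ ^ 2) ν) :
    Integrable (fun z => objective P F z - objective P F xs) ν := by
  refine (hν.const_mul L₂).mono'
    (h.continuous_objective.sub continuous_const).aestronglyMeasurable
    (Filter.Eventually.of_forall fun z => ?_)
  rw [Real.norm_of_nonneg (sub_nonneg.2 (hxs z))]
  exact h.objective_sub_le hL hxs z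

/-- Moving the expectation of `‖z - xs‖` under a square root is what lets the recursion close in the
expected divergence. -/
theorem integral_stepIncrement_joint_le (hn : 1 ≤ n) (hm : 1 ≤ m) (hr : 2 ≤ r) {R : ℝ}
    (hR0 : 0 < R) (hR : (r - 1) * (n : ℝ) ^ (2 / r - 1) ≤ R) (hL : 0 < L₂)
    (h : IsStochasticProblem P F g L L₂ σ) (hxs : ∀ y, objective P F xs ≤ objective P F y)
    (hN : IsNoise P ζ η Δζ Δη) (hs : s = 1 / (48 * R * L₂)) {ν : Measure (Vec n)}
    [IsProbabilityMeasure ν] (hν : Integrable (fun z => ‖z - xs‖ ^ 2) ν) :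
    Integrable (fun t : Vec n × Vec n × (Fin m → X) =>
        stepIncrement r s (t.1 - xs) (batchMean g t.1) (batchNoise ζ η t.1) t.2)
        (ν.prod ((sphereUniform n).prod (Measure.pi fun _ => P))) ∧
    ∫ t : Vec n × Vec n × (Fin m → X),
        stepIncrement r s (t.1 - xs) (batchMean g t.1) (batchNoise ζ η t.1) t.2
        ∂ν.prod ((sphereUniform n).prod (Measure.pi fun _ => P))
      ≤ -(11 / 12 * (s / n) * ∫ z, (objective P F z - objective P F xs) ∂ν)
        + (s / n / (48 * L₂) * (σ ^ 2 / m + n * (3 / 2 * Δζ + 3 * Δη ^ 2))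
          + s * (√Δζ + Δη) / √n * √(∫ z, ‖z - xs‖ ^ 2 ∂ν)) := by
  have := isProbabilityMeasure_sphereUniform hn
  have hn0 : (0 : ℝ) < n := by exact_mod_cast hn
  have hs0 : 0 < s := by rw [hs]; positivity
  obtain ⟨hζ0, hη0⟩ := hN.nonneg hn
  set Q := (sphereUniform n).prod (Measure.pi fun _ : Fin m => P) with hQ
  have hpt := integral_stepIncrement_point_le (m := m) hn hm hr hR0 hR hL h hxs hN hs
  have hmeas := measurable_stepIncrement_joint (m := m) (r := r) (s := s) (xs := xs) h hN
  set K := 3 / 2 * Δζ + 3 * Δη ^ 2 with hK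
  have hi : Integrable (fun t : Vec n × Vec n × (Fin m → X) =>
      stepIncrement r s (t.1 - xs) (batchMean g t.1) (batchNoise ζ η t.1) t.2) (ν.prod Q) := by
    rw [integrable_prod_iff hmeas.aestronglyMeasurable]
    refine ⟨Filter.Eventually.of_forall fun z => (hpt z).1, ?_⟩
    have hb : ∀ z, ∫ w : Vec n × (Fin m → X),
        |stepIncrement r s (z - xs) (batchMean g z) (batchNoise ζ η z) w| ∂Q
        ≤ s * ((4 * L₂ * (L₂ * ‖z - xs‖ ^ 2) + σ ^ 2 / m) + K + ‖z - xs‖ ^ 2)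
          + s ^ 2 * ((4 * L₂ * (L₂ * ‖z - xs‖ ^ 2) + σ ^ 2 / m) + K) := fun z => by
      have hb := fun (e : Vec n) (he : ‖e‖ = 1) => batchNoise_bounds (m := m) hN hn hm z he
      have hcm : Measurable (batchNoise (m := m) ζ η z) :=
        (measurable_batchNoise (m := m) hN).comp measurable_prodMk_left
      refine (integral_abs_stepIncrement_le hn hr (h.memLp_batchMean m z) hcm
        (fun e he => ⟨(hb e he).1, (hb e he).2.1⟩) hs0.le (z - xs)).trans ?_
      have h1 : ∫ ξ, ‖batchMean (m := m) g z ξ‖ ^ 2 ∂(Measure.pi fun _ => P)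
          ≤ 4 * L₂ * (L₂ * ‖z - xs‖ ^ 2) + σ ^ 2 / m := by
        have h1 := h.integral_norm_batchMean_sq_le hm z
        have h2 := h.norm_gradient_sq_le hL hxs z
        have h3 := mul_le_mul_of_nonneg_left (h.objective_sub_le hL hxs z)
          (show 0 ≤ 4 * L₂ by positivity)
        linarith
      gcongr
    have hB : Integrable (fun z => s * ((4 * L₂ * (L₂ * ‖z - xs‖ ^ 2) + σ ^ 2 / m) + K
          + ‖z - xs‖ ^ 2) + s ^ 2 * ((4 * L₂ * (L₂ * ‖z - xs‖ ^ 2) + σ ^ 2 / m) + K)) ν := by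
      have h1 := ((hν.const_mul L₂).const_mul (4 * L₂)).add (integrable_const (σ ^ 2 / m))
      exact (((h1.add (integrable_const K)).add hν).const_mul s).add
        ((h1.add (integrable_const K)).const_mul (s ^ 2))
    refine hB.mono' (hmeas.norm.stronglyMeasurable.integral_prod_right').aestronglyMeasurable
      (Filter.Eventually.of_forall fun z => ?_)
    rw [Real.norm_of_nonneg (integral_nonneg fun _ => norm_nonneg _)]
    exact hb z
  refine ⟨hi, ?_⟩
  rw [integral_prod _ hi]
  have hδ := integrable_objective_sub h hL hxs hν
  have hnorm : MemLp (fun z => ‖z - xs‖) 2 ν :=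
    (memLp_two_iff_integrable_sq (by fun_prop)).2 hν
  have hnorm1 := hnorm.integrable one_le_two
  have j1 := (hδ.const_mul (11 / 12 * (s / n))).neg
  have j2 := integrable_const (μ := ν) (s / n / (48 * L₂) * (σ ^ 2 / m + n * K))
  have j3 := hnorm1.const_mul (s * (√Δζ + Δη) / √n)
  refine (integral_mono hi.integral_prod_left (j1.add (j2.add j3)) fun z => (hpt z).2).trans ?_
  rw [integral_add' j1 (j2.add j3), integral_add' j2 j3, integral_neg', integral_const_mul,
    integral_const_mul]
  simp only [integral_const, probReal_univ, one_smul]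
  rw [integral_const_mul]
  have h1 := integral_abs_le_sqrt (u := fun z => ‖z - xs‖) (by fun_prop) hν
  simp only [abs_norm] at h1
  gcongr

end RoundEstimate

/-! ### Runs of the method. -/

section Run

variable {n N m : ℕ} {X Ω : Type*}
  {F : Vec n → X → ℝ} {g : Vec n → X → Vec n} {L : X → ℝ} {L₂ σ Δζ Δη : ℝ}
  {ζ η : Vec n → X → Vec n → ℝ} {e : Fin N → Ω → Vec n} {ξ : Fin N → Fin m → Ω → X}
  {x : ℕ → Ω → Vec n} {d : Vec n → ℝ} {q : ℝ≥0∞} {x₀ xs : Vec n}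

theorem IsRDDRun.gradient_step (hd : Differentiable ℝ d)
    (hrun : IsRDDRun q L₂ d (noisyDeriv g ζ η) x₀ e ξ x) (k : Fin N) (ω : Ω) :
    gradient d (x (k + 1) ω) = gradient d (x k ω)
      - (rddStep n q L₂ * n) • gradEstimate g ζ η (x k ω, roundSample e ξ k ω) := by
  have h := gradient_eq_of_isMinOn hd (hrun.step k ω)
  rw [h, batchGrad_noisyDeriv]
  rfl

variable [MeasurableSpace X] {P : Measure X}

/-- A run provides a minimizer for each `ω`, with no measurability. The dual variable `∇d(x_k)`
obeys an explicit measurable recursion, and the continuous left inverse of `∇d` recovers `x_k` from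
it. -/
theorem IsRDDRun.measurable_iterate (hd : Differentiable ℝ d)
    (hsc : ∀ x y : Vec n, 1 / 2 * ‖y - x‖ ^ 2 ≤ bregman d x y)
    (hP : IsStochasticProblem P F g L L₂ σ) (hN : IsNoise P ζ η Δζ Δη)
    (hrun : IsRDDRun q L₂ d (noisyDeriv g ζ η) x₀ e ξ x) (k : ℕ) (hk : k ≤ N) :
    Measurable[pastAlgebra e ξ k] (x k) ∧
      Measurable[pastAlgebra e ξ k] fun ω => gradient d (x k ω) := by
  obtain ⟨T, hT, hTd⟩ := exists_continuous_leftInverse_gradient hsc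
  induction k with
  | zero =>
    have h0 : x 0 = fun _ => x₀ := funext hrun.start
    rw [h0]
    exact ⟨measurable_const, measurable_const⟩
  | succ k ih =>
    obtain ⟨h1, h2⟩ := ih (Nat.le_of_succ_le hk)
    have hle := pastAlgebra_mono (e := e) (ξ := ξ) (Nat.le_succ k)
    have h1' := h1.mono hle le_rfl
    have h2' := h2.mono hle le_rfl
    have hW := measurable_roundSample_past (e := e) (ξ := ξ) ⟨k, hk⟩
    have hG : Measurable[pastAlgebra e ξ (k + 1)] fun ω =>
        gradEstimate g ζ η (x k ω, roundSample e ξ ⟨k, hk⟩ ω) :=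
      (measurable_gradEstimate (m := m) hP hN).comp (h1'.prodMk hW)
    have hy : Measurable[pastAlgebra e ξ (k + 1)] fun ω => gradient d (x (k + 1) ω) := by
      have e1 : (fun ω => gradient d (x (k + 1) ω)) = fun ω => gradient d (x k ω)
          - (rddStep n q L₂ * n) • gradEstimate g ζ η (x k ω, roundSample e ξ ⟨k, hk⟩ ω) :=
        funext fun ω => hrun.gradient_step hd ⟨k, hk⟩ ω
      rw [e1]
      exact h2'.sub (hG.const_smul (rddStep n q L₂ * n : ℝ))
    refine ⟨?_, hy⟩
    have e2 : x (k + 1) = fun ω => T (gradient d (x (k + 1) ω)) := funext fun ω => (hTd _).symm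
    rw [e2]
    exact hT.measurable.comp hy

variable [IsProbabilityMeasure P]

/-- Jensen's inequality through the gradient inequality at the average, whose linear terms cancel.
-/
theorem objective_average_le (hP : IsStochasticProblem P F g L L₂ σ) (hN1 : 1 ≤ N) (ω : Ω) :
    objective P F (averageIterate N x ω)
      ≤ 1 / (N : ℝ) * ∑ k ∈ Finset.range N, objective P F (x k ω) := by
  have hN0 : (0 : ℝ) < N := by exact_mod_cast hN1
  set y := averageIterate N x ω with hy
  have h1 : ∑ k ∈ Finset.range N, (x k ω - y) = 0 := by
    rw [Finset.sum_sub_distrib, Finset.sum_const, Finset.card_range, ← Nat.cast_smul_eq_nsmul ℝ,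
      hy, averageIterate, smul_smul, mul_one_div_cancel hN0.ne', one_smul, sub_self]
  have h2 := Finset.sum_le_sum fun k (_ : k ∈ Finset.range N) => hP.le_objective y (x k ω)
  rw [Finset.sum_add_distrib, ← inner_sum, h1, inner_zero_right, add_zero, Finset.sum_const,
    Finset.card_range, nsmul_eq_mul] at h2
  rw [one_div, ← div_eq_inv_mul, le_div_iff₀ hN0]
  linarith

variable [MeasurableSpace Ω] {μ : Measure Ω} [IsProbabilityMeasure μ]

/-- The convergence bound before the choice of the final constants. -/
theorem rdd_bound (hn : 8 ≤ n) (hN1 : 1 ≤ N) (hm : 1 ≤ m) {p : ℝ≥0∞} (hp1 : 1 ≤ p) (hp2 : p ≤ 2)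
    (hpq : p⁻¹ + q⁻¹ = 1) (hd : IsProxFunction p d) (hL : 0 < L₂)
    (hP : IsStochasticProblem P F g L L₂ σ)
    (hxs : ∀ y, objective P F xs ≤ objective P F y) (hNo : IsNoise P ζ η Δζ Δη)
    (hS : IsSampling μ P e ξ) (hrun : IsRDDRun q L₂ d (noisyDeriv g ζ η) x₀ e ξ x) :
    Integrable (fun ω => objective P F (averageIterate N x ω)) μ ∧
      11 / 12 * rddStep n q L₂ * N *
          ((∫ ω, objective P F (averageIterate N x ω) ∂μ) - objective P F xs)
        ≤ 2 * bregman d x₀ xs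
          + 2 * (N * (rddStep n q L₂ / (48 * L₂)
            * (σ ^ 2 / m + n * (3 / 2 * Δζ + 3 * Δη ^ 2))))
          + 2 * (N * (rddStep n q L₂ * n * (√Δζ + Δη) / √n)) ^ 2 := by
  have hn1 : 1 ≤ n := by omega
  have hn0 : (0 : ℝ) < n := by exact_mod_cast hn1
  have hN0 : (0 : ℝ) < N := by exact_mod_cast hN1
  obtain ⟨r, r', hr2, hrr, hpr, hr'2, hR⟩ := exists_exponent hn hp1 hp2 hpq
  obtain ⟨-, hq2⟩ := inv_toReal_le_half hp2 hpq
  have hρ := rho_pos hn hq2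
  have hp0 : 0 < p.toReal := ENNReal.toReal_pos (zero_lt_one.trans_le hp1).ne'
    (ne_top_of_le_ne_top (by simp) hp2)
  have hsc := bregman_ge_sumNorm hd hp0 hpr
  have hsc2 := bregman_ge_norm hd hp0 (hpr.trans hr'2)
  obtain ⟨hζ0, hη0⟩ := hNo.nonneg hn1
  set α := rddStep n q L₂ with hα
  have hα0 : 0 < α := by rw [hα, rddStep]; positivity
  set s := α * n with hs
  have hs0 : 0 < s := mul_pos hα0 hn0
  have hsn : s / n = α := by rw [hs]; field_simp
  have hs' : s = 1 / (48 * rho n q * L₂) := by rw [hs, hα, rddStep]; field_simp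
  have hxm : ∀ k ≤ N, Measurable (x k) ∧ Measurable fun ω => gradient d (x k ω) := fun k hk =>
    ⟨(hrun.measurable_iterate hd.differentiable hsc2 hP hNo k hk).1.mono (hS.pastAlgebra_le k)
      le_rfl, (hrun.measurable_iterate hd.differentiable hsc2 hP hNo k hk).2.mono
      (hS.pastAlgebra_le k) le_rfl⟩
  have hVm : ∀ k ≤ N, Measurable fun ω => bregman d (x k ω) xs := fun k hk => by
    obtain ⟨h1, h2⟩ := hxm k hk
    have h3 := hd.differentiable.continuous.measurable.comp h1
    exact ((measurable_const.sub h3).sub (h2.inner (measurable_const.sub h1)))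
  have hV0 : ∀ k ω, 0 ≤ bregman d (x k ω) xs := fun k ω =>
    le_trans (by positivity) (hsc2 (x k ω) xs)
  have hnV : ∀ k ω, ‖x k ω - xs‖ ^ 2 ≤ 2 * bregman d (x k ω) xs := fun k ω => by
    have := hsc2 (x k ω) xs
    rw [norm_sub_rev] at this
    linarith
  have hsqi : ∀ k ≤ N, Integrable (fun ω => bregman d (x k ω) xs) μ →
      Integrable (fun ω => ‖x k ω - xs‖ ^ 2) μ := fun k hk hi =>
    (hi.const_mul 2).mono' (((hxm k hk).1.sub_const xs).norm.pow_const 2).aestronglyMeasurable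
      (Filter.Eventually.of_forall fun ω => by
        rw [Real.norm_of_nonneg (sq_nonneg _)]; exact hnV k ω)
  set A := α / (48 * L₂) * (σ ^ 2 / m + n * (3 / 2 * Δζ + 3 * Δη ^ 2)) with hA
  set B := s * (√Δζ + Δη) / √n with hB
  have hB0 : 0 ≤ B := by positivity
  -- Integrability of the potential is not known in advance. It is carried along with the estimate,
  -- the new potential being dominated by the old one plus the increment.
  have hround : ∀ k (hk : k < N), Integrable (fun ω => bregman d (x k ω) xs) μ →
      Integrable (fun ω => bregman d (x (k + 1) ω) xs) μ ∧
      Integrable (fun ω => objective P F (x k ω) - objective P F xs) μ ∧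
      ∫ ω, bregman d (x (k + 1) ω) xs ∂μ ≤ ∫ ω, bregman d (x k ω) xs ∂μ
        - 11 / 12 * α * ∫ ω, (objective P F (x k ω) - objective P F xs) ∂μ + A
        + B * √(2 * ∫ ω, bregman d (x k ω) xs ∂μ) := by
    intro k hk hVi
    have hxk := (hxm k hk.le).1
    have hmap := hS.map_prod_roundSample ⟨k, hk⟩
      (hrun.measurable_iterate hd.differentiable hsc2 hP hNo k hk.le).1
    have hpr : IsProbabilityMeasure (μ.map (x k)) :=
      Measure.isProbabilityMeasure_map hxk.aemeasurable
    have hpm : Measurable fun ω => (x k ω, roundSample e ξ ⟨k, hk⟩ ω) :=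
      hxk.prodMk (hS.measurable_roundSample _)
    have hsq := hsqi k hk.le hVi
    have hν : Integrable (fun z => ‖z - xs‖ ^ 2) (μ.map (x k)) :=
      (integrable_map_measure (by fun_prop) hxk.aemeasurable).2 hsq
    obtain ⟨hj1, hj2⟩ := integral_stepIncrement_joint_le (m := m) hn1 hm hr2 hρ hR hL hP hxs hNo
      hs' hν
    have hjm := measurable_stepIncrement_joint (m := m) (r := r) (s := s) (xs := xs) hP hNo
    rw [← hmap] at hj1 hj2
    rw [integrable_map_measure hjm.aestronglyMeasurable hpm.aemeasurable] at hj1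
    rw [integral_map hpm.aemeasurable hjm.aestronglyMeasurable, hsn,
      integral_map (f := fun z => objective P F z - objective P F xs) hxk.aemeasurable
        (hP.continuous_objective.sub continuous_const).aestronglyMeasurable,
      integral_map hxk.aemeasurable (by fun_prop)] at hj2
    have hδi : Integrable (fun ω => objective P F (x k ω) - objective P F xs) μ :=
      (integrable_objective_sub hP hL hxs hν).comp_measurable hxk
    have hstep : ∀ ω, bregman d (x (k + 1) ω) xs ≤ bregman d (x k ω) xs
        + stepIncrement r s (x k ω - xs) (batchMean g (x k ω)) (batchNoise ζ η (x k ω))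
          (roundSample e ξ ⟨k, hk⟩ ω) := fun ω => by
      have h1 := bregman_step_le hrr hsc hs0.le
        (hrun.gradient_step hd.differentiable ⟨k, hk⟩ ω) xs
      refine h1.trans (le_of_eq ?_)
      simp only [stepIncrement, gradEstimate]
      ring
    have hint := hVi.add hj1
    have hVi' : Integrable (fun ω => bregman d (x (k + 1) ω) xs) μ :=
      hint.mono' (hVm (k + 1) hk).aestronglyMeasurable (Filter.Eventually.of_forall fun ω => by
        rw [Real.norm_of_nonneg (hV0 _ ω)]; exact hstep ω)
    refine ⟨hVi', hδi, ?_⟩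
    have h1 := integral_mono hVi' hint hstep
    rw [integral_add' hVi hj1] at h1
    have h2 : √(∫ ω, ‖x k ω - xs‖ ^ 2 ∂μ) ≤ √(2 * ∫ ω, bregman d (x k ω) xs ∂μ) := by
      refine Real.sqrt_le_sqrt ?_
      rw [← integral_const_mul]
      exact integral_mono hsq (hVi.const_mul 2) (hnV k)
    have h3 := mul_le_mul_of_nonneg_left h2 hB0
    simp only [Function.comp_def] at h1
    linarith
  have hVint : ∀ k ≤ N, Integrable (fun ω => bregman d (x k ω) xs) μ := by
    intro k
    induction k with
    | zero => intro _; simp only [hrun.start]; exact integrable_const _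
    | succ k ih => intro hk; exact (hround k hk (ih (Nat.le_of_succ_le hk))).1
  have hsum := sum_le_of_recursion (N := N) (v := fun k => ∫ ω, bregman d (x k ω) xs ∂μ)
    (δ := fun k => ∫ ω, (objective P F (x k ω) - objective P F xs) ∂μ) (a := 11 / 12 * α)
    (A := A) (B := B) (by positivity) hB0 (by positivity)
    (fun k _ => integral_nonneg (hV0 k))
    (fun k _ => integral_nonneg fun ω => sub_nonneg.2 (hxs _))
    (fun k hk => (hround k hk (hVint k hk.le)).2.2)
  have hδint := fun k (hk : k < N) => (hround k hk (hVint k hk.le)).2.1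
  have havg : ∀ ω, objective P F (averageIterate N x ω) - objective P F xs
      ≤ 1 / (N : ℝ) * ∑ k ∈ Finset.range N, (objective P F (x k ω) - objective P F xs) :=
      fun ω => by
    have := objective_average_le (x := x) hP hN1 ω
    rw [Finset.sum_sub_distrib, Finset.sum_const, Finset.card_range, nsmul_eq_mul, mul_sub,
      ← mul_assoc, one_div_mul_cancel hN0.ne', one_mul]
    linarith
  have hsumi : Integrable (fun ω => 1 / (N : ℝ) * ∑ k ∈ Finset.range N,
      (objective P F (x k ω) - objective P F xs)) μ :=
    (integrable_finsetSum _ fun k hk => hδint k (Finset.mem_range.1 hk)).const_mul _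
  have havm : Measurable (averageIterate N x) := by
    have : Measurable fun ω => ∑ k ∈ Finset.range N, x k ω :=
      Finset.measurable_fun_sum _ fun k hk => (hxm k (Finset.mem_range.1 hk).le).1
    exact this.const_smul (1 / (N : ℝ))
  have hfi : Integrable (fun ω => objective P F (averageIterate N x ω) - objective P F xs) μ := by
    refine hsumi.mono' ((hP.continuous_objective.measurable.comp havm).sub_const _
      ).aestronglyMeasurable (Filter.Eventually.of_forall fun ω => ?_)
    rw [Real.norm_of_nonneg (sub_nonneg.2 (hxs _))]
    exact havg ω
  have hfi2 : Integrable (fun ω => objective P F (averageIterate N x ω)) μ := by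
    have := hfi.add (integrable_const (objective P F xs))
    exact this.congr (Filter.Eventually.of_forall fun ω => by simp)
  refine ⟨hfi2, ?_⟩
  have hle := integral_mono hfi hsumi havg
  rw [integral_sub hfi2 (integrable_const _), integral_const_mul,
    integral_finsetSum _ fun k hk => hδint k (Finset.mem_range.1 hk)] at hle
  simp only [integral_const, probReal_univ, one_smul] at hle
  have h1 := mul_le_mul_of_nonneg_left hle (show 0 ≤ 11 / 12 * α * N by positivity)
  have h2 : 11 / 12 * α * N * (1 / (N : ℝ) * ∑ k ∈ Finset.range N,
      ∫ ω, (objective P F (x k ω) - objective P F xs) ∂μ)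
      = 11 / 12 * α * ∑ k ∈ Finset.range N,
        ∫ ω, (objective P F (x k ω) - objective P F xs) ∂μ := by
    field_simp
  rw [h2] at h1
  refine h1.trans (hsum.trans (le_of_eq ?_))
  have h0 : ∫ ω, bregman d (x 0 ω) xs ∂μ = bregman d x₀ xs := by
    simp only [hrun.start, integral_const, probReal_univ, one_smul]
  rw [h0]

end Run

/-! ### Constants, and the complexity in terms of the Bregman distance. -/

/-- The convergence bound for the Randomized Directional Derivative method. -/
theorem rdd_error {n N m : ℕ} {p q : ℝ≥0∞} {d : Vec n → ℝ} (x₀ xs : Vec n) {L₂ : ℝ} (σ Δζ Δη : ℝ)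
    (hn : 8 ≤ n) (hN : 1 ≤ N) (hm : 1 ≤ m) (hp1 : 1 ≤ p) (hp2 : p ≤ 2) (hpq : p⁻¹ + q⁻¹ = 1)
    (hd : IsProxFunction p d) (hL : 0 < L₂) :
    RDDErrorAtMost.{u, v} n N m q d x₀ xs L₂ σ Δζ Δη
      (384 * n * rho n q * L₂ * bregman d x₀ xs / N
        + 2 / L₂ * (σ ^ 2 / m)
        + n / (12 * L₂) * Δζ
        + 4 * n / (3 * L₂) * Δη ^ 2
        + 8 * √(2 * n * bregman d x₀ xs) / N * (√Δζ / 2 + 2 * Δη)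
        + N / (3 * L₂ * rho n q) * (√Δζ / 2 + 2 * Δη) ^ 2) := by
  intro X _ P _ F g L ζ η Ω _ μ _ e ξ x hP hxs hNo hS hrun
  obtain ⟨hi, hb⟩ := rdd_bound hn hN hm hp1 hp2 hpq hd hL hP hxs hNo hS hrun
  refine ⟨hi, ?_⟩
  have hn0 : (0 : ℝ) < n := by exact_mod_cast (by omega : 0 < n)
  have hN0 : (0 : ℝ) < N := by exact_mod_cast hN
  have hm0 : (0 : ℝ) < m := by exact_mod_cast hm
  have hρ := rho_pos hn (inv_toReal_le_half hp2 hpq).2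
  obtain ⟨hζ0, hη0⟩ := hNo.nonneg (by omega)
  have hV : 0 ≤ bregman d x₀ xs := le_trans (by positivity)
    (bregman_ge_norm hd (ENNReal.toReal_pos (zero_lt_one.trans_le hp1).ne'
      (ne_top_of_le_ne_top (by simp) hp2)) (by simpa using ENNReal.toReal_mono (by simp) hp2) x₀ xs)
  set S := (∫ ω, objective P F (averageIterate N x ω) ∂μ) - objective P F xs
  set Θ := bregman d x₀ xs
  set ρ := rho n q
  set D := √Δζ + Δη with hD
  set D' := √Δζ / 2 + 2 * Δη with hD'
  have hsq := Real.sqrt_nonneg Δζ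
  have e1 : (N * (rddStep n q L₂ * n * D / √n)) ^ 2 = N ^ 2 * (rddStep n q L₂ ^ 2 * n * D ^ 2) := by
    rw [mul_pow, div_pow, Real.sq_sqrt hn0.le]
    field_simp
  have hα : rddStep n q L₂ = 1 / (48 * n * ρ * L₂) := rfl
  rw [e1, hα] at hb
  have hb2 : S ≤ 12 * 48 / 11 * n * ρ * L₂ / N * (2 * Θ
      + 2 * (N * (1 / (48 * n * ρ * L₂) / (48 * L₂) * (σ ^ 2 / m + n * (3 / 2 * Δζ + 3 * Δη ^ 2))))
      + 2 * (N ^ 2 * ((1 / (48 * n * ρ * L₂)) ^ 2 * n * D ^ 2))) := by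
    have h1 := mul_le_mul_of_nonneg_left hb
      (show 0 ≤ 12 * 48 / 11 * n * ρ * L₂ / N by positivity)
    refine le_trans (le_of_eq ?_) h1
    field_simp
  -- Each coefficient lies below the required one: `1152/11 ≤ 384`, `1/22 ≤ 2`, `3/44 ≤ 1/12`, `3/22
  -- ≤ 4/3`, and `4/22 ≤ 1/3` after `D ≤ 2 D'`. The square-root term of the theorem is pure slack.
  have e2 : 12 * 48 / 11 * n * ρ * L₂ / N * (2 * Θ
      + 2 * (N * (1 / (48 * n * ρ * L₂) / (48 * L₂) * (σ ^ 2 / m + n * (3 / 2 * Δζ + 3 * Δη ^ 2))))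
      + 2 * (N ^ 2 * ((1 / (48 * n * ρ * L₂)) ^ 2 * n * D ^ 2)))
      = 1152 / 11 * (n * ρ * L₂ * Θ / N) + 1 / 22 * (1 / L₂ * (σ ^ 2 / m))
        + 3 / 44 * (n / L₂ * Δζ) + 3 / 22 * (n / L₂ * Δη ^ 2)
        + 1 / 22 * (N / (L₂ * ρ) * D ^ 2) := by
    field_simp
    ring
  rw [e2] at hb2
  have hDD : D ^ 2 ≤ 4 * D' ^ 2 := by
    have : D ≤ 2 * D' := by rw [hD, hD']; linarith
    have := pow_le_pow_left₀ (by positivity) this 2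
    linarith
  have t1 : 0 ≤ n * ρ * L₂ * Θ / N := by positivity
  have t2 : 0 ≤ 1 / L₂ * (σ ^ 2 / m) := by positivity
  have t3 : 0 ≤ n / L₂ * Δζ := by positivity
  have t4 : 0 ≤ n / L₂ * Δη ^ 2 := by positivity
  have t5 : 0 ≤ 8 * √(2 * n * Θ) / N * D' := by positivity
  have t6 : N / (L₂ * ρ) * D ^ 2 ≤ N / (L₂ * ρ) * (4 * D' ^ 2) :=
    mul_le_mul_of_nonneg_left hDD (by positivity)
  have t7 : 0 ≤ N / (L₂ * ρ) * D' ^ 2 := by positivity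
  have f1 : 384 * n * ρ * L₂ * Θ / N = 384 * (n * ρ * L₂ * Θ / N) := by ring
  have f2 : 2 / L₂ * (σ ^ 2 / m) = 2 * (1 / L₂ * (σ ^ 2 / m)) := by ring
  have f3 : n / (12 * L₂) * Δζ = 1 / 12 * (n / L₂ * Δζ) := by field_simp
  have f4 : 4 * n / (3 * L₂) * Δη ^ 2 = 4 / 3 * (n / L₂ * Δη ^ 2) := by field_simp
  have f6 : N / (3 * L₂ * ρ) * D' ^ 2 = 1 / 3 * (N / (L₂ * ρ) * D' ^ 2) := by field_simp
  rw [f1, f2, f3, f4, f6]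
  linarith

/-- The starting point itself is already accurate when the Bregman distance is small. -/
theorem rdd_error_one {n : ℕ} {q : ℝ≥0∞} {d : Vec n → ℝ} {x₀ xs : Vec n} {L₂ σ Δζ Δη ε : ℝ}
    (hL : 0 < L₂) (h : L₂ * ‖x₀ - xs‖ ^ 2 ≤ ε) :
    RDDErrorAtMost.{u, v} n 1 1 q d x₀ xs L₂ σ Δζ Δη ε := by
  intro X _ P _ F g L ζ η Ω _ μ _ e ξ x hP hxs _ _ hrun
  -- The average stops at `x (N - 1)`, so a single iteration returns the starting point.
  have h1 : ∀ ω, averageIterate 1 x ω = x₀ := fun ω => by simp [averageIterate, hrun.start]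
  simp only [h1, integral_const, probReal_univ, one_smul]
  exact ⟨integrable_const _, (hP.objective_sub_le hL hxs x₀).trans h⟩

theorem sqrt_error_term_le {n N Θ V ε D : ℝ} (hn : 0 < n) (hN : 1 ≤ N) (hΘ : 0 < Θ)
    (hε : 0 < ε) (hV : V ≤ Θ) (hD0 : 0 ≤ D) (hD : 1000000 * (D ^ 2 * (n * Θ)) ≤ 17 / 2 * ε ^ 2) :
    8 * √(2 * n * V) / N * D ≤ ε / 6 := by
  have h1 : √(2 * n * V) ≤ √(2 * n * Θ) :=
    Real.sqrt_le_sqrt (mul_le_mul_of_nonneg_left hV (by positivity))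
  have h0 : (√(2 * n * Θ) * D) ^ 2 ≤ (ε / 100) ^ 2 := by
    rw [mul_pow, Real.sq_sqrt (by positivity)]
    have := sq_nonneg ε
    linarith
  have h2 := abs_le_of_sq_le_sq' h0 (by positivity) |>.2
  have h3 := mul_le_mul_of_nonneg_right h1 hD0
  rw [div_mul_eq_mul_div, div_le_iff₀ (by linarith)]
  have h4 : ε / 6 * 1 ≤ ε / 6 * N := mul_le_mul_of_nonneg_left hN (by positivity)
  linarith

theorem sq_error_term_le {n N ρ L₂ Θ ε D : ℝ} (hρ : 0 < ρ) (hL : 0 < L₂) (hε : 0 < ε)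
    (hN : N ≤ 2306 * (n * ρ * L₂ * Θ / ε))
    (hD : 1000000 * (D ^ 2 * (n * Θ)) ≤ 17 / 2 * ε ^ 2) :
    N / (3 * L₂ * ρ) * D ^ 2 ≤ ε / 6 := by
  rw [div_mul_eq_mul_div, div_le_iff₀ (by positivity)]
  have h1 := mul_le_mul_of_nonneg_right hN (sq_nonneg D)
  have h2 : 2306 * (n * ρ * L₂ * Θ / ε) * D ^ 2
      = 2306 * ρ * L₂ / ε * (D ^ 2 * (n * Θ)) := by ring
  have h3 : D ^ 2 * (n * Θ) ≤ 1 / 100000 * ε ^ 2 := by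
    have := sq_nonneg ε
    linarith
  have h4 := mul_le_mul_of_nonneg_left h3 (show 0 ≤ 2306 * ρ * L₂ / ε by positivity)
  have h5 : 2306 * ρ * L₂ / ε * (1 / 100000 * ε ^ 2) = 2306 / 100000 * (ε * L₂ * ρ) := by
    field_simp
  have h6 : 0 ≤ ε * L₂ * ρ := by positivity
  linarith

/-- The error budget: `2304 = 6 · 384` and `12 = 6 · 2` make the first two terms at most `ε / 6`
each. The next two get `ε / 12` each and the last two `ε / 6` each, in total `5ε / 6`. The last term
grows with `N`, hence the upper bound on `N`. -/
theorem error_terms_le {n N m ρ L₂ σ Θ V ε Δζ Δη : ℝ} (hn : 0 < n) (hN : 1 ≤ N) (hm : 1 ≤ m)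
    (hρ : 0 < ρ) (hL : 0 < L₂) (hΘ : 0 < Θ) (hε : 0 < ε) (hV : V ≤ Θ)
    (hζ0 : 0 ≤ Δζ) (hη0 : 0 ≤ Δη)
    (hN1 : 2304 * (n * ρ * L₂ * Θ / ε) ≤ N) (hN2 : N ≤ 2306 * (n * ρ * L₂ * Θ / ε))
    (hm1 : 12 * (σ ^ 2 / (ε * L₂)) ≤ m)
    (hζ : 1000000 * Δζ ≤ min (ε ^ 2 / (n * Θ)) (ε * L₂ / n))
    (hη : 1000000 * Δη ^ 2 ≤ min (ε ^ 2 / (n * Θ)) (ε * L₂ / n)) :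
    384 * n * ρ * L₂ * V / N + 2 / L₂ * (σ ^ 2 / m) + n / (12 * L₂) * Δζ
        + 4 * n / (3 * L₂) * Δη ^ 2 + 8 * √(2 * n * V) / N * (√Δζ / 2 + 2 * Δη)
        + N / (3 * L₂ * ρ) * (√Δζ / 2 + 2 * Δη) ^ 2 ≤ ε := by
  have hN0 : 0 < N := by linarith
  have hm0 : 0 < m := by linarith
  obtain ⟨hζ1, hζ2⟩ := le_min_iff.1 hζ
  obtain ⟨hη1, hη2⟩ := le_min_iff.1 hη
  rw [le_div_iff₀ (by positivity)] at hζ1 hζ2 hη1 hη2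
  have hsq := Real.sqrt_nonneg Δζ
  have hsq2 := Real.sq_sqrt hζ0
  set D' := √Δζ / 2 + 2 * Δη with hD'
  have hD0 : 0 ≤ D' := by positivity
  -- The coefficients `1/2` and `8` add up to the `17/2` of the next bound.
  have hD2 : D' ^ 2 ≤ 1 / 2 * Δζ + 8 * Δη ^ 2 := by
    have := sq_nonneg (√Δζ / 2 - 2 * Δη)
    rw [hD']
    linarith
  have hDΘ : 1000000 * (D' ^ 2 * (n * Θ)) ≤ 17 / 2 * ε ^ 2 := by
    have := mul_le_mul_of_nonneg_right hD2 (show 0 ≤ n * Θ by positivity)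
    linarith
  have t1 : 384 * n * ρ * L₂ * V / N ≤ ε / 6 := by
    rw [div_le_iff₀ hN0]
    rw [mul_div_assoc', div_le_iff₀ hε] at hN1
    have : n * ρ * L₂ * V ≤ n * ρ * L₂ * Θ := mul_le_mul_of_nonneg_left hV (by positivity)
    linarith
  have t2 : 2 / L₂ * (σ ^ 2 / m) ≤ ε / 6 := by
    rw [mul_div_assoc', div_le_iff₀ (by positivity)] at hm1
    rw [div_mul_div_comm, div_le_iff₀ (by positivity)]
    linarith
  have t3 : n / (12 * L₂) * Δζ ≤ ε / 12 := by
    rw [div_mul_eq_mul_div, div_le_iff₀ (by positivity)]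
    have := mul_nonneg hζ0 hn.le
    linarith
  have t4 : 4 * n / (3 * L₂) * Δη ^ 2 ≤ ε / 12 := by
    rw [div_mul_eq_mul_div, div_le_iff₀ (by positivity)]
    have := mul_nonneg (sq_nonneg Δη) hn.le
    linarith
  have t5 := sqrt_error_term_le hn hN hΘ hε hV hD0 hDΘ
  have t6 := sq_error_term_le hρ hL hε hN2 hDΘ
  linarith

/-- The complexity in terms of the Bregman distance from the starting point. -/
theorem rdd_complexity {n : ℕ} {p q : ℝ≥0∞} {L₂ σ Θ ε : ℝ} (hn : 8 ≤ n) (hp1 : 1 ≤ p)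
    (hp2 : p ≤ 2) (hpq : p⁻¹ + q⁻¹ = 1) (hL : 0 < L₂) (hΘ : 0 < Θ) (hε : 0 < ε) :
    ∃ N m : ℕ, 1 ≤ N ∧ 1 ≤ m ∧
      (N : ℝ) ≤ 1000000 * max 1 (n * rho n q * L₂ * Θ / ε) ∧
      (m : ℝ) ≤ 1000000 * max 1 (σ ^ 2 / (ε * L₂)) ∧
      (N * m : ℝ) ≤ 1000000 * max 1
        (max (n * rho n q * L₂ * Θ / ε) (n * rho n q * σ ^ 2 * Θ / ε ^ 2)) ∧
      ∀ (d : Vec n → ℝ) (x₀ xs : Vec n) (Δζ Δη : ℝ),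
        IsProxFunction p d → bregman d x₀ xs ≤ Θ →
        1000000 * Δζ ≤ min (ε ^ 2 / (n * Θ)) (ε * L₂ / n) →
        1000000 * Δη ^ 2 ≤ min (ε ^ 2 / (n * Θ)) (ε * L₂ / n) →
        RDDErrorAtMost.{u, v} n N m q d x₀ xs L₂ σ Δζ Δη ε := by
  have hn0 : (0 : ℝ) < n := by exact_mod_cast (by omega : 0 < n)
  have hq2 := (inv_toReal_le_half hp2 hpq).2
  have hρ := rho_pos hn hq2
  have hρ1 := one_le_mul_rho hn hq2
  set A := n * rho n q * L₂ * Θ / ε with hA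
  have hA0 : 0 < A := by positivity
  set t := σ ^ 2 / (ε * L₂) with ht
  have ht0 : 0 ≤ t := by positivity
  have hAt : n * rho n q * σ ^ 2 * Θ / ε ^ 2 = A * t := by rw [hA, ht]; field_simp
  rw [hAt]
  -- For `A ≤ 1/2` the starting point is accurate: `f(x₀) - f(x_*) ≤ L₂ ‖x₀ - x_*‖² ≤ 2 L₂ Θ ≤ 2 A
  -- ε`. For `A > 1/2` rounding up is harmless: `2304 A + 1 ≤ 2306 A`.
  rcases le_or_gt A (1 / 2) with hA1 | hA1
  · have l1 := le_max_left 1 A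
    have l2 := le_max_left 1 t
    have l3 := le_max_left 1 (max A (A * t))
    refine ⟨1, 1, le_rfl, le_rfl, ?_, ?_, ?_, fun d x₀ xs Δζ Δη hd hV _ _ => ?_⟩
    · push_cast; linarith
    · push_cast; linarith
    · push_cast; linarith
    · refine rdd_error_one hL ?_
      have h1 := bregman_ge_norm hd (ENNReal.toReal_pos (zero_lt_one.trans_le hp1).ne'
        (ne_top_of_le_ne_top (by simp) hp2)) (by simpa using ENNReal.toReal_mono (by simp) hp2)
        x₀ xs
      rw [norm_sub_rev] at h1
      rw [hA, div_le_iff₀ hε] at hA1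
      have h2 : 1 * (L₂ * Θ) ≤ n * rho n q * (L₂ * Θ) :=
        mul_le_mul_of_nonneg_right hρ1 (by positivity)
      have h3 := mul_le_mul_of_nonneg_left (h1.trans hV) hL.le
      nlinarith
  · have c1 := Nat.le_ceil (2304 * A)
    have c2 := Nat.ceil_lt_add_one (show 0 ≤ 2304 * A by positivity)
    have c3 := Nat.le_ceil (12 * t)
    have c4 := Nat.ceil_lt_add_one (show 0 ≤ 12 * t by positivity)
    set N := ⌈2304 * A⌉₊ with hN
    have hN1 : 1 ≤ N := Nat.one_le_iff_ne_zero.2 fun h0 => by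
      rw [h0] at c1; push_cast at c1; linarith
    have l1 := le_max_right 1 A
    have l2 := le_max_left 1 t
    have l2' := le_max_right 1 t
    have l3 := (le_max_left A (A * t)).trans (le_max_right 1 _)
    have l4 := (le_max_right A (A * t)).trans (le_max_right 1 _)
    have c5 : (N : ℝ) ≤ 2306 * A := by linarith
    refine ⟨N, ⌈12 * t⌉₊ + 1, hN1, Nat.le_add_left 1 _, ?_, ?_, ?_,
      fun d x₀ xs Δζ Δη hd hV hζ hη => ?_⟩
    · linarith
    · push_cast; linarith
    · push_cast
      have h1 : (N : ℝ) * ((⌈12 * t⌉₊ : ℝ) + 1) ≤ 2306 * A * (12 * t + 2) :=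
        mul_le_mul c5 (by linarith) (by positivity) (by positivity)
      nlinarith
    · intro X _ P _ F g L ζ η Ω _ μ _ e ξ x hP hxs hNo hS hrun
      obtain ⟨hi, hb⟩ := rdd_error x₀ xs σ Δζ Δη hn hN1 (Nat.le_add_left 1 _) hp1 hp2 hpq hd hL
        X P F g L ζ η Ω μ e ξ x hP hxs hNo hS hrun
      obtain ⟨hζ0, hη0⟩ := hNo.nonneg (by omega)
      refine ⟨hi, hb.trans ?_⟩
      refine error_terms_le hn0 (by exact_mod_cast hN1) (by push_cast; linarith) hρ hL hΘ hε hV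
        hζ0 hη0 c1 c5 ?_ hζ hη
      push_cast
      linarith

/-! ### The two-point inequality for the `κ`-norm. -/

/-- The arithmetic-geometric mean inequality: the product of the two powers is `(1 - t²) ^ c ≥ 1`.
-/
theorem two_le_rpow_add_rpow {c t : ℝ} (hc : c ≤ 0) (h0 : 0 ≤ t) (h1 : t < 1) :
    2 ≤ (1 + t) ^ c + (1 - t) ^ c := by
  have hu : 0 < (1 + t) ^ c := Real.rpow_pos_of_pos (by linarith) c
  have hv : 0 < (1 - t) ^ c := Real.rpow_pos_of_pos (by linarith) c
  have huv : 1 ≤ (1 + t) ^ c * (1 - t) ^ c := by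
    rw [← Real.mul_rpow (by linarith) (by linarith)]
    exact Real.one_le_rpow_of_pos_of_le_one_of_nonpos (by nlinarith) (by nlinarith) hc
  refine abs_le_of_sq_le_sq' ?_ (by positivity) |>.2
  nlinarith [sq_nonneg ((1 + t) ^ c - (1 - t) ^ c)]

theorem hasDerivAt_one_add_rpow (b : ℝ) {t : ℝ} (h : 0 < 1 + t) :
    HasDerivAt (fun t : ℝ => (1 + t) ^ b) (b * (1 + t) ^ (b - 1)) t := by
  simpa using ((hasDerivAt_id t).const_add 1).rpow_const (p := b) (Or.inl h.ne')

theorem hasDerivAt_one_sub_rpow (b : ℝ) {t : ℝ} (h : 0 < 1 - t) :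
    HasDerivAt (fun t : ℝ => (1 - t) ^ b) (-(b * (1 - t) ^ (b - 1))) t := by
  simpa using ((hasDerivAt_id t).const_sub 1).rpow_const (p := b) (Or.inl h.ne')

theorem nonneg_of_hasDerivAt_nonneg {f f' : ℝ → ℝ} (h0 : f 0 = 0)
    (hf : ∀ t, 0 ≤ t → t < 1 → HasDerivAt f (f' t) t) (hf' : ∀ t, 0 ≤ t → t < 1 → 0 ≤ f' t)
    {t : ℝ} (ht : 0 ≤ t) (ht1 : t < 1) : 0 ≤ f t := by
  have hm : MonotoneOn f (Set.Ico 0 1) := by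
    refine monotoneOn_of_deriv_nonneg (convex_Ico 0 1)
      (fun s hs => (hf s hs.1 hs.2).continuousAt.continuousWithinAt) ?_ ?_ <;>
      rw [interior_Ico] <;> intro s hs
    · exact (hf s hs.1.le hs.2).differentiableAt.differentiableWithinAt
    · rw [(hf s hs.1.le hs.2).deriv]
      exact hf' s hs.1.le hs.2
  rw [← h0]
  exact hm ⟨le_rfl, one_pos⟩ ⟨ht, ht1⟩ ht

theorem two_mul_le_rpow_sub_rpow {b t : ℝ} (hb : 0 ≤ b) (hb1 : b ≤ 1) (h0 : 0 ≤ t) (h1 : t < 1) :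
    2 * b * t ≤ (1 + t) ^ b - (1 - t) ^ b := by
  have := nonneg_of_hasDerivAt_nonneg (f := fun t => (1 + t) ^ b - (1 - t) ^ b - 2 * b * t)
    (f' := fun t => b * (1 + t) ^ (b - 1) - -(b * (1 - t) ^ (b - 1)) - 2 * b * 1) (by simp)
    (fun s hs hs1 => ((hasDerivAt_one_add_rpow b (by linarith)).sub
      (hasDerivAt_one_sub_rpow b (by linarith))).sub ((hasDerivAt_id s).const_mul (2 * b)))
    (fun s hs hs1 => by
      have := mul_le_mul_of_nonneg_left
        (two_le_rpow_add_rpow (c := b - 1) (by linarith) hs hs1) hb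
      linarith) h0 h1
  linarith

/-- Up to a positive factor, this is the discriminant condition needed in `weighted_two_point`. The
difference of the sides vanishes at `0`, and its derivative is a positive multiple of the difference
in `two_mul_le_rpow_sub_rpow` with `b = 1 - a` (for `a > 0`). -/
theorem rpow_add_rpow_le {a t : ℝ} (ha : 0 ≤ a) (ha1 : a ≤ 1) (ht : |t| < 1) :
    (1 + t) ^ a + (1 - t) ^ a ≤ 1 + a + (1 - a) * (1 - t ^ 2) ^ a := by
  have key : ∀ t : ℝ, 0 ≤ t → t < 1 →
      (1 + t) ^ a + (1 - t) ^ a ≤ 1 + a + (1 - a) * (1 - t ^ 2) ^ a := by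
    intro t h0 h1
    have := nonneg_of_hasDerivAt_nonneg
      (f := fun t => (1 - a) * (1 - t ^ 2) ^ a - ((1 + t) ^ a + (1 - t) ^ a) + (1 + a))
      (f' := fun t => (1 - a) * (-(2 * t) * a * (1 - t ^ 2) ^ (a - 1))
        - (a * (1 + t) ^ (a - 1) + -(a * (1 - t) ^ (a - 1)))) (by simp; ring)
      (fun s hs hs1 => by
        have hs2 : 1 - s ^ 2 ≠ 0 := by nlinarith
        have h := ((hasDerivAt_pow 2 s).const_sub 1).rpow_const (p := a) (Or.inl hs2)
        simp only [Nat.cast_ofNat, Nat.add_one_sub_one, pow_one] at h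
        exact ((h.const_mul (1 - a)).sub ((hasDerivAt_one_add_rpow a (by linarith)).add
          (hasDerivAt_one_sub_rpow a (by linarith)))).add_const _)
      (fun s hs hs1 => by
        have hp : 0 < 1 + s := by linarith
        have hq : 0 < 1 - s := by linarith
        have e0 : (1 - s ^ 2) ^ (a - 1) = (1 + s) ^ (a - 1) * (1 - s) ^ (a - 1) := by
          rw [← Real.mul_rpow hp.le hq.le]; ring_nf
        have e1 : (1 - s) ^ (a - 1) * (1 - s) ^ (1 - a) = 1 := by
          rw [← Real.rpow_add hq]; simp
        have e2 : (1 + s) ^ (a - 1) * (1 + s) ^ (1 - a) = 1 := by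
          rw [← Real.rpow_add hp]; simp
        have hu : 0 < (1 + s) ^ (a - 1) := Real.rpow_pos_of_pos hp _
        have hv : 0 < (1 - s) ^ (a - 1) := Real.rpow_pos_of_pos hq _
        have h := two_mul_le_rpow_sub_rpow (b := 1 - a) (by linarith) (by linarith) hs hs1
        rw [e0]
        set u := (1 + s) ^ (a - 1)
        set v := (1 - s) ^ (a - 1)
        have h2 := mul_le_mul_of_nonneg_left h (show 0 ≤ a * u * v by positivity)
        have e3 : a * u * v * ((1 + s) ^ (1 - a) - (1 - s) ^ (1 - a)) = a * v - a * u := by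
          linear_combination a * v * e2 - a * u * e1
        rw [e3] at h2
        linarith) h0 h1
    linarith
  rcases le_total 0 t with h | h
  · exact key t h (by rwa [abs_of_nonneg h] at ht)
  · have := key (-t) (by linarith) (by rwa [abs_of_nonpos h] at ht)
    rw [neg_sq, sub_neg_eq_add, ← sub_eq_add_neg] at this
    linarith

theorem quadratic_form_nonneg {A B C : ℝ} (hA : 0 ≤ A) (hC : 0 ≤ C) (h : B ^ 2 ≤ A * C) (x y : ℝ) :
    0 ≤ A * x ^ 2 + 2 * B * (x * y) + C * y ^ 2 := by
  rcases hA.eq_or_lt with rfl | hA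
  · have hB : B = 0 := by nlinarith
    rw [hB]
    nlinarith [mul_nonneg hC (sq_nonneg y)]
  · have : 0 ≤ A * (A * x ^ 2 + 2 * B * (x * y) + C * y ^ 2) := by
      nlinarith [sq_nonneg (A * x + B * y), mul_nonneg (sub_nonneg.2 h) (sq_nonneg y)]
    exact nonneg_of_mul_nonneg_right this hA

/-- The weighted two-point inequality behind the `2`-uniform convexity of the `κ`-norm. -/
theorem weighted_two_point {κ a l k : ℝ} (hκ1 : 1 ≤ κ) (hκ2 : κ ≤ 2) (ha : a = (2 - κ) / κ)
    (hl : 0 < l) (hk : 0 < k) (m h : ℝ) :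
    2 * ((m ^ 2 + (κ - 1) * h ^ 2) * ((l + k) / 2) ^ (-a))
      ≤ (m + h) ^ 2 * l ^ (-a) + (m - h) ^ 2 * k ^ (-a) := by
  have hκ0 : 0 < κ := by linarith
  have ha0 : 0 ≤ a := by rw [ha]; exact div_nonneg (by linarith) hκ0.le
  have ha1 : a ≤ 1 := by rw [ha, div_le_one hκ0]; linarith
  have hκa : κ * (1 + a) = 2 := by rw [ha]; field_simp; ring
  -- By homogeneity only the ratio of the weights matters: `l = r (1 + t)`, `k = r (1 - t)`.
  set r := (l + k) / 2 with hr
  set t := (l - k) / (l + k) with ht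
  have hr0 : 0 < r := by positivity
  have ht1 : |t| < 1 := by
    rw [ht, abs_div, abs_of_pos (by linarith : 0 < l + k), div_lt_one (by linarith), abs_lt]
    constructor <;> linarith
  have hl' : l = r * (1 + t) := by rw [hr, ht]; field_simp; ring
  have hk' : k = r * (1 - t) := by rw [hr, ht]; field_simp; ring
  have hp : 0 < 1 + t := by linarith [(abs_lt.1 ht1).1]
  have hq : 0 < 1 - t := by linarith [(abs_lt.1 ht1).2]
  have hmain := rpow_add_rpow_le ha0 ha1 ht1
  have e0 : (1 - t ^ 2) ^ a = (1 + t) ^ a * (1 - t) ^ a := by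
    rw [← Real.mul_rpow hp.le hq.le]; ring_nf
  have hle : (1 - t ^ 2) ^ a ≤ 1 :=
    Real.rpow_le_one (by nlinarith) (by nlinarith [sq_nonneg t]) ha0
  rw [e0] at hmain hle
  rw [hl', hk', Real.mul_rpow hr0.le hp.le, Real.mul_rpow hr0.le hq.le, Real.rpow_neg hp.le,
    Real.rpow_neg hq.le]
  have hw : 0 < r ^ (-a) := Real.rpow_pos_of_pos hr0 _
  have hU : 0 < (1 + t) ^ a := Real.rpow_pos_of_pos hp _
  have hV : 0 < (1 - t) ^ a := Real.rpow_pos_of_pos hq _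
  set w := r ^ (-a)
  set U := (1 + t) ^ a
  set V := (1 - t) ^ a
  set u := U⁻¹ with hu
  set v := V⁻¹ with hv
  have hu0 : 0 < u := by positivity
  have hv0 : 0 < v := by positivity
  have eu : U * u = 1 := mul_inv_cancel₀ hU.ne'
  have ev : V * v = 1 := mul_inv_cancel₀ hV.ne'
  have huv : 1 ≤ u * v := by rw [hu, hv, ← mul_inv]; exact (one_le_inv₀ (by positivity)).2 hle
  have huv2 : 2 ≤ u + v := by
    refine abs_le_of_sq_le_sq' ?_ (by positivity) |>.2
    nlinarith [sq_nonneg (u - v)]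
  -- This is `A C - B² ≥ 0` for the quadratic form in `m, h` below. It follows from `hmain`
  -- multiplied by `κ u v / 2`.
  have hdisc : 0 ≤ u * v - κ * ((u + v) / 2) + (κ - 1) := by
    have h2 := mul_le_mul_of_nonneg_left hmain (show 0 ≤ κ / 2 * (u * v) by positivity)
    have e1 : κ / 2 * (u * v) * (U + V) = κ / 2 * (u + v) := by
      linear_combination κ / 2 * v * eu + κ / 2 * u * ev
    have e2 : κ / 2 * (u * v) * (1 + a + (1 - a) * (U * V)) = u * v + (κ - 1) := by
      linear_combination (u * v) / 2 * hκa + (κ / 2 * (1 - a)) * (V * v * eu + ev) - hκa / 2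
    rw [e1, e2] at h2
    linarith
  have hq := quadratic_form_nonneg (A := (u + v) / 2 - 1) (B := (u - v) / 2)
    (C := (u + v) / 2 - (κ - 1)) (by linarith) (by linarith) (by nlinarith) m h
  have := mul_nonneg hw.le hq
  nlinarith

/-- Jensen for the power `2 / κ` with weights `r i`. Equality holds for `r i` proportional to `|z i|
^ κ`, which is `sum_weight_eq_sumNorm_sq`. -/
theorem sumNorm_sq_le_sum_weight {n : ℕ} {κ : ℝ} (hκ0 : 0 < κ) (hκ2 : κ ≤ 2) {r : Fin n → ℝ}
    (hr : ∀ i, 0 < r i) (hr1 : ∑ i, r i = 1) (z : Vec n) :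
    sumNorm κ z ^ 2 ≤ ∑ i, z i ^ 2 * r i ^ (-((2 - κ) / κ)) := by
  have h := Real.rpow_arith_mean_le_arith_mean_rpow Finset.univ r (fun i => |z i| ^ κ / r i)
    (fun i _ => (hr i).le) hr1 (fun i _ => div_nonneg (Real.rpow_nonneg (abs_nonneg _) _) (hr i).le)
    (p := 2 / κ) ((one_le_div hκ0).2 hκ2)
  rw [sumNorm_sq]
  have e1 : ∑ i, r i * (|z i| ^ κ / r i) = ∑ i, |z i| ^ κ :=
    Finset.sum_congr rfl fun i _ => mul_div_cancel₀ _ (hr i).ne'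
  rw [e1] at h
  refine h.trans (le_of_eq (Finset.sum_congr rfl fun i _ => ?_))
  rw [Real.div_rpow (Real.rpow_nonneg (abs_nonneg _) _) (hr i).le,
    ← Real.rpow_mul (abs_nonneg _), mul_div_cancel₀ _ hκ0.ne', Real.rpow_two, sq_abs]
  have e2 : r i ^ (-((2 - κ) / κ)) = r i / r i ^ (2 / κ) := by
    have : -((2 - κ) / κ) = 1 - 2 / κ := by field_simp; ring
    rw [this, Real.rpow_sub (hr i), Real.rpow_one]
  rw [e2]
  ring

theorem sum_weight_eq_sumNorm_sq {n : ℕ} {κ : ℝ} (hκ0 : 0 < κ) {x : Vec n} (hx : ∀ i, x i ≠ 0) :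
    ∑ i, x i ^ 2 * (|x i| ^ κ / ∑ j, |x j| ^ κ) ^ (-((2 - κ) / κ)) = sumNorm κ x ^ 2 := by
  rw [sumNorm_sq]
  rcases isEmpty_or_nonempty (Fin n) with hE | hE
  · simp [hκ0.ne']
  have hp : ∀ i, 0 < |x i| ^ κ := fun i => Real.rpow_pos_of_pos (abs_pos.2 (hx i)) _
  have hS : 0 < ∑ j, |x j| ^ κ := Finset.sum_pos (fun i _ => hp i) Finset.univ_nonempty
  set S := ∑ j, |x j| ^ κ with hSdef
  have e : ∀ i, x i ^ 2 * (|x i| ^ κ / S) ^ (-((2 - κ) / κ))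
      = |x i| ^ κ * S ^ ((2 - κ) / κ) := fun i => by
    rw [Real.div_rpow (hp i).le hS.le, Real.rpow_neg hS.le, div_inv_eq_mul, ← mul_assoc,
      ← Real.rpow_mul (abs_nonneg _), ← sq_abs, ← Real.rpow_two,
      ← Real.rpow_add (abs_pos.2 (hx i))]
    congr 2
    field_simp
    ring
  rw [Finset.sum_congr rfl fun i _ => e i, ← Finset.sum_mul, ← hSdef]
  nth_rewrite 1 [← Real.rpow_one S]
  rw [← Real.rpow_add hS]
  congr 1
  field_simp
  ring

theorem continuous_sumNorm {n : ℕ} {κ : ℝ} (hκ : 0 < κ) :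
    Continuous (sumNorm κ : Vec n → ℝ) := by
  unfold sumNorm
  refine Continuous.rpow_const (continuous_finsetSum _ fun i _ => ?_)
    fun _ => Or.inr (by positivity)
  exact Continuous.rpow_const (by fun_prop) fun _ => Or.inr hκ.le

/-- The optimal weights of `m + h` and `m - h` make the right side an exact weighted sum, while
their average is an admissible weight for both norms on the left. What remains is
`weighted_two_point` in each coordinate. Vanishing coordinates would give zero weights under a
nonpositive power. -/
theorem sumNorm_two_point_of_ne_zero {n : ℕ} {κ : ℝ} (hκ1 : 1 ≤ κ) (hκ2 : κ ≤ 2) {m h : Vec n}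
    (hx : ∀ i, (m + h) i ≠ 0) (hy : ∀ i, (m - h) i ≠ 0) :
    2 * (sumNorm κ m ^ 2 + (κ - 1) * sumNorm κ h ^ 2)
      ≤ sumNorm κ (m + h) ^ 2 + sumNorm κ (m - h) ^ 2 := by
  have hκ0 : 0 < κ := by linarith
  rcases isEmpty_or_nonempty (Fin n) with hE | hE
  · simp [sumNorm_sq, hκ0.ne']
  have hp : ∀ {z : Vec n}, (∀ i, z i ≠ 0) → ∀ i, 0 < |z i| ^ κ := fun hz i =>
    Real.rpow_pos_of_pos (abs_pos.2 (hz i)) _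
  have hS : ∀ {z : Vec n}, (∀ i, z i ≠ 0) → 0 < ∑ j, |z j| ^ κ := fun hz =>
    Finset.sum_pos (fun i _ => hp hz i) Finset.univ_nonempty
  rw [← sum_weight_eq_sumNorm_sq hκ0 hx, ← sum_weight_eq_sumNorm_sq hκ0 hy]
  set l : Fin n → ℝ := fun i => |(m + h) i| ^ κ / ∑ j, |(m + h) j| ^ κ with hl
  set k : Fin n → ℝ := fun i => |(m - h) i| ^ κ / ∑ j, |(m - h) j| ^ κ with hk
  have hl0 : ∀ i, 0 < l i := fun i => div_pos (hp hx i) (hS hx)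
  have hk0 : ∀ i, 0 < k i := fun i => div_pos (hp hy i) (hS hy)
  have hl1 : ∑ i, l i = 1 := by rw [hl, ← Finset.sum_div, div_self (hS hx).ne']
  have hk1 : ∑ i, k i = 1 := by rw [hk, ← Finset.sum_div, div_self (hS hy).ne']
  have hr0 : ∀ i, 0 < (l i + k i) / 2 := fun i => half_pos (add_pos (hl0 i) (hk0 i))
  have hr1 : ∑ i, (l i + k i) / 2 = 1 := by
    rw [← Finset.sum_div, Finset.sum_add_distrib, hl1, hk1]; norm_num
  have h1 := sumNorm_sq_le_sum_weight hκ0 hκ2 hr0 hr1 m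
  have h2 := mul_le_mul_of_nonneg_left (sumNorm_sq_le_sum_weight hκ0 hκ2 hr0 hr1 h)
    (sub_nonneg.2 hκ1)
  refine (mul_le_mul_of_nonneg_left (add_le_add h1 h2) two_pos.le).trans ?_
  rw [Finset.mul_sum, ← Finset.sum_add_distrib, Finset.mul_sum, ← Finset.sum_add_distrib]
  refine Finset.sum_le_sum fun i _ => ?_
  have := weighted_two_point hκ1 hκ2 rfl (hl0 i) (hk0 i) (m i) (h i)
  change _ ≤ (m i + h i) ^ 2 * l i ^ _ + (m i - h i) ^ 2 * k i ^ _
  linarith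

/-- Shifting `m` by a small multiple of the all-ones vector makes every coordinate of `m ± h`
nonzero; continuity does the rest. -/
theorem sumNorm_two_point {n : ℕ} {κ : ℝ} (hκ1 : 1 ≤ κ) (hκ2 : κ ≤ 2) (m h : Vec n) :
    2 * (sumNorm κ m ^ 2 + (κ - 1) * sumNorm κ h ^ 2)
      ≤ sumNorm κ (m + h) ^ 2 + sumNorm κ (m - h) ^ 2 := by
  have hκ0 : 0 < κ := by linarith
  have hc := continuous_sumNorm (n := n) hκ0
  set j : Vec n := WithLp.toLp 2 fun _ => 1
  have hne : ∀ c : ℝ, ∀ᶠ ε in nhdsWithin (0 : ℝ) {0}ᶜ, c + ε ≠ 0 := fun c => by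
    rcases eq_or_ne c 0 with rfl | hc
    · filter_upwards [self_mem_nhdsWithin] with ε hε
      simpa using hε
    · refine (ContinuousAt.eventually_ne (g := fun ε : ℝ => c + ε) (by fun_prop)
        (by simpa using hc)).filter_mono nhdsWithin_le_nhds
  have hev : ∀ᶠ ε in nhdsWithin (0 : ℝ) {0}ᶜ,
      2 * (sumNorm κ (m + ε • j) ^ 2 + (κ - 1) * sumNorm κ h ^ 2)
        ≤ sumNorm κ (m + ε • j + h) ^ 2 + sumNorm κ (m + ε • j - h) ^ 2 := by
    filter_upwards [Filter.eventually_all.2 fun i => hne (m i + h i),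
      Filter.eventually_all.2 fun i => hne (m i - h i)] with ε h1 h2
    refine sumNorm_two_point_of_ne_zero hκ1 hκ2 (fun i => ?_) fun i => ?_
    · have := h1 i
      simp only [j, PiLp.add_apply, PiLp.smul_apply, smul_eq_mul, mul_one]
      convert this using 1
      ring
    · have := h2 i
      simp only [j, PiLp.add_apply, PiLp.sub_apply, PiLp.smul_apply, smul_eq_mul, mul_one]
      convert this using 1
      ring
  have hlim : ∀ φ : ℝ → ℝ, Continuous φ →
      Filter.Tendsto φ (nhdsWithin (0 : ℝ) {0}ᶜ) (nhds (φ 0)) := fun φ hφ =>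
    (hφ.tendsto 0).mono_left nhdsWithin_le_nhds
  have h1 := hlim (fun ε => 2 * (sumNorm κ (m + ε • j) ^ 2 + (κ - 1) * sumNorm κ h ^ 2))
    (by fun_prop)
  have h2 := hlim (fun ε => sumNorm κ (m + ε • j + h) ^ 2 + sumNorm κ (m + ε • j - h) ^ 2)
    (by fun_prop)
  simpa using le_of_tendsto_of_tendsto h1 h2 hev

theorem differentiable_sumNorm_sq {n : ℕ} {κ : ℝ} (hκ1 : 1 < κ) (hκ2 : κ ≤ 2) :
    Differentiable ℝ fun x : Vec n => sumNorm κ x ^ 2 := by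
  simp only [sumNorm_sq]
  have h : Differentiable ℝ fun x : Vec n => ∑ i, |x i| ^ κ :=
    Differentiable.fun_sum fun i _ => by
      have h1 : Differentiable ℝ fun t : ℝ => |t| ^ κ := fun t =>
        (hasDerivAt_abs_rpow t hκ1).differentiableAt
      exact h1.comp (g := fun t : ℝ => |t| ^ κ) (f := fun x : Vec n => x i) (by fun_prop)
  exact fun x => (h x).rpow_const (Or.inr ((one_le_div (by linarith)).2 hκ2))

/-- Subtracting the quadratic `c s² / 2` leaves `Φ` with `2 Φ(s/2) ≤ Φ(s)`. Hence the slopes `2^k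
Φ(2^(-k))`, which tend to the derivative at `0`, stay below `Φ(1)`. -/
theorem le_sub_of_midpoint {φ : ℝ → ℝ} {D c : ℝ} (hφ : HasDerivAt φ D 0)
    (h : ∀ s, 2 * φ (s / 2) + c * s ^ 2 / 4 ≤ φ s + φ 0) : D + c / 2 ≤ φ 1 - φ 0 := by
  set Φ : ℝ → ℝ := fun s => φ s - φ 0 - c / 2 * s ^ 2 with hΦ
  have h1 : ∀ s, 2 * Φ (s / 2) ≤ Φ s := fun s => by
    have := h s
    simp only [hΦ]
    linarith
  have h2 : ∀ k : ℕ, 2 ^ k * Φ ((1 / 2) ^ k) ≤ Φ 1 := fun k => by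
    induction k with
    | zero => simp
    | succ k ih =>
      refine le_trans ?_ ih
      have := mul_le_mul_of_nonneg_left (h1 ((1 / 2) ^ k)) (show (0 : ℝ) ≤ 2 ^ k by positivity)
      refine le_trans (le_of_eq ?_) this
      rw [pow_succ, pow_succ (1 / 2 : ℝ)]
      ring_nf
  have hpow : Filter.Tendsto (fun k : ℕ => (1 / 2 : ℝ) ^ k) Filter.atTop (nhds 0) :=
    tendsto_pow_atTop_nhds_zero_of_lt_one (by norm_num) (by norm_num)
  have h3 := (hasDerivAt_iff_tendsto_slope_zero.1 hφ).comp
    (tendsto_nhdsWithin_iff.2 ⟨hpow, Filter.Eventually.of_forall fun k =>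
      (pow_pos (by norm_num : (0 : ℝ) < 1 / 2) k).ne'⟩)
  have h4 := h3.sub (hpow.const_mul (c / 2))
  have h5 : D - c / 2 * 0 ≤ Φ 1 := by
    refine le_of_tendsto h4 (Filter.Eventually.of_forall fun k => le_trans (le_of_eq ?_) (h2 k))
    have e : (2 : ℝ) ^ k * (1 / 2) ^ k = 1 := by rw [← mul_pow]; norm_num
    have e' : ((1 / 2 : ℝ) ^ k)⁻¹ = 2 ^ k := by rw [← inv_pow]; norm_num
    simp only [Function.comp, zero_add, smul_eq_mul, hΦ, e']
    linear_combination (c / 2 * (1 / 2) ^ k) * e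
  simp only [hΦ] at h5
  linarith

/-- The squared `κ`-norm is `(κ - 1)`-strongly convex with respect to itself. -/
theorem sumNorm_sq_strongly_convex {n : ℕ} {κ : ℝ} (hκ1 : 1 < κ) (hκ2 : κ ≤ 2) (x y : Vec n) :
    (κ - 1) * sumNorm κ (y - x) ^ 2 ≤ sumNorm κ y ^ 2 - sumNorm κ x ^ 2
      - ⟪gradient (fun x : Vec n => sumNorm κ x ^ 2) x, y - x⟫ := by
  set f := fun x : Vec n => sumNorm κ x ^ 2
  set h := y - x with hh
  have hf : HasFDerivAt f (innerSL ℝ (gradient f x)) (x + (0 : ℝ) • h) := by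
    rw [zero_smul, add_zero]
    exact (differentiable_sumNorm_sq hκ1 hκ2 x).hasGradientAt.hasFDerivAt
  have hline : HasDerivAt (fun s : ℝ => x + s • h) h 0 := by
    simpa using ((hasDerivAt_id (0 : ℝ)).smul_const h).const_add x
  have hφ : HasDerivAt (fun s : ℝ => f (x + s • h)) ⟪gradient f x, h⟫ 0 :=
    HasFDerivAt.comp_hasDerivAt (f := fun s : ℝ => x + s • h) (0 : ℝ) hf hline
  have := le_sub_of_midpoint (c := 2 * ((κ - 1) * sumNorm κ h ^ 2)) hφ fun s => by
    have h1 := sumNorm_two_point hκ1.le hκ2 (x + (s / 2) • h) ((s / 2) • h)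
    have e1 : x + (s / 2) • h + (s / 2) • h = x + s • h := by
      rw [add_assoc, ← add_smul, add_halves]
    rw [e1, add_sub_cancel_right, sumNorm_smul (by linarith), mul_pow, sq_abs] at h1
    simp only [f, zero_smul, add_zero]
    linarith
  simp only [one_smul, zero_smul, add_zero, hh, add_sub_cancel] at this
  linarith

/-! ### The standard prox-functions. -/

theorem proxTwo_isProxFunction (n : ℕ) : IsProxFunction 2 (proxTwo n) := by
  have hg : ∀ x : Vec n, HasGradientAt (proxTwo n) x x := fun x => by
    have h := ((hasStrictFDerivAt_norm_sq x).hasFDerivAt.const_mul (1 / 2 : ℝ))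
    have e : (1 / 2 : ℝ) • (2 • innerSL ℝ x) = innerSL ℝ x := by
      ext v; simp
    rw [e] at h
    exact hasGradientAt_iff_hasFDerivAt.2 h
  refine ⟨fun x => (hg x).differentiableAt, fun x y => ?_, ⟨0, by simp [proxTwo]⟩, ?_⟩
  · rw [(hg x).gradient, pNorm_eq_sumNorm (by norm_num), ENNReal.toReal_ofNat, sumNorm_two,
      norm_sub_sq_real, inner_sub_right, real_inner_self_eq_norm_sq, proxTwo, proxTwo,
      real_inner_comm]
    linarith
  · rintro _ ⟨x, rfl⟩
    exact mul_nonneg (by norm_num) (sq_nonneg _)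

theorem gradient_const_mul {n : ℕ} {f : Vec n → ℝ} (c : ℝ) {x : Vec n}
    (hf : DifferentiableAt ℝ f x) :
    gradient (fun y => c * f y) x = c • gradient f x := by
  rw [gradient, gradient, fderiv_const_mul hf, map_smul]

theorem kappa_bounds {n : ℕ} (hn : 8 ≤ n) : 1 < kappa n ∧ kappa n ≤ 2 := by
  have hl := two_le_log hn
  refine ⟨lt_add_of_pos_right _ (by positivity), ?_⟩
  have : 1 / Real.log n ≤ 1 := (div_le_one (by linarith)).2 (by linarith)
  rw [kappa]
  linarith

theorem rpow_kappa_sub_one {n : ℕ} (hn : 8 ≤ n) : (n : ℝ) ^ (kappa n - 1) = Real.exp 1 := by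
  have hl := two_le_log hn
  have hn0 : (0 : ℝ) < n := by exact_mod_cast (by omega : 0 < n)
  rw [Real.rpow_def_of_pos hn0, kappa]
  congr 1
  field_simp
  ring

theorem proxOne_eq {n : ℕ} (hn : 8 ≤ n) (x : Vec n) :
    proxOne n x = Real.exp 1 * (n : ℝ) ^ ((kappa n - 1) * (2 - kappa n) / kappa n) * Real.log n / 2
      * sumNorm (kappa n) x ^ 2 := by
  have hκ : 0 < kappa n := by linarith [(kappa_bounds hn).1]
  rw [proxOne, pNorm_eq_sumNorm (by rwa [ENNReal.toReal_ofReal hκ.le]),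
    ENNReal.toReal_ofReal hκ.le]

theorem proxOne_isProxFunction {n : ℕ} (hn : 8 ≤ n) : IsProxFunction 1 (proxOne n) := by
  obtain ⟨hκ1, hκ2⟩ := kappa_bounds hn
  have hl := two_le_log hn
  have hn0 : (0 : ℝ) < n := by exact_mod_cast (by omega : 0 < n)
  have hdiff := differentiable_sumNorm_sq (n := n) hκ1 hκ2
  rw [show proxOne n = _ from funext fun x => proxOne_eq hn x]
  set K := Real.exp 1 * (n : ℝ) ^ ((kappa n - 1) * (2 - kappa n) / kappa n) * Real.log n with hK
  have hK0 : 0 ≤ K := by positivity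
  -- The scaling of `d₁` is chosen for this: since `(κ - 1) ln n = 1` and `e = n ^ (κ - 1)`, the
  -- modulus `K (κ - 1)` is the square of the constant comparing the `1`-norm with the `κ`-norm.
  have hKκ : K * (kappa n - 1) = ((n : ℝ) ^ (1 - 1 / kappa n)) ^ 2 := by
    have hκl : Real.log n * (kappa n - 1) = 1 := by rw [kappa]; field_simp; ring
    rw [hK, ← rpow_kappa_sub_one hn, ← Real.rpow_add hn0, mul_assoc, hκl, mul_one,
      ← Real.rpow_mul_natCast hn0.le]
    congr 1
    push_cast
    field_simp
    ring
  refine ⟨hdiff.const_mul _, fun x y => ?_, ⟨0, ?_⟩, ?_⟩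
  · rw [gradient_const_mul _ (hdiff x), real_inner_smul_left, pNorm_eq_sumNorm (by norm_num),
      ENNReal.toReal_one]
    have h1 := mul_le_mul_of_nonneg_left (sumNorm_sq_strongly_convex hκ1 hκ2 x y)
      (show 0 ≤ K / 2 by positivity)
    have h2 := pow_le_pow_left₀ (sumNorm_nonneg _ _)
      (sumNorm_le_rpow_mul_sumNorm hκ1 (y - x)) 2
    rw [mul_pow, ← hKκ] at h2
    linarith
  · simp [sumNorm_sq, Real.zero_rpow (by linarith : kappa n ≠ 0),
      Real.zero_rpow (by positivity : 2 / kappa n ≠ 0)]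
  · rintro _ ⟨x, rfl⟩
    positivity

theorem stdProx_isProxFunction {n : ℕ} (hn : 8 ≤ n) {p : ℝ≥0∞} (hp : p = 1 ∨ p = 2) :
    IsProxFunction p (stdProx n p) := by
  rcases hp with rfl | rfl
  · rw [stdProx, if_pos rfl]
    exact proxOne_isProxFunction hn
  · rw [stdProx, if_neg (by norm_num)]
    exact proxTwo_isProxFunction n

/-! ### The complexity in terms of the distance. -/

theorem gradient_comp_sub {n : ℕ} (d : Vec n → ℝ) (a x : Vec n) :
    gradient (fun z => d (z - a)) x = gradient d (x - a) := by
  rw [gradient, gradient, fderiv_comp_sub]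

theorem IsProxFunction.comp_sub {n : ℕ} {p : ℝ≥0∞} {d : Vec n → ℝ} (hd : IsProxFunction p d)
    (a : Vec n) : IsProxFunction p (fun z => d (z - a)) := by
  refine ⟨hd.differentiable.comp (differentiable_id.sub_const a), fun x y => ?_, ?_, ?_⟩
  · have := hd.strongly_convex (x - a) (y - a)
    rwa [sub_sub_sub_cancel_right, ← gradient_comp_sub] at this
  · obtain ⟨x, hx⟩ := hd.min_eq_zero.1
    exact ⟨x + a, by simpa using hx⟩
  · rintro _ ⟨x, rfl⟩
    exact hd.min_eq_zero.2 ⟨x - a, rfl⟩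

/-- The translated prox-function is centred at its minimizer, where the gradient vanishes. -/
theorem IsProxFunction.bregman_comp_sub {n : ℕ} {p : ℝ≥0∞} {d : Vec n → ℝ}
    (hd : IsProxFunction p d) (h0 : d 0 = 0) (a x : Vec n) :
    bregman (fun z => d (z - a)) a x = d (x - a) := by
  have hmin : IsLocalMin d 0 := Filter.Eventually.of_forall fun y =>
    h0.le.trans (hd.min_eq_zero.2 ⟨y, rfl⟩)
  have hg : gradient d 0 = 0 := by rw [gradient, hmin.fderiv_eq_zero, map_zero]
  rw [bregman, gradient_comp_sub, sub_self, hg, h0, inner_zero_left]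
  ring

theorem stdProx_zero {n : ℕ} (hn : 8 ≤ n) (p : ℝ≥0∞) : stdProx n p 0 = 0 := by
  obtain ⟨hκ1, -⟩ := kappa_bounds hn
  rw [stdProx]
  split_ifs
  · simp [proxOne_eq hn, sumNorm_sq, Real.zero_rpow (by linarith : kappa n ≠ 0),
      Real.zero_rpow (by positivity : 2 / kappa n ≠ 0)]
  · simp [proxTwo]

/-- For `p = 1` the power of `n` is at most `n ^ (κ - 1) = e`, and `e² / 2 ≤ 4`; for `p = 2` there
is ample room. -/
theorem stdProx_le {n : ℕ} (hn : 8 ≤ n) {p : ℝ≥0∞} (hp : p = 1 ∨ p = 2) (x : Vec n) :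
    stdProx n p x ≤ 4 * Real.log n * pNorm p x ^ 2 := by
  have hl := two_le_log hn
  have hn1 : (1 : ℝ) ≤ n := by exact_mod_cast (by omega : 1 ≤ n)
  rcases hp with rfl | rfl
  · obtain ⟨hκ1, hκ2⟩ := kappa_bounds hn
    rw [stdProx, if_pos rfl, proxOne_eq hn, pNorm_eq_sumNorm (by norm_num), ENNReal.toReal_one]
    have h1 : (n : ℝ) ^ ((kappa n - 1) * (2 - kappa n) / kappa n) ≤ Real.exp 1 := by
      rw [← rpow_kappa_sub_one hn]
      refine Real.rpow_le_rpow_of_exponent_le hn1 ?_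
      rw [div_le_iff₀ (by linarith)]
      exact mul_le_mul_of_nonneg_left (by linarith) (by linarith)
    have h2 : sumNorm (kappa n) x ^ 2 ≤ sumNorm 1 x ^ 2 :=
      pow_le_pow_left₀ (sumNorm_nonneg _ _) (sumNorm_le_sumNorm one_pos hκ1.le x) 2
    have h3 : Real.exp 1 * Real.exp 1 ≤ 8 := by
      have := Real.exp_one_lt_d9
      have := Real.exp_pos 1
      nlinarith
    have h4 := mul_le_mul_of_nonneg_left h1 (Real.exp_pos 1).le
    have h5 := mul_le_mul_of_nonneg_right (h4.trans h3) (show 0 ≤ Real.log n by linarith)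
    exact mul_le_mul (by linarith) h2 (sq_nonneg _) (by positivity)
  · rw [stdProx, if_neg (by norm_num), proxTwo, pNorm_eq_sumNorm (by norm_num),
      ENNReal.toReal_ofNat, sumNorm_two]
    exact mul_le_mul_of_nonneg_right (by linarith) (sq_nonneg _)

theorem pNorm_sub_rev {n : ℕ} {p : ℝ≥0∞} (hp : 0 < p.toReal) (x y : Vec n) :
    pNorm p (x - y) = pNorm p (y - x) := by
  simp only [pNorm_eq_sumNorm hp, sumNorm, PiLp.sub_apply, abs_sub_comm]

theorem noise_level_mono {l a b Δ : ℝ} (hl : 1 ≤ l) (ha : 0 ≤ a) (hb : 0 ≤ b)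
    (h : 64000000 * l ^ 2 * Δ ≤ min a b) : 1000000 * Δ ≤ min (a / (4 * l)) b := by
  obtain ⟨h1, h2⟩ := le_min_iff.1 h
  -- A noise level may be negative here, in which case multiplying by powers of `l` reverses the
  -- inequalities.
  rcases le_total Δ 0 with hΔ | hΔ
  · exact le_min ((by linarith : 1000000 * Δ ≤ 0).trans (by positivity)) (by linarith)
  · have h3 : l * Δ ≤ l ^ 2 * Δ := mul_le_mul_of_nonneg_right (by nlinarith) hΔ
    have h4 : 1 * Δ ≤ l * Δ := mul_le_mul_of_nonneg_right hl hΔ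
    refine le_min ?_ (by linarith)
    rw [le_div_iff₀ (by linarith)]
    linarith

/-- The complexity in terms of the distance from the starting point. -/
theorem rdd_complexity_dist {n : ℕ} {p q : ℝ≥0∞} {L₂ σ R ε : ℝ} (hn : 8 ≤ n) (hp : p = 1 ∨ p = 2)
    (hpq : p⁻¹ + q⁻¹ = 1) (hL : 0 < L₂) (hR : 0 < R) (hε : 0 < ε) :
    ∃ N m : ℕ, 1 ≤ N ∧ 1 ≤ m ∧
      (N * m : ℝ) ≤ 64000000 * Real.log n ^ 2 * max 1
        (max ((n : ℝ) ^ (2 * (q⁻¹).toReal) * L₂ * R ^ 2 / ε)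
          ((n : ℝ) ^ (2 * (q⁻¹).toReal) * σ ^ 2 * R ^ 2 / ε ^ 2)) ∧
      ∀ (x₀ xs : Vec n) (Δζ Δη : ℝ),
        pNorm p (x₀ - xs) ≤ R →
        64000000 * Real.log n ^ 2 * Δζ ≤ min (ε ^ 2 / (n * R ^ 2)) (ε * L₂ / n) →
        64000000 * Real.log n ^ 2 * Δη ^ 2 ≤ min (ε ^ 2 / (n * R ^ 2)) (ε * L₂ / n) →
        RDDErrorAtMost.{u, v} n N m q (fun z => stdProx n p (z - x₀)) x₀ xs
          L₂ σ Δζ Δη ε := by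
  have hl := two_le_log hn
  have hn0 : (0 : ℝ) < n := by exact_mod_cast (by omega : 0 < n)
  have hp1 : 1 ≤ p := by rcases hp with rfl | rfl <;> norm_num
  have hp2 : p ≤ 2 := by rcases hp with rfl | rfl <;> norm_num
  have hpt : 0 < p.toReal := by rcases hp with rfl | rfl <;> norm_num
  -- `Θ = 4 ln n R²` by `stdProx_le`. Together with `n ρ_n ≤ 16 ln n n^(2/q)` this produces the
  -- factor `64 (ln n)²`.
  obtain ⟨N, m, hN, hm, -, -, hNm, H⟩ := rdd_complexity.{u, v} (σ := σ)
    (Θ := 4 * Real.log n * R ^ 2)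
    hn hp1 hp2 hpq hL (by positivity) hε
  have hρ := mul_rho_le hn (inv_toReal_le_half hp2 hpq).2
  set l := Real.log n with hlog
  set M := (n : ℝ) ^ (2 * (q⁻¹).toReal) with hM
  have hM0 : 0 < M := Real.rpow_pos_of_pos hn0 _
  refine ⟨N, m, hN, hm, hNm.trans ?_, fun x₀ xs Δζ Δη hx hζ hη => ?_⟩
  · have hl2 : 1 ≤ 64 * l ^ 2 := by nlinarith
    have key : ∀ s : ℝ, 0 ≤ s → n * rho n q * (4 * l * R ^ 2) * s
        ≤ 64 * l ^ 2 * (M * R ^ 2 * s) := fun s hs => by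
      have := mul_le_mul_of_nonneg_right hρ (show 0 ≤ 4 * l * R ^ 2 * s by positivity)
      linarith
    have e : (64000000 : ℝ) * l ^ 2 * max 1 (max (M * L₂ * R ^ 2 / ε) (M * σ ^ 2 * R ^ 2 / ε ^ 2))
        = 1000000 * (64 * l ^ 2 * max 1
          (max (M * L₂ * R ^ 2 / ε) (M * σ ^ 2 * R ^ 2 / ε ^ 2))) := by ring
    rw [e]
    refine mul_le_mul_of_nonneg_left ?_ (by norm_num)
    have hl0 : 0 ≤ 64 * l ^ 2 := by linarith
    rw [mul_max_of_nonneg _ _ hl0, mul_max_of_nonneg _ _ hl0]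
    refine max_le_max (by linarith) (max_le_max ?_ ?_)
    · have := key (L₂ / ε) (by positivity)
      refine (le_of_eq ?_).trans (this.trans (le_of_eq ?_)) <;> ring
    · have := key (σ ^ 2 / ε ^ 2) (by positivity)
      refine (le_of_eq ?_).trans (this.trans (le_of_eq ?_)) <;> ring
  · have hd := stdProx_isProxFunction hn hp
    have e : ε ^ 2 / (n * (4 * l * R ^ 2)) = ε ^ 2 / (n * R ^ 2) / (4 * l) := by
      rw [div_div]; ring_nf
    refine H _ x₀ xs Δζ Δη (hd.comp_sub x₀) ?_ ?_ ?_
    · rw [hd.bregman_comp_sub (stdProx_zero hn p)]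
      refine (stdProx_le hn hp _).trans ?_
      rw [pNorm_sub_rev hpt]
      have : 0 ≤ pNorm p (x₀ - xs) := by rw [pNorm_eq_sumNorm hpt]; exact sumNorm_nonneg _ _
      gcongr
    · rw [e]
      exact noise_level_mono (by linarith) (by positivity) (by positivity) hζ
    · rw [e]
      exact noise_level_mono (by linarith) (by positivity) (by positivity) hη

theorem theorem2 :
    -- the functions chosen for `p = 1` and `p = 2` are prox-functions
    (∀ n : ℕ, 8 ≤ n →
      IsProxFunction 1 (stdProx n 1) ∧ IsProxFunction 2 (stdProx n 2)) ∧
    -- the convergence bound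
    (∀ (n N m : ℕ) (p q : ℝ≥0∞) (d : Vec n → ℝ) (x₀ xs : Vec n) (L₂ σ Δζ Δη : ℝ),
      8 ≤ n → 1 ≤ N → 1 ≤ m → 1 ≤ p → p ≤ 2 → p⁻¹ + q⁻¹ = 1 →
      IsProxFunction p d → 0 < L₂ →
      RDDErrorAtMost.{u, v} n N m q d x₀ xs L₂ σ Δζ Δη
        (384 * n * rho n q * L₂ * bregman d x₀ xs / N
          + 2 / L₂ * (σ ^ 2 / m)
          + n / (12 * L₂) * Δζ
          + 4 * n / (3 * L₂) * Δη ^ 2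
          + 8 * √(2 * n * bregman d x₀ xs) / N * (√Δζ / 2 + 2 * Δη)
          + N / (3 * L₂ * rho n q) * (√Δζ / 2 + 2 * Δη) ^ 2)) ∧
    -- the complexity in terms of `Θ_p = V[x₀](x_*)`, with the parameters that give it
    (∃ C : ℝ, 0 < C ∧
      ∀ (n : ℕ) (p q : ℝ≥0∞) (L₂ σ Θ ε : ℝ),
        8 ≤ n → 1 ≤ p → p ≤ 2 → p⁻¹ + q⁻¹ = 1 → 0 < L₂ → 0 ≤ σ → 0 < Θ → 0 < ε →
        ∃ N m : ℕ, 1 ≤ N ∧ 1 ≤ m ∧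
          (N : ℝ) ≤ C * max 1 (n * rho n q * L₂ * Θ / ε) ∧
          (m : ℝ) ≤ C * max 1 (σ ^ 2 / (ε * L₂)) ∧
          (N * m : ℝ) ≤ C * max 1
            (max (n * rho n q * L₂ * Θ / ε) (n * rho n q * σ ^ 2 * Θ / ε ^ 2)) ∧
          ∀ (d : Vec n → ℝ) (x₀ xs : Vec n) (Δζ Δη : ℝ),
            IsProxFunction p d → bregman d x₀ xs ≤ Θ →
            C * Δζ ≤ min (ε ^ 2 / (n * Θ)) (ε * L₂ / n) →
            C * Δη ^ 2 ≤ min (ε ^ 2 / (n * Θ)) (ε * L₂ / n) →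
            RDDErrorAtMost.{u, v} n N m q d x₀ xs L₂ σ Δζ Δη ε) ∧
    -- the complexity in terms of the distance `R_p` from the starting point to the solution
    (∃ (C : ℝ) (c : ℕ), 0 < C ∧
      ∀ (n : ℕ) (p q : ℝ≥0∞) (L₂ σ R ε : ℝ),
        8 ≤ n → (p = 1 ∨ p = 2) → p⁻¹ + q⁻¹ = 1 → 0 < L₂ → 0 ≤ σ → 0 < R → 0 < ε →
        ∃ N m : ℕ, 1 ≤ N ∧ 1 ≤ m ∧
          (N * m : ℝ) ≤ C * Real.log n ^ c * max 1
            (max ((n : ℝ) ^ (2 * (q⁻¹).toReal) * L₂ * R ^ 2 / ε)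
              ((n : ℝ) ^ (2 * (q⁻¹).toReal) * σ ^ 2 * R ^ 2 / ε ^ 2)) ∧
          ∀ (x₀ xs : Vec n) (Δζ Δη : ℝ),
            pNorm p (x₀ - xs) ≤ R →
            C * Real.log n ^ c * Δζ ≤ min (ε ^ 2 / (n * R ^ 2)) (ε * L₂ / n) →
            C * Real.log n ^ c * Δη ^ 2 ≤ min (ε ^ 2 / (n * R ^ 2)) (ε * L₂ / n) →
            RDDErrorAtMost.{u, v} n N m q (fun z => stdProx n p (z - x₀)) x₀ xs
              L₂ σ Δζ Δη ε) := by
  refine ⟨fun n hn => ⟨stdProx_isProxFunction hn (Or.inl rfl),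
    stdProx_isProxFunction hn (Or.inr rfl)⟩, ?_, ⟨1000000, by norm_num, ?_⟩,
    ⟨64000000, 2, by norm_num, ?_⟩⟩
  · intro n N m p q d x₀ xs L₂ σ Δζ Δη hn hN hm hp1 hp2 hpq hd hL
    exact rdd_error x₀ xs σ Δζ Δη hn hN hm hp1 hp2 hpq hd hL
  · intro n p q L₂ σ Θ ε hn hp1 hp2 hpq hL _ hΘ hε
    exact rdd_complexity hn hp1 hp2 hpq hL hΘ hε
  · intro n p q L₂ σ R ε hn hp hpq hL _ hR hε
    exact rdd_complexity_dist hn hp hpq hL hR hε
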